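/- Let $\Omega$ be a Polish space, $\mathbb P$ a Borel probability measure on $\Omega$ and $\mathcal F$ the $\mathbb P$-completion of the Borel $\sigma$-algebra. Let $(\tau_x)_{x\in\mathbb R}$ be a group of transformations of $\Omega$ ($\tau_0=\mathrm{id}$, $\tau_{x+y}=\tau_x\circ\tau_y$) such that $(x,\omega)\mapsto\tau_x\omega$ is measurable from $\mathcal B(\mathbb R)\otimes\mathcal F$ to the Borel $\sigma$-algebra of $\Omega$, $\mathbb P(\tau_x(E))=\mathbb P(E)$ for all $x$ and all measurable $E$, and which is ergodic: every measurable $\varphi:\Omega\to\mathbb R$ with $\varphi\circ\tau_x=\varphi$ almost surely for each $x\in\mathbb R$ is almost surely constant. Let $a:\mathbb R\times\Omega\to[0,1]$ and $H:\mathbb R\times\mathbb R\times\Omega\to\mathbb R$ be jointly measurable and stationary, $a(x+y,\omega)=a(x,\tau_y\omega)$ and $H(x+y,p,\omega)=H(x,p,\tau_y\omega)$ for all $x,y,p,\omega$. Assume that almost surely $a(\cdot,\omega)\not\equiv0$ and $\min_{\mathbb R}a(\cdot,\omega)=0$; that for some $\kappa>0$ the function $\sqrt{a(\cdot,\omega)}$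 is $\kappa$-Lipschitz for every $\omega$; and that, for some constants $\alpha_0,\alpha_1,\eta>0$ and $\gamma>2$ and for every $\omega$, the function $h(x,p)=H(x,p,\omega)$ satisfies, for all $x,y,p,q\in\mathbb R$, 1. $\alpha_0|p|^\gamma-1/\alpha_0\le h(x,p)\le\alpha_1(|p|^\gamma+1)$; 2. $|h(x,p)-h(x,q)|\le\alpha_1(|p|+|q|+1)^{\gamma-1}|p-q|$; 3. $|h(x,p)-h(y,p)|\le\alpha_1(|p|^\gamma+1)|x-y|$; 4. $h(x,(1-s)p+sq)<\max\{h(x,p),h(x,q)\}$ whenever $p\ne q$ and $0<s<1$; 5. if $\hat p(x)$ is the minimizer of $h(x,\cdot)$, then $h(x,p_1)-h(x,p_2)\ge\eta|p_1-p_2|$ for $p_1<p_2\le\hat p(x)$ and $h(x,p_2)-h(x,p_1)\ge\eta|p_1-p_2|$ for $\hat p(x)\le p_1<p_2$. For $\lambda\in\mathbb R$ consider the equation $$a(x,\omega)u''+H(x,u',\omega)=\lambda\quad\text{in }\mathbb R, \tag{$\mathrm{HJ}_\lambda(\omega)$}$$ understood in the viscosity sense with continuous $u$ (for a supersolution $a\varphi''+H\le\lambda$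 where a $C^2$ function $\varphi$ touches $u$ from below; for a subsolution $a\varphi''+H\ge\lambda$ where it touches from above). Then there is a constant $\lambda_0\in\mathbb R$ such that almost surely $\lambda_0$ is the infimum of the $\lambda$ for which $(\mathrm{HJ}_\lambda(\omega))$ has a viscosity supersolution, and almost surely $(\mathrm{HJ}_{\lambda_0}(\omega))$ has a Lipschitz solution vanishing at $0$. Moreover, for every choice, for almost every $\omega$, of such a solution $u_{\lambda_0}(\cdot,\omega)$ (no measurability in $\omega$ is required), the following holds. Almost surely, for every $\lambda>\lambda_0$ there is exactly one Lipschitz solution $u=u^+_\lambda(\cdot,\omega)$ of $(\mathrm{HJ}_\lambda(\omega))$ with $u(0)=0$ and $u'\ge u_{\lambda_0}'(\cdot,\omega)$ almost everywhere, exactly one Lipschitz solution $u=u^-_\lambda(\cdot,\omega)$ with $u(0)=0$ and $u'\le u_{\lambda_0}'(\cdot,\omega)$ almost everywhere, and both are of class $C^1$. For $\lambda>\lambda_0$ the random variables $(u^\pm_\lambda)'(0,\omega)$ are integrable, and: (i) Set $\theta^+(\lambda)=\mathbb E[(u^+_\lambda)'(0,\omega)]$ for $\lambda>\lambda_0$ and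 $\theta^+(\lambda_0)=\inf_{\lambda>\lambda_0}\theta^+(\lambda)$. The infimum is finite, and $\theta^+$ is continuous and strictly increasing on $[\lambda_0,\infty)$, with $\theta^+(\lambda)\to+\infty$ as $\lambda\to+\infty$; in particular $\theta^+$ maps $(\lambda_0,\infty)$ into $(\theta^+(\lambda_0),\infty)$. (ii) Set $\theta^-(\lambda)=\mathbb E[(u^-_\lambda)'(0,\omega)]$ for $\lambda>\lambda_0$ and $\theta^-(\lambda_0)=\sup_{\lambda>\lambda_0}\theta^-(\lambda)$. The supremum is finite, and $\theta^-$ is continuous and strictly decreasing on $[\lambda_0,\infty)$, with $\theta^-(\lambda)\to-\infty$ as $\lambda\to+\infty$; in particular $\theta^-$ maps $(\lambda_0,\infty)$ into $(-\infty,\theta^-(\lambda_0))$. -/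

import Mathlib

open MeasureTheory Set Filter Topology

noncomputable section

/-- `τ` is a one-parameter group of transformations of `Ω` that is measurable, preserves `P` and is
ergodic. The `σ`-algebra `𝓕` of events is the `P`-completion of the given (Borel) one, which is
`NullMeasurableSpace Ω P`. -/
structure IsErgodicFlow {Ω : Type*} [MeasurableSpace Ω] (P : Measure Ω) (τ : ℝ → Ω → Ω) :
    Prop where
  measurable : Measurable (fun q : ℝ × NullMeasurableSpace Ω P => (τ q.1 q.2 : Ω))
  zero : ∀ ω, τ 0 ω = ω
  add : ∀ x y ω, τ (x + y) ω = τ x (τ y ω)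
  invariant : ∀ (x : ℝ) (E : Set Ω), MeasurableSet E → P (τ x '' E) = P E
  ergodic : ∀ φ : Ω → ℝ, Measurable φ → (∀ x : ℝ, ∀ᵐ ω ∂P, φ (τ x ω) = φ ω) →
    ∃ c : ℝ, ∀ᵐ ω ∂P, φ ω = c

/-- The class `𝓗(α₀, α₁, γ)` of Hamiltonians `h(x, p)`. -/
structure IsHamiltonian (α₀ α₁ γ : ℝ) (h : ℝ → ℝ → ℝ) : Prop where
  lower : ∀ x p, α₀ * |p| ^ γ - 1 / α₀ ≤ h x p
  upper : ∀ x p, h x p ≤ α₁ * (|p| ^ γ + 1)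
  lip_p : ∀ x p q, |h x p - h x q| ≤ α₁ * (|p| + |q| + 1) ^ (γ - 1) * |p - q|
  lip_x : ∀ x y p, |h x p - h y p| ≤ α₁ * (|p| ^ γ + 1) * |x - y|

/-- The class `𝓗_sqc(α₀, α₁, γ, η)`: strictly quasiconvex Hamiltonians in `𝓗(α₀, α₁, γ)` with
slope at least `η` on either side of the minimizer `p̂` of `h(x, ·)` (which exists, by coercivity,
and is unique, by strict quasiconvexity). -/
structure IsSqcHamiltonian (α₀ α₁ γ η : ℝ) (h : ℝ → ℝ → ℝ) : Prop
    extends IsHamiltonian α₀ α₁ γ h where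
  strict_quasiconvex : ∀ x p₀ p₁ s : ℝ, p₀ ≠ p₁ → 0 < s → s < 1 →
    h x ((1 - s) * p₀ + s * p₁) < max (h x p₀) (h x p₁)
  slope_left : ∀ x pmin : ℝ, (∀ p, h x pmin ≤ h x p) →
    ∀ p₁ p₂ : ℝ, p₁ < p₂ → p₂ ≤ pmin → η * |p₁ - p₂| ≤ h x p₁ - h x p₂
  slope_right : ∀ x pmin : ℝ, (∀ p, h x pmin ≤ h x p) →
    ∀ p₁ p₂ : ℝ, pmin ≤ p₁ → p₁ < p₂ → η * |p₁ - p₂| ≤ h x p₂ - h x p₁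

/-- `u` is a (continuous) viscosity supersolution of `a u'' + h(x, u') = l` in `ℝ`: wherever a `C²`
function `φ` touches `u` from below, `a φ'' + h(x, φ') ≤ l`. -/
def IsViscositySupersolution (a : ℝ → ℝ) (h : ℝ → ℝ → ℝ) (l : ℝ) (u : ℝ → ℝ) : Prop :=
  Continuous u ∧ ∀ (φ : ℝ → ℝ) (x₀ : ℝ), ContDiff ℝ 2 φ → IsLocalMin (fun x => u x - φ x) x₀ →
    a x₀ * deriv (deriv φ) x₀ + h x₀ (deriv φ x₀) ≤ l

/-- `u` is a (continuous) viscosity subsolution of `a u'' + h(x, u') = l` in `ℝ`: wherever a `C²`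
function `φ` touches `u` from above, `a φ'' + h(x, φ') ≥ l`. -/
def IsViscositySubsolution (a : ℝ → ℝ) (h : ℝ → ℝ → ℝ) (l : ℝ) (u : ℝ → ℝ) : Prop :=
  Continuous u ∧ ∀ (φ : ℝ → ℝ) (x₀ : ℝ), ContDiff ℝ 2 φ → IsLocalMax (fun x => u x - φ x) x₀ →
    l ≤ a x₀ * deriv (deriv φ) x₀ + h x₀ (deriv φ x₀)

/-- `u` is a Lipschitz viscosity solution of `a u'' + h(x, u') = l` in `ℝ`, with `u(0) = 0`. -/
structure IsLipschitzSolution (a : ℝ → ℝ) (h : ℝ → ℝ → ℝ) (l : ℝ) (u : ℝ → ℝ) : Prop where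
  supersolution : IsViscositySupersolution a h l u
  subsolution : IsViscositySubsolution a h l u
  lipschitz : ∃ K : NNReal, LipschitzWith K u
  at_zero : u 0 = 0

/-- `l₀` is the critical value: the infimum, finite, of the `l` for which `a u'' + h(x, u') = l`
has a continuous viscosity supersolution. -/
def IsCriticalValue (a : ℝ → ℝ) (h : ℝ → ℝ → ℝ) (l₀ : ℝ) : Prop :=
  IsGLB {l : ℝ | ∃ u : ℝ → ℝ, IsViscositySupersolution a h l u} l₀

/-- `u` is a Lipschitz solution at level `l` with `u(0) = 0` and `u' ≥ v'` almost everywhere. -/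
def IsUpperCorrector (a : ℝ → ℝ) (h : ℝ → ℝ → ℝ) (v : ℝ → ℝ) (l : ℝ) (u : ℝ → ℝ) : Prop :=
  IsLipschitzSolution a h l u ∧ ∀ᵐ x : ℝ, deriv v x ≤ deriv u x

/-- `u` is a Lipschitz solution at level `l` with `u(0) = 0` and `u' ≤ v'` almost everywhere. -/
def IsLowerCorrector (a : ℝ → ℝ) (h : ℝ → ℝ → ℝ) (v : ℝ → ℝ) (l : ℝ) (u : ℝ → ℝ) : Prop :=
  IsLipschitzSolution a h l u ∧ ∀ᵐ x : ℝ, deriv u x ≤ deriv v x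

/-- The upper corrector `u⁺_l` relative to the critical solution `v` (meaningful when there is
exactly one). -/
def upperCorrector (a : ℝ → ℝ) (h : ℝ → ℝ → ℝ) (v : ℝ → ℝ) (l : ℝ) : ℝ → ℝ :=
  Classical.epsilon (IsUpperCorrector a h v l)

/-- The lower corrector `u⁻_l` relative to the critical solution `v` (meaningful when there is
exactly one). -/
def lowerCorrector (a : ℝ → ℝ) (h : ℝ → ℝ → ℝ) (v : ℝ → ℝ) (l : ℝ) : ℝ → ℝ :=
  Classical.epsilon (IsLowerCorrector a h v l)

/-- The random variable `ω ↦ (u⁺_l)'(0, ω)`. -/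
def upperSlope {Ω : Type*} (a : ℝ → Ω → ℝ) (H : ℝ → ℝ → Ω → ℝ) (v : Ω → ℝ → ℝ) (l : ℝ) (ω : Ω) :
    ℝ :=
  deriv (upperCorrector (fun x => a x ω) (fun x p => H x p ω) (v ω) l) 0

/-- The random variable `ω ↦ (u⁻_l)'(0, ω)`. -/
def lowerSlope {Ω : Type*} (a : ℝ → Ω → ℝ) (H : ℝ → ℝ → Ω → ℝ) (v : Ω → ℝ → ℝ) (l : ℝ) (ω : Ω) :
    ℝ :=
  deriv (lowerCorrector (fun x => a x ω) (fun x p => H x p ω) (v ω) l) 0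

open Classical in
/-- `θ⁺(l) = 𝔼[(u⁺_l)'(0)]` for `l > l₀`, and `θ⁺(l₀) = inf_{l > l₀} θ⁺(l)`. -/
def thetaPlus {Ω : Type*} [MeasurableSpace Ω] (P : Measure Ω) (a : ℝ → Ω → ℝ)
    (H : ℝ → ℝ → Ω → ℝ) (v : Ω → ℝ → ℝ) (l₀ l : ℝ) : ℝ :=
  if l₀ < l then ∫ ω, upperSlope a H v l ω ∂P
  else sInf ((fun m : ℝ => ∫ ω, upperSlope a H v m ω ∂P) '' Ioi l₀)

open Classical in
/-- `θ⁻(l) = 𝔼[(u⁻_l)'(0)]` for `l > l₀`, and `θ⁻(l₀) = sup_{l > l₀} θ⁻(l)`. -/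
def thetaMinus {Ω : Type*} [MeasurableSpace Ω] (P : Measure Ω) (a : ℝ → Ω → ℝ)
    (H : ℝ → ℝ → Ω → ℝ) (v : Ω → ℝ → ℝ) (l₀ l : ℝ) : ℝ :=
  if l₀ < l then ∫ ω, lowerSlope a H v l ω ∂P
  else sSup ((fun m : ℝ => ∫ ω, lowerSlope a H v m ω ∂P) '' Ioi l₀)

end

/-! The probabilistic structure enters in two places. Invariance of `P` under the flow shows that
almost surely `a` has zeros arbitrarily far to the left and to the right (`ae_exists_zero_ge`), and
ergodicity makes the critical value, which is translation invariant and measurable, almost surely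
constant. The rest is deterministic analysis of one realization, axiomatized in `IsEnvironment`,
followed by integration in `ω`.

For a fixed realization, the slope `f = u'` of a solution satisfies `a f' + h(x, f) = l` on each
component of `{a > 0}` and `h(z, f z) = l` at the zeros of `a`. Since `√a` is Lipschitz, `a x ≤ κ²
(x - z)²` near a zero `z`, so `∫ 1 / a` diverges there. A bounded solution of the ODE which lies
above the slope of a supersolution at a lower level is thereby forced towards the largest root of
`h(z, ·) = l`, uniformly over the components near `z` (`exists_forall_abs_sub_topRoot_le`). Two
solutions of the ODE with this limit at the left end of a component coincide, because `h` is
increasing in `p` near the largest root (`eqOn_of_tendsto`). Existence comes from shooting with a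
very large initial slope (`exists_ode_from_large_slope`) and letting the starting point tend to the
end of the component. Gluing the components gives a continuous slope (`exists_isMaxSlope`), hence a
`C¹` corrector.

Any upper corrector has this same slope: viscosity solutions are classical where `a > 0`
(`odeOn_deriv`), and at almost every zero of `a` the first order equation holds pointwise, with the
critical slope below selecting the largest root (`eq_of_isUpperCorrector`). So the corrector does
not depend on the critical solution chosen. Critical solutions themselves are limits of correctors
as the level decreases to the critical one (`exists_solution_of_forall_gt`).

For `θ⁺`, a first contact argument started at a zero of `a` (`lt_of_strict`) shows that the slope is
strictly increasing in the level, and exceeds `p` once the level exceeds the supremum of `h(·, p)`.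
Uniqueness gives continuity in the level, and the a priori slope bound allows dominated convergence.
Measurability is obtained from a countable family of strict subfunctions (`lt_maxSlope_iff`,
`critical_lt_iff`), which also describes the critical value. The statements on `θ⁻` follow by the
reflection `x ↦ -x`. -/

noncomputable section

/-! ### Viscosity inequalities and test functions -/

/-- The standing assumptions on a fixed realization of the coefficients. -/
structure IsEnvironment (α₀ α₁ γ κ : ℝ) (a : ℝ → ℝ) (h : ℝ → ℝ → ℝ) : Prop where
  α₀_pos : 0 < α₀
  α₁_pos : 0 < α₁
  two_lt : 2 < γ
  κ_pos : 0 < κ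
  mem_Icc : ∀ x, a x ∈ Icc (0 : ℝ) 1
  sqrt_lip : ∀ x y, |√(a x) - √(a y)| ≤ κ * |x - y|
  ham : IsHamiltonian α₀ α₁ γ h
  quasiconvex : ∀ x p₀ p₁ s : ℝ, p₀ ≠ p₁ → 0 < s → s < 1 →
    h x ((1 - s) * p₀ + s * p₁) < max (h x p₀) (h x p₁)
  zeros_left : ∀ x, ∃ z ≤ x, a z = 0
  zeros_right : ∀ x, ∃ z ≥ x, a z = 0

/-- Supersolutions, tested at the points of `J` only. -/
def SuperOn (a : ℝ → ℝ) (h : ℝ → ℝ → ℝ) (l : ℝ) (J : Set ℝ) (u : ℝ → ℝ) : Prop :=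
  Continuous u ∧ ∀ (φ : ℝ → ℝ) (x₀ : ℝ), x₀ ∈ J → ContDiff ℝ 2 φ →
    IsLocalMin (fun x => u x - φ x) x₀ → a x₀ * deriv (deriv φ) x₀ + h x₀ (deriv φ x₀) ≤ l

lemma IsViscositySupersolution.superOn {a h l u} (hu : IsViscositySupersolution a h l u)
    (J : Set ℝ) : SuperOn a h l J u :=
  ⟨hu.1, fun φ x₀ _ => hu.2 φ x₀⟩

lemma SuperOn.mono {a h l l' u} {J J' : Set ℝ} (hu : SuperOn a h l J u) (hJ : J' ⊆ J)
    (hl : l ≤ l') : SuperOn a h l' J' u :=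
  ⟨hu.1, fun φ x₀ hx hφ hm => (hu.2 φ x₀ (hJ hx) hφ hm).trans hl⟩

/-- Facts about supersolutions apply to subsolutions after negation. The Hamiltonian `-h(x, -p)` is
no longer coercive, so only facts that do not use coercivity are transferred in this way. -/
lemma IsViscositySubsolution.neg {a h l u} (hu : IsViscositySubsolution a h l u) :
    IsViscositySupersolution a (fun x p => -h x (-p)) (-l) (fun x => -u x) := by
  refine ⟨hu.1.neg, fun φ x₀ hφ hm => ?_⟩
  have h1 := hu.2 (fun x => -φ x) x₀ hφ.neg (by
    have := hm.neg
    refine this.congr (Eventually.of_forall fun x => ?_)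
    simp; ring)
  have e1 : deriv (fun x => -φ x) = fun x => -deriv φ x := by
    ext x; exact deriv.fun_neg
  rw [e1] at h1
  have e2 : deriv (fun x => -deriv φ x) x₀ = -deriv (deriv φ) x₀ := deriv.fun_neg
  rw [e2] at h1
  simp only
  linarith

lemma IsViscositySupersolution.neg {a h l u}
    (hu : IsViscositySupersolution a (fun x p => -h x (-p)) (-l) (fun x => -u x)) :
    IsViscositySubsolution a h l u := by
  refine ⟨hu.1.neg.congr fun x => neg_neg _, fun φ x₀ hφ hm => ?_⟩
  have h1 := hu.2 (fun x => -φ x) x₀ hφ.neg (by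
    have := hm.neg
    refine this.congr (Eventually.of_forall fun x => ?_)
    simp; ring)
  have e1 : deriv (fun x => -φ x) = fun x => -deriv φ x := by
    ext x; exact deriv.fun_neg
  rw [e1] at h1
  have e2 : deriv (fun x => -deriv φ x) x₀ = -deriv (deriv φ) x₀ := deriv.fun_neg
  rw [e2] at h1
  simp only [neg_neg] at h1
  linarith

lemma hasDerivAt_quadratic (A B C x₀ x : ℝ) :
    HasDerivAt (fun x => A + B * (x - x₀) + C * (x - x₀) ^ 2) (B + 2 * C * (x - x₀)) x := by
  have h1 : HasDerivAt (fun x => x - x₀) 1 x := (hasDerivAt_id x).sub_const x₀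
  refine (((h1.const_mul B).const_add A).add ((h1.pow 2).const_mul C)).congr_deriv ?_
  simp; ring

lemma hasDerivAt_affine (B C x₀ x : ℝ) :
    HasDerivAt (fun x => B + C * (x - x₀)) C x := by
  have h1 : HasDerivAt (fun x => x - x₀) 1 x := (hasDerivAt_id x).sub_const x₀
  simpa using (h1.const_mul C).const_add B

lemma deriv_quadratic (A B C x₀ : ℝ) :
    deriv (fun x => A + B * (x - x₀) + C * (x - x₀) ^ 2) = fun x => B + 2 * C * (x - x₀) :=
  funext fun x => (hasDerivAt_quadratic A B C x₀ x).deriv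

lemma deriv_deriv_quadratic (A B C x₀ x : ℝ) :
    deriv (deriv (fun x => A + B * (x - x₀) + C * (x - x₀) ^ 2)) x = 2 * C := by
  rw [deriv_quadratic]
  exact (hasDerivAt_affine _ _ _ _).deriv

lemma contDiff_quadratic (A B C x₀ : ℝ) :
    ContDiff ℝ 2 (fun x => A + B * (x - x₀) + C * (x - x₀) ^ 2) := by fun_prop

/-- A supersolution may be tested by any function that is twice differentiable at the point. -/
lemma SuperOn.touch {a h l J u} (hu : SuperOn a h l J u) {U f : ℝ → ℝ} {c x₀ : ℝ} (hx : x₀ ∈ J)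
    (ha : 0 ≤ a x₀) (hU : ∀ᶠ x in 𝓝 x₀, HasDerivAt U (f x) x) (hf : HasDerivAt f c x₀)
    (hmin : IsLocalMin (fun x => u x - U x) x₀) : a x₀ * c + h x₀ (f x₀) ≤ l := by
  -- Since `U` is twice differentiable only at `x₀`, it is replaced by a parabola whose second
  -- derivative is smaller by `2ε`, which stays below `U` near `x₀`; then `ε → 0`.
  have key : ∀ ε > 0, a x₀ * (c - 2 * ε) + h x₀ (f x₀) ≤ l := by
    intro ε hε
    let φ : ℝ → ℝ := fun x => U x₀ + f x₀ * (x - x₀) + (c / 2 - ε) * (x - x₀) ^ 2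
    have hg : ∀ᶠ x in 𝓝 x₀, HasDerivAt (fun x => U x - φ x)
        (f x - (f x₀ + 2 * (c / 2 - ε) * (x - x₀))) x := by
      filter_upwards [hU] with x hx
      exact hx.sub (hasDerivAt_quadratic _ _ _ _ _)
    have hg' : deriv (fun x => U x - φ x) =ᶠ[𝓝 x₀]
        fun x => f x - (f x₀ + 2 * (c / 2 - ε) * (x - x₀)) := by
      filter_upwards [hg] with x hx using hx.deriv
    have hm2 : IsLocalMin (fun x => U x - φ x) x₀ := by
      apply isLocalMin_of_deriv_deriv_pos
      · rw [hg'.deriv_eq, (hf.fun_sub (hasDerivAt_affine _ _ _ _)).deriv]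
        linarith
      · rw [hg'.eq_of_nhds]; ring
      · exact hg.self_of_nhds.continuousAt
    have hm3 : IsLocalMin (fun x => u x - φ x) x₀ := by
      refine (hmin.add hm2).congr (Eventually.of_forall fun x => ?_)
      simp
    have := hu.2 φ x₀ hx (contDiff_quadratic _ _ _ _) hm3
    rw [deriv_deriv_quadratic, deriv_quadratic] at this
    simp only [sub_self, mul_zero, add_zero] at this
    convert this using 3
    ring
  refine le_of_forall_pos_le_add fun ε hε => ?_
  have h1 := key (ε / (2 * (a x₀ + 1))) (by positivity)
  have h2 : a x₀ * (2 * (ε / (2 * (a x₀ + 1)))) ≤ ε := by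
    have : a x₀ * (2 * (ε / (2 * (a x₀ + 1)))) = (a x₀ / (a x₀ + 1)) * ε := by
      field_simp
    rw [this]
    have : a x₀ / (a x₀ + 1) ≤ 1 := by rw [div_le_one (by linarith)]; linarith
    nlinarith
  nlinarith

/-- Second order necessary condition, in the form needed to check that functions which are
twice differentiable at a point satisfy the viscosity inequality there. -/
lemma deriv_deriv_le_of_isLocalMin {U f φ : ℝ → ℝ} {c x₀ : ℝ} (hφ : ContDiff ℝ 2 φ)
    (hU : ∀ᶠ x in 𝓝 x₀, HasDerivAt U (f x) x) (hf : HasDerivAt f c x₀)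
    (hmin : IsLocalMin (fun x => U x - φ x) x₀) : deriv φ x₀ = f x₀ ∧ deriv (deriv φ) x₀ ≤ c := by
  have hφ1 : Differentiable ℝ φ := hφ.differentiable (by norm_num)
  have hφ2 : Differentiable ℝ (deriv φ) := by
    have : ContDiff ℝ 1 (deriv φ) := by
      rw [← one_add_one_eq_two] at hφ
      exact (contDiff_succ_iff_deriv.1 hφ).2.2
    exact this.differentiable (by norm_num)
  have h1 : deriv φ x₀ = f x₀ := by
    have := hmin.hasDerivAt_eq_zero (hU.self_of_nhds.sub (hφ1 x₀).hasDerivAt)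
    linarith
  refine ⟨h1, ?_⟩
  by_contra hlt
  push Not at hlt
  have hg : ∀ᶠ x in 𝓝 x₀, HasDerivAt (fun x => φ x - U x) (deriv φ x - f x) x := by
    filter_upwards [hU] with x hx
    exact (hφ1 x).hasDerivAt.sub hx
  have hg' : deriv (fun x => φ x - U x) =ᶠ[𝓝 x₀] fun x => deriv φ x - f x := by
    filter_upwards [hg] with x hx using hx.deriv
  have hm2 : IsLocalMin (fun x => φ x - U x) x₀ := by
    apply isLocalMin_of_deriv_deriv_pos
    · rw [hg'.deriv_eq, ((hφ2 x₀).hasDerivAt.fun_sub hf).deriv]; linarith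
    · rw [hg'.eq_of_nhds, h1]; ring
    · exact hg.self_of_nhds.continuousAt
  -- The point `x₀` is now both a local minimum and a local maximum of `φ - U`, so this function is
  -- locally constant, against its positive second derivative.
  have hc : (fun x => φ x - U x) =ᶠ[𝓝 x₀] fun _ => φ x₀ - U x₀ := by
    filter_upwards [hm2, hmin] with x h2 h3
    linarith
  have hd : deriv (fun x => φ x - U x) =ᶠ[𝓝 x₀] fun _ => 0 := by
    filter_upwards [hc.eventually_nhds] with x hx
    rw [Filter.EventuallyEq.deriv_eq hx]; simp
  have : deriv (deriv (fun x => φ x - U x)) x₀ = 0 := by rw [hd.deriv_eq]; simp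
  rw [hg'.deriv_eq, ((hφ2 x₀).hasDerivAt.fun_sub hf).deriv] at this
  linarith

/-- Slopes of functions touching a Lipschitz function from below are bounded. -/
lemma abs_deriv_le_of_isLocalMin {u U : ℝ → ℝ} {K p s t x₀ : ℝ} (hx : x₀ ∈ Ioo s t)
    (hu : ∀ x ∈ Icc s t, ∀ y ∈ Icc s t, |u x - u y| ≤ K * |x - y|) (hU : HasDerivAt U p x₀)
    (hmin : IsLocalMin (fun x => u x - U x) x₀) : |p| ≤ K := by
  have hnhds : Icc s t ∈ 𝓝 x₀ := Icc_mem_nhds hx.1 hx.2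
  have hx' : x₀ ∈ Icc s t := ⟨hx.1.le, hx.2.le⟩
  rw [abs_le]
  constructor
  · have hg : HasDerivAt (fun x => U x + K * (x - x₀)) (p + K) x₀ := by
      simpa using hU.fun_add (hasDerivAt_affine 0 K x₀ x₀)
    by_contra hlt
    have hneg : p + K < 0 := by linarith
    have h1 := (hasDerivAt_iff_tendsto_slope_left_right.1 hg).1
    have h2 := h1.eventually (gt_mem_nhds hneg)
    have h3 : ∀ᶠ x in 𝓝[<] x₀, u x₀ - U x₀ ≤ u x - U x := nhdsWithin_le_nhds hmin
    obtain ⟨x, h2, h3, h4, h5⟩ := (h2.and (h3.and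
      ((Filter.Eventually.filter_mono nhdsWithin_le_nhds hnhds).and self_mem_nhdsWithin))).exists
    have h5' : x < x₀ := h5
    have := hu x h4 x₀ hx'
    rw [slope_def_field, div_lt_iff_of_neg (by linarith)] at h2
    rw [abs_of_neg (by linarith : x - x₀ < 0)] at this
    have := le_abs_self (u x - u x₀)
    nlinarith
  · have hg : HasDerivAt (fun x => U x + (-K) * (x - x₀)) (p + -K) x₀ := by
      simpa using hU.fun_add (hasDerivAt_affine 0 (-K) x₀ x₀)
    by_contra hlt
    have hpos : 0 < p + -K := by linarith
    have h1 := (hasDerivAt_iff_tendsto_slope_left_right.1 hg).2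
    have h2 := h1.eventually (lt_mem_nhds hpos)
    have h3 : ∀ᶠ x in 𝓝[>] x₀, u x₀ - U x₀ ≤ u x - U x := nhdsWithin_le_nhds hmin
    obtain ⟨x, h2, h3, h4, h5⟩ := (h2.and (h3.and
      ((Filter.Eventually.filter_mono nhdsWithin_le_nhds hnhds).and self_mem_nhdsWithin))).exists
    have h5' : x₀ < x := h5
    have := hu x h4 x₀ hx'
    rw [slope_def_field, lt_div_iff₀ (by linarith)] at h2
    rw [abs_of_pos (by linarith : 0 < x - x₀)] at this
    have := le_abs_self (u x - u x₀)
    nlinarith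

end

/-! ### A priori bounds for supersolutions, and their behaviour near zeros of the diffusion -/

noncomputable section

namespace IsEnvironment

variable {α₀ α₁ γ κ : ℝ} {a : ℝ → ℝ} {h : ℝ → ℝ → ℝ}

lemma nonneg (E : IsEnvironment α₀ α₁ γ κ a h) (x : ℝ) : 0 ≤ a x := (E.mem_Icc x).1

lemma le_one (E : IsEnvironment α₀ α₁ γ κ a h) (x : ℝ) : a x ≤ 1 := (E.mem_Icc x).2

lemma pos_of_ne (E : IsEnvironment α₀ α₁ γ κ a h) {x : ℝ} (hx : a x ≠ 0) : 0 < a x :=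
  lt_of_le_of_ne (E.nonneg x) hx.symm

lemma continuous_a (E : IsEnvironment α₀ α₁ γ κ a h) : Continuous a := by
  have h1 : Continuous fun x => √(a x) := by
    have : LipschitzWith ⟨κ, E.κ_pos.le⟩ fun x => √(a x) :=
      LipschitzWith.of_dist_le_mul fun x y => E.sqrt_lip x y
    exact this.continuous
  exact (h1.pow 2).congr fun x => Real.sq_sqrt (E.nonneg x)

/-- The quadratic vanishing of `a` is what makes `∫ 1 / a` diverge at a zero; every barrier near a
zero is built on `1 / (x - z)²`. -/
lemma le_sq (E : IsEnvironment α₀ α₁ γ κ a h) {z : ℝ} (hz : a z = 0) (x : ℝ) :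
    a x ≤ κ ^ 2 * (x - z) ^ 2 := by
  have h1 := E.sqrt_lip x z
  rw [hz, Real.sqrt_zero, sub_zero, abs_of_nonneg (Real.sqrt_nonneg _)] at h1
  calc a x = √(a x) ^ 2 := (Real.sq_sqrt (E.nonneg x)).symm
    _ ≤ (κ * |x - z|) ^ 2 := by gcongr
    _ = κ ^ 2 * (x - z) ^ 2 := by rw [mul_pow, sq_abs]

lemma lip_p_of_le (E : IsEnvironment α₀ α₁ γ κ a h) {K x p q : ℝ} (hp : |p| ≤ K) (hq : |q| ≤ K) :
    |h x p - h x q| ≤ α₁ * (2 * K + 1) ^ (γ - 1) * |p - q| := by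
  refine (E.ham.lip_p x p q).trans ?_
  have := E.α₁_pos.le
  have := E.two_lt
  have : (|p| + |q| + 1) ^ (γ - 1) ≤ (2 * K + 1) ^ (γ - 1) :=
    Real.rpow_le_rpow (by positivity) (by linarith) (by linarith)
  gcongr

lemma continuous_h (E : IsEnvironment α₀ α₁ γ κ a h) : Continuous fun q : ℝ × ℝ => h q.1 q.2 := by
  rw [continuous_iff_continuousAt]
  rintro ⟨x₀, p₀⟩
  rw [ContinuousAt, tendsto_iff_dist_tendsto_zero]
  have hγ := E.two_lt
  have hb : Tendsto (fun q : ℝ × ℝ => α₁ * (|q.2| ^ γ + 1) * |q.1 - x₀|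
      + α₁ * (|q.2| + |p₀| + 1) ^ (γ - 1) * |q.2 - p₀|) (𝓝 (x₀, p₀)) (𝓝 0) := by
    have : Continuous (fun q : ℝ × ℝ => α₁ * (|q.2| ^ γ + 1) * |q.1 - x₀|
      + α₁ * (|q.2| + |p₀| + 1) ^ (γ - 1) * |q.2 - p₀|) := by
      have h1 : Continuous fun q : ℝ × ℝ => |q.2| ^ γ :=
        (continuous_snd.abs).rpow_const fun q => Or.inr (by linarith)
      have h2 : Continuous fun q : ℝ × ℝ => (|q.2| + |p₀| + 1) ^ (γ - 1) :=
        ((continuous_snd.abs.add continuous_const).add continuous_const).rpow_const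
          fun q => Or.inr (by linarith)
      fun_prop
    have h0 := this.tendsto (x₀, p₀)
    simpa using h0
  refine squeeze_zero (fun q => dist_nonneg) (fun q => ?_) hb
  rw [Real.dist_eq]
  calc |h q.1 q.2 - h x₀ p₀| ≤ |h q.1 q.2 - h x₀ q.2| + |h x₀ q.2 - h x₀ p₀| := abs_sub_le _ _ _
    _ ≤ _ := add_le_add (E.ham.lip_x _ _ _) (E.ham.lip_p _ _ _)

lemma continuous_h_right (E : IsEnvironment α₀ α₁ γ κ a h) (x : ℝ) : Continuous (h x) :=
  E.continuous_h.comp (Continuous.prodMk_right x)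

lemma continuous_h_left (E : IsEnvironment α₀ α₁ γ κ a h) (p : ℝ) : Continuous fun x => h x p :=
  E.continuous_h.comp (Continuous.prodMk_left p)

/-- Quadratic growth is the order that matters: for a logarithmic barrier, the squared slope and the
second derivative scale alike. -/
lemma lower_sq (E : IsEnvironment α₀ α₁ γ κ a h) (x : ℝ) {p : ℝ} (hp : 1 ≤ |p|) :
    α₀ * p ^ 2 - 1 / α₀ ≤ h x p := by
  refine le_trans ?_ (E.ham.lower x p)
  have h1 : |p| ^ (2 : ℝ) ≤ |p| ^ γ := Real.rpow_le_rpow_of_exponent_le hp E.two_lt.le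
  have h2 : |p| ^ (2 : ℝ) = p ^ 2 := by rw [Real.rpow_two, sq_abs]
  have := E.α₀_pos
  rw [h2] at h1
  gcongr

lemma neg_le (E : IsEnvironment α₀ α₁ γ κ a h) (x p : ℝ) : -(1 / α₀) ≤ h x p := by
  have := E.ham.lower x p
  have : 0 ≤ α₀ * |p| ^ γ := mul_nonneg E.α₀_pos.le (Real.rpow_nonneg (abs_nonneg _) _)
  linarith

end IsEnvironment

/-- Half the Lipschitz constant of supersolutions at level `l`. -/
def barrierSlope (α₀ l : ℝ) : ℝ := 1 + (2 + max l 0 + 1 / α₀) / α₀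

/-- The Lipschitz constant of supersolutions at level `l`. -/
def slopeBound (α₀ l : ℝ) : ℝ := 2 * barrierSlope α₀ l

lemma one_le_barrierSlope {α₀ : ℝ} (h₀ : 0 < α₀) (l : ℝ) : 1 ≤ barrierSlope α₀ l := by
  have : 0 ≤ max l 0 := le_max_right _ _
  unfold barrierSlope
  have : 0 ≤ (2 + max l 0 + 1 / α₀) / α₀ := by positivity
  linarith

lemma slopeBound_pos {α₀ : ℝ} (h₀ : 0 < α₀) (l : ℝ) : 0 < slopeBound α₀ l := by
  have := one_le_barrierSlope h₀ l
  unfold slopeBound; linarith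

lemma slopeBound_mono {α₀ l l' : ℝ} (h₀ : 0 < α₀) (hl : l ≤ l') :
    slopeBound α₀ l ≤ slopeBound α₀ l' := by
  unfold slopeBound barrierSlope
  gcongr

/-- With `A` the barrier slope, `A log (1 - r)` violates the supersolution inequality even if the
diffusion takes its largest value `1`. -/
lemma lt_barrierSlope {α₀ : ℝ} (h₀ : 0 < α₀) (l : ℝ) :
    l + 1 / α₀ < α₀ * barrierSlope α₀ l ^ 2 - barrierSlope α₀ l := by
  have h1 := one_le_barrierSlope h₀ l
  have h2 : α₀ * barrierSlope α₀ l = α₀ + (2 + max l 0 + 1 / α₀) := by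
    unfold barrierSlope; field_simp
  have h3 : l ≤ max l 0 := le_max_left _ _
  have h4 : 0 ≤ max l 0 := le_max_right _ _
  have h5 : 0 < 1 / α₀ := by positivity
  have h6 : α₀ * barrierSlope α₀ l ^ 2 - barrierSlope α₀ l =
    barrierSlope α₀ l * (α₀ + (1 + max l 0 + 1 / α₀)) := by
    linear_combination (barrierSlope α₀ l) * h2
  rw [h6]
  nlinarith

namespace IsEnvironment

variable {α₀ α₁ γ κ : ℝ} {a : ℝ → ℝ} {h : ℝ → ℝ → ℝ}

lemma lt_h (E : IsEnvironment α₀ α₁ γ κ a h) {l p : ℝ} (x : ℝ) (hp : slopeBound α₀ l ≤ |p|) :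
    l < h x p := by
  have h1 := one_le_barrierSlope E.α₀_pos l
  have h2 : barrierSlope α₀ l ≤ |p| := by unfold slopeBound at hp; linarith
  have h3 := E.lower_sq x (h1.trans h2)
  have h4 := lt_barrierSlope E.α₀_pos l
  have h5 : barrierSlope α₀ l ^ 2 ≤ p ^ 2 := by
    rw [← sq_abs p]; gcongr
  have := mul_le_mul_of_nonneg_left h5 E.α₀_pos.le
  linarith

/-- Supersolutions stay above logarithmic barriers. -/
lemma barrier_le (E : IsEnvironment α₀ α₁ γ κ a h) {l y σ : ℝ} {u : ℝ → ℝ} (hσ : σ ^ 2 = 1)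
    (hu : SuperOn a h l (Ioo (y - 1) (y + 1)) u) {r : ℝ} (hr0 : 0 ≤ r) (hr1 : r < 1) :
    u y + barrierSlope α₀ l * Real.log (1 - r) ≤ u (y + σ * r) := by
  set A := barrierSlope α₀ l with hA
  have hA1 : 1 ≤ A := one_le_barrierSlope E.α₀_pos l
  by_contra hlt
  push Not at hlt
  -- parametrise by the distance to `y`
  let g : ℝ → ℝ := fun s => u (y + σ * s) - u y - A * Real.log (1 - s)
  have hcu : Continuous fun s => u (y + σ * s) := hu.1.comp (by fun_prop)
  obtain ⟨m, hm⟩ : ∃ m, ∀ s ∈ Icc (0 : ℝ) 1, m ≤ u (y + σ * s) := by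
    obtain ⟨m, hm⟩ := (isCompact_Icc.image_of_continuousOn hcu.continuousOn).bddBelow
    exact ⟨m, fun s hs => hm (mem_image_of_mem _ hs)⟩
  -- Close to distance `1` the logarithm falls below the minimum `m` of `u`, so a negative minimum
  -- of `g` cannot sit at the outer end.
  obtain ⟨t, ht0, ht1, htr, htg⟩ : ∃ t, 0 < t ∧ t < 1 ∧ r < t ∧ 0 < g t := by
    let e := Real.exp ((m - u y - 1) / A)
    have he : 0 < e := Real.exp_pos _
    let d := min (e) ((1 - r) / 2)
    have hd : 0 < d := lt_min he (by linarith)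
    have hd1 : d ≤ (1 - r) / 2 := min_le_right _ _
    refine ⟨1 - d, by linarith, by linarith, by linarith, ?_⟩
    have h1 : Real.log d ≤ (m - u y - 1) / A := by
      rw [← Real.log_exp ((m - u y - 1) / A)]
      exact Real.log_le_log hd (min_le_left _ _)
    have h2 : A * Real.log d ≤ m - u y - 1 := by
      rw [le_div_iff₀ (by linarith)] at h1; linarith
    have h3 := hm (1 - d) ⟨by linarith, by linarith⟩
    simp only [g, sub_sub_cancel]
    linarith
  have hgc : ContinuousOn g (Icc 0 t) := by
    refine (hcu.continuousOn.sub continuousOn_const).sub (continuousOn_const.mul ?_)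
    exact ContinuousOn.log (by fun_prop) fun s hs => by linarith [hs.2]
  obtain ⟨s, hs, hsmin⟩ := isCompact_Icc.exists_isMinOn (nonempty_Icc.2 ht0.le) hgc
  have hgr : g r < 0 := by simp only [g]; linarith
  have hgs : g s < 0 := (hsmin ⟨hr0, htr.le⟩).trans_lt hgr
  have hs0 : s ≠ 0 := by rintro rfl; simp [g] at hgs
  have hst : s ≠ t := by rintro rfl; linarith
  have hs0' : 0 < s := lt_of_le_of_ne hs.1 (Ne.symm hs0)
  have hst' : s < t := lt_of_le_of_ne hs.2 hst
  have hgmin : IsLocalMin g s := hsmin.isLocalMin (Icc_mem_nhds hs0' hst')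
  have hσσ : ∀ x, σ * (σ * x) = x := fun x => by rw [← mul_assoc, ← sq, hσ, one_mul]
  let x₀ := y + σ * s
  have hcx : Continuous fun x : ℝ => σ * (x - y) := by fun_prop
  have hx₀ : σ * (x₀ - y) = s := by simp [x₀, hσσ]
  have hmin : IsLocalMin (fun x => u x - (u y + A * Real.log (1 - σ * (x - y)))) x₀ := by
    have h1 : IsLocalMin (g ∘ fun x => σ * (x - y)) x₀ := by
      refine IsMinFilter.comp_tendsto (l := 𝓝 s) ?_ ?_
      · rw [hx₀]; exact hgmin
      · rw [← hx₀]; exact hcx.tendsto x₀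
    refine h1.congr (Eventually.of_forall fun x => ?_)
    simp [g, hσσ]; ring
  have habs : |σ| = 1 := by
    have : |σ| ^ 2 = 1 := by rw [sq_abs, hσ]
    nlinarith [abs_nonneg σ]
  have hmem : x₀ ∈ Ioo (y - 1) (y + 1) := by
    have : |x₀ - y| < 1 := by
      simp only [x₀, add_sub_cancel_left, abs_mul, habs, one_mul, abs_of_pos hs0']; linarith
    rw [abs_lt] at this
    exact ⟨by linarith, by linarith⟩
  have hpos : ∀ᶠ x in 𝓝 x₀, 0 < 1 - σ * (x - y) := by
    have : ContinuousAt (fun x => 1 - σ * (x - y)) x₀ := by fun_prop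
    refine this.eventually (lt_mem_nhds ?_)
    simp only [hx₀]; linarith
  have hlin : ∀ x, HasDerivAt (fun x => 1 - σ * (x - y)) (-σ) x := fun x => by
    simpa [sub_eq_add_neg] using hasDerivAt_affine 1 (-σ) y x
  have hU : ∀ᶠ x in 𝓝 x₀, HasDerivAt (fun x => u y + A * Real.log (1 - σ * (x - y)))
      (A * (-σ / (1 - σ * (x - y)))) x := by
    filter_upwards [hpos] with x hx
    exact (((hlin x).log hx.ne').const_mul A).const_add _
  have hne := hpos.self_of_nhds.ne'
  have hf : HasDerivAt (fun x => A * (-σ / (1 - σ * (x - y))))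
      (A * ((0 * (1 - σ * (x₀ - y)) - (-σ) * (-σ)) / (1 - σ * (x₀ - y)) ^ 2)) x₀ :=
    ((hasDerivAt_const x₀ (-σ)).div (hlin x₀) hne).const_mul A
  have key := hu.touch hmem (E.nonneg _) hU hf hmin
  rw [hx₀] at key
  have h1s : 0 < 1 - s := by linarith
  have e1 : A * ((0 * (1 - s) - -σ * -σ) / (1 - s) ^ 2) = - (A / (1 - s) ^ 2) := by
    have : -σ * -σ = 1 := by rw [← hσ]; ring
    rw [this]; field_simp; ring
  rw [e1] at key
  set p := A * (-σ / (1 - s)) with hp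
  have hp2 : p ^ 2 = A ^ 2 / (1 - s) ^ 2 := by
    rw [hp, mul_pow, div_pow, neg_sq, hσ]; ring
  have habsp : 1 ≤ |p| := by
    rw [hp, abs_mul, abs_div, abs_neg, habs, abs_of_pos h1s, abs_of_pos (by linarith : 0 < A)]
    have : 1 ≤ 1 / (1 - s) := by rw [le_div_iff₀ h1s]; linarith
    nlinarith
  have hlow := E.lower_sq x₀ habsp
  rw [hp2] at hlow
  have hlt2 := lt_barrierSlope E.α₀_pos l
  rw [← hA] at hlt2
  have hinv : 1 ≤ 1 / (1 - s) ^ 2 := by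
    rw [le_div_iff₀ (by positivity)]; nlinarith
  have hax : a x₀ * (A / (1 - s) ^ 2) ≤ A / (1 - s) ^ 2 :=
    mul_le_of_le_one_left (by positivity) (E.le_one _)
  -- The Hamiltonian and diffusion terms carry the same factor `1 / (1 - s)² ≥ 1`, so the touching
  -- inequality is excluded at every distance by `lt_barrierSlope`.
  have h7 : (α₀ * A ^ 2 - A) * (1 / (1 - s) ^ 2) ≤ l + 1 / α₀ := by
    have e2 : (α₀ * A ^ 2 - A) * (1 / (1 - s) ^ 2) = α₀ * (A ^ 2 / (1 - s) ^ 2) - A / (1 - s) ^ 2 := by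
      ring
    rw [e2]; linarith
  have h8 : 0 < α₀ * A ^ 2 - A := by
    have hfac : A * (α₀ * A - 1) = α₀ * A ^ 2 - A := by ring
    have h2 : α₀ * A = α₀ + (2 + max l 0 + 1 / α₀) := by
      rw [hA]; unfold barrierSlope; have := E.α₀_pos.ne'; field_simp
    have h4 : 0 ≤ max l 0 := le_max_right _ _
    have h5 : 0 < 1 / α₀ := by have := E.α₀_pos; positivity
    have := E.α₀_pos
    rw [← hfac]
    apply mul_pos <;> linarith
  nlinarith

/-- On `[0, 1/2]` one has `log (1 - r) ≥ -2 r`; this is the factor `2` between `slopeBound` and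
`barrierSlope`. -/
lemma sub_le_of_abs_le (E : IsEnvironment α₀ α₁ γ κ a h) {l y x : ℝ} {u : ℝ → ℝ}
    (hu : SuperOn a h l (Ioo (y - 1) (y + 1)) u) (hx : |x - y| ≤ 1 / 2) :
    u y - slopeBound α₀ l * |x - y| ≤ u x := by
  obtain ⟨σ, hσ, hxy⟩ : ∃ σ : ℝ, σ ^ 2 = 1 ∧ x = y + σ * |x - y| := by
    rcases le_total 0 (x - y) with h0 | h0
    · exact ⟨1, by norm_num, by rw [abs_of_nonneg h0]; ring⟩
    · exact ⟨-1, by norm_num, by rw [abs_of_nonpos h0]; ring⟩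
  have h1 := E.barrier_le hσ hu (abs_nonneg (x - y)) (by linarith)
  rw [← hxy] at h1
  have h2 := Real.one_sub_inv_le_log_of_pos (by linarith : 0 < 1 - |x - y|)
  have h3 : -(2 * |x - y|) ≤ 1 - (1 - |x - y|)⁻¹ := by
    have hpos : 0 < 1 - |x - y| := by linarith
    have : (1 - |x - y|)⁻¹ ≤ 1 + 2 * |x - y| := by
      rw [inv_le_iff_one_le_mul₀ hpos]
      nlinarith [abs_nonneg (x - y)]
    linarith
  have hA1 : 1 ≤ barrierSlope α₀ l := one_le_barrierSlope E.α₀_pos l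
  have := mul_le_mul_of_nonneg_left (h3.trans h2) (by linarith : 0 ≤ barrierSlope α₀ l)
  unfold slopeBound
  linarith

lemma lipschitz_of_superOn (E : IsEnvironment α₀ α₁ γ κ a h) {l s t : ℝ} {u : ℝ → ℝ}
    (hu : SuperOn a h l (Ioo (s - 1) (t + 1)) u) :
    ∀ x ∈ Icc s t, ∀ y ∈ Icc s t, |u x - u y| ≤ slopeBound α₀ l * |x - y| := by
  set K := slopeBound α₀ l
  have loc : ∀ x ∈ Icc s t, ∀ y ∈ Icc s t, |x - y| ≤ 1 / 2 → |u x - u y| ≤ K * |x - y| := by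
    intro x hx y hy hxy
    have h1 := E.sub_le_of_abs_le (hu.mono (J' := Ioo (y - 1) (y + 1))
      (Ioo_subset_Ioo (by linarith [hy.1]) (by linarith [hy.2])) le_rfl) hxy
    have h2 := E.sub_le_of_abs_le (x := y) (hu.mono (J' := Ioo (x - 1) (x + 1))
      (Ioo_subset_Ioo (by linarith [hx.1]) (by linarith [hx.2])) le_rfl) (by rwa [abs_sub_comm])
    rw [abs_sub_comm y x] at h2
    rw [abs_le]; constructor <;> linarith
  -- The local bound is chained along steps of length `1/2`, which does not worsen the constant.
  have ind : ∀ n : ℕ, ∀ x ∈ Icc s t, ∀ y ∈ Icc s t, x ≤ y → y ≤ x + n / 2 →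
      |u x - u y| ≤ K * (y - x) := by
    intro n
    induction n with
    | zero =>
      intro x hx y hy h1 h2
      have : x = y := by simp at h2; linarith
      subst this; simp
    | succ n ih =>
      intro x hx y hy h1 h2
      push_cast at h2
      rcases le_total y (x + 1 / 2) with h3 | h3
      · have := loc x hx y hy (by rw [abs_sub_comm, abs_of_nonneg (by linarith)]; linarith)
        rwa [abs_sub_comm x y, abs_of_nonneg (by linarith : 0 ≤ y - x)] at this
      · have hm : x + 1 / 2 ∈ Icc s t := ⟨by linarith [hx.1], by linarith [hy.2]⟩
        have e1 := loc x hx _ hm (by rw [abs_sub_comm, abs_of_nonneg (by linarith)]; linarith)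
        have e2 := ih _ hm y hy h3 (by linarith)
        rw [abs_sub_comm x (x + 1 / 2), abs_of_nonneg (by linarith : 0 ≤ x + 1 / 2 - x)] at e1
        calc |u x - u y| ≤ |u x - u (x + 1 / 2)| + |u (x + 1 / 2) - u y| := abs_sub_le _ _ _
          _ ≤ K * (x + 1 / 2 - x) + K * (y - (x + 1 / 2)) := add_le_add e1 e2
          _ = K * (y - x) := by ring
  intro x hx y hy
  rcases le_total x y with hxy | hxy
  · obtain ⟨n, hn⟩ := exists_nat_ge (2 * (y - x))
    have := ind n x hx y hy hxy (by linarith)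
    rwa [abs_sub_comm x y, abs_of_nonneg (by linarith : 0 ≤ y - x)]
  · obtain ⟨n, hn⟩ := exists_nat_ge (2 * (x - y))
    have := ind n y hy x hx hxy (by linarith)
    rwa [abs_sub_comm, abs_of_nonneg (by linarith : 0 ≤ x - y)]

/-- A concave parabola with slope `p` at `z` and `C r = 2 θ` drops `2 θ r` below its tangent at
distance `r`, while `u` drops at most `θ r`; so it touches `u` strictly inside. There `a ≤ κ² r²`,
and the second order term, of curvature `4 θ / r`, contributes only `4 θ κ² r`. -/
lemma exists_touching_near_zero {l z r p θ : ℝ} {u : ℝ → ℝ} {J : Set ℝ}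
    (hu : SuperOn a h l J u) (hr : 0 < r) (hJ : Ioo (z - r) (z + r) ⊆ J) (hθ : 0 < θ)
    (ha : ∀ x, a x ≤ κ ^ 2 * (x - z) ^ 2)
    (hlow : ∀ x, |x - z| ≤ r → u z + p * (x - z) - θ * |x - z| ≤ u x) :
    ∃ x q, |x - z| < r ∧ |q - p| ≤ 4 * θ ∧ h x q ≤ l + 4 * θ * κ ^ 2 * r := by
  obtain ⟨C, hC, hCr⟩ : ∃ C, 0 < C ∧ C * r = 2 * θ :=
    ⟨2 * θ / r, by positivity, by field_simp⟩
  let φ : ℝ → ℝ := fun x => u z + p * (x - z) + (-C) * (x - z) ^ 2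
  have hc : ContinuousOn (fun x => u x - φ x) (Icc (z - r) (z + r)) :=
    (hu.1.sub (contDiff_quadratic _ _ _ _).continuous).continuousOn
  obtain ⟨x, hx, hmin⟩ := isCompact_Icc.exists_isMinOn (nonempty_Icc.2 (by linarith)) hc
  have hz0 : u x - φ x ≤ 0 := by
    have := hmin (show z ∈ Icc (z - r) (z + r) from ⟨by linarith, by linarith⟩)
    simpa [φ] using this
  have hxr : |x - z| ≤ r := abs_le.2 ⟨by linarith [hx.1], by linarith [hx.2]⟩
  have hxr' : |x - z| ≠ r := by
    intro he
    have h1 := hlow x hxr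
    have h2 : (x - z) ^ 2 = r ^ 2 := by rw [← sq_abs, he]
    simp only [φ, h2, he] at hz0 h1
    have : C * r ^ 2 = 2 * θ * r := by rw [← hCr]; ring
    have : 0 < θ * r := by positivity
    linarith
  have hlt : |x - z| < r := lt_of_le_of_ne hxr hxr'
  have hlt' := abs_lt.1 hlt
  have hxI : x ∈ Ioo (z - r) (z + r) := ⟨by linarith, by linarith⟩
  have key := hu.2 φ x (hJ hxI) (contDiff_quadratic _ _ _ _)
    (hmin.isLocalMin (Icc_mem_nhds hxI.1 hxI.2))
  rw [deriv_deriv_quadratic, deriv_quadratic] at key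
  refine ⟨x, p + 2 * -C * (x - z), hlt, ?_, ?_⟩
  · rw [add_sub_cancel_left, abs_mul, abs_mul, abs_neg, abs_of_pos hC,
      abs_of_pos (by norm_num : (0 : ℝ) < 2)]
    calc 2 * C * |x - z| ≤ 2 * C * r := by gcongr
      _ = 4 * θ := by rw [mul_assoc, hCr]; ring
  · have h1 : a x ≤ κ ^ 2 * r ^ 2 := (ha x).trans (by
      rw [← sq_abs (x - z)]; gcongr)
    have h2 : a x * (2 * C) ≤ κ ^ 2 * r ^ 2 * (2 * C) := by gcongr
    have e : κ ^ 2 * r ^ 2 * (2 * C) = 4 * θ * κ ^ 2 * r := by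
      linear_combination (2 * κ ^ 2 * r) * hCr
    linarith

/-- At a zero of the diffusion, a supersolution satisfies the first order inequality in the
classical sense wherever it is differentiable. -/
lemma h_deriv_le {l z p : ℝ} {u : ℝ → ℝ} {J : Set ℝ} (hu : SuperOn a h l J u) (hJ : J ∈ 𝓝 z)
    (ha : ∀ x, a x ≤ κ ^ 2 * (x - z) ^ 2) (hh : Continuous fun q : ℝ × ℝ => h q.1 q.2)
    (hd : HasDerivAt u p z) : h z p ≤ l := by
  by_contra hlt
  push Not at hlt
  obtain ⟨c, hc1, hc2⟩ := exists_between hlt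
  have hev : ∀ᶠ q : ℝ × ℝ in 𝓝 (z, p), c < h q.1 q.2 := hh.tendsto (z, p) |>.eventually (lt_mem_nhds hc2)
  obtain ⟨ρ, hρ, hball⟩ := Metric.eventually_nhds_iff.1 hev
  obtain ⟨ρ', hρ', hJ'⟩ := Metric.mem_nhds_iff.1 hJ
  -- The touching slope is within `4 θ` of `p`, so `θ = ρ / 5` keeps it inside the ball where `h >
  -- c`.
  have hθ : 0 < ρ / 5 := by positivity
  have hd' := hasDerivAt_iff_isLittleO.1 hd
  have hlo := hd'.def hθ
  obtain ⟨r₀, hr₀, hlo⟩ := Metric.eventually_nhds_iff.1 hlo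
  set θ := ρ / 5
  obtain ⟨r, hr, hr1, hr2, hr3, hr4⟩ : ∃ r > 0, r < r₀ ∧ r < ρ ∧ r < ρ' ∧
      4 * θ * κ ^ 2 * r ≤ c - l := by
    let m := min (min (r₀ / 2) (ρ / 2)) (min (ρ' / 2) ((c - l) / (4 * θ * κ ^ 2 + 1)))
    have hcl : 0 < c - l := by linarith
    have hD : 0 < 4 * θ * κ ^ 2 + 1 := by positivity
    have h1 : m ≤ r₀ / 2 := (min_le_left _ _).trans (min_le_left _ _)
    have h2 : m ≤ ρ / 2 := (min_le_left _ _).trans (min_le_right _ _)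
    have h3 : m ≤ ρ' / 2 := (min_le_right _ _).trans (min_le_left _ _)
    have h4 : m ≤ (c - l) / (4 * θ * κ ^ 2 + 1) := (min_le_right _ _).trans (min_le_right _ _)
    have hm : 0 < m := by
      refine lt_min (lt_min ?_ ?_) (lt_min ?_ ?_) <;> positivity
    refine ⟨m, hm, by linarith, by linarith, by linarith, ?_⟩
    rw [le_div_iff₀ hD] at h4
    nlinarith
  obtain ⟨x, q, hx, hq, hle⟩ := exists_touching_near_zero (p := p) hu hr (fun x hx => hJ' (by
    rw [Metric.mem_ball, Real.dist_eq, abs_lt]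
    exact ⟨by linarith [hx.1], by linarith [hx.2]⟩)) hθ ha (fun x hx => by
      have := hlo (y := x) (by rw [Real.dist_eq]; linarith)
      rw [Real.norm_eq_abs, Real.norm_eq_abs, smul_eq_mul] at this
      have := (abs_le.1 this).1
      linarith)
  have := hball (y := (x, q)) (by
    rw [Prod.dist_eq, Real.dist_eq, Real.dist_eq]
    exact max_lt (by simpa using hx.trans hr2) (by simp only [θ] at hq ⊢; linarith))
  simp only at this
  linarith

/-- A supersolution at a lower level forces the sublevel sets at zeros of the diffusion to be
nonempty. -/
lemma exists_h_lt (E : IsEnvironment α₀ α₁ γ κ a h) {μ l z : ℝ} {u : ℝ → ℝ} (hμ : μ < l)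
    (hz : a z = 0) (hu : SuperOn a h μ (Ioo (z - 2) (z + 2)) u) : ∃ p, h z p < l := by
  set K := slopeBound α₀ μ
  have hK : 0 < K := slopeBound_pos E.α₀_pos μ
  have hlip := E.lipschitz_of_superOn (s := z - 1) (t := z + 1)
    (hu.mono (Ioo_subset_Ioo (by linarith) (by linarith)) le_rfl)
  -- `D r` collects the second order error of the touching parabola and the cost of moving from `x`
  -- to `z` at slopes bounded by `4 K`.
  set D := 4 * K * κ ^ 2 + α₁ * ((4 * K) ^ γ + 1) with hD
  have hDpos : 0 < D := by
    have := E.α₁_pos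
    positivity
  obtain ⟨r, hr, hr1, hrD⟩ : ∃ r > 0, r ≤ 1 ∧ D * r < l - μ := by
    refine ⟨min 1 ((l - μ) / (2 * D)), lt_min one_pos (by
      have : 0 < l - μ := by linarith
      positivity), min_le_left _ _, ?_⟩
    have h1 := min_le_right 1 ((l - μ) / (2 * D))
    rw [le_div_iff₀ (by positivity)] at h1
    linarith
  obtain ⟨x, q, hx, hq, hle⟩ := exists_touching_near_zero (p := 0) hu hr
    (Ioo_subset_Ioo (by linarith) (by linarith)) hK (E.le_sq hz) (fun x hx => by
      have hx' := abs_le.1 hx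
      have := hlip x ⟨by linarith, by linarith⟩ z ⟨by linarith, by linarith⟩
      have := (abs_le.1 this).1
      linarith)
  rw [sub_zero] at hq
  refine ⟨q, ?_⟩
  have h1 := (abs_le.1 (E.ham.lip_x x z q)).1
  have h2 : α₁ * (|q| ^ γ + 1) * |x - z| ≤ α₁ * ((4 * K) ^ γ + 1) * r := by
    have := E.α₁_pos
    have h3 : |q| ^ γ ≤ (4 * K) ^ γ :=
      Real.rpow_le_rpow (abs_nonneg _) hq (by linarith [E.two_lt])
    gcongr
  have h4 : D * r = 4 * K * κ ^ 2 * r + α₁ * ((4 * K) ^ γ + 1) * r := by rw [hD]; ring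
  linarith

/-- A Lipschitz supersolution cannot be bent for too long: `C` measures `∫ 1 / a` from below. -/
lemma not_bent_of_superOn (E : IsEnvironment α₀ α₁ γ κ a h) {μ s t z c K : ℝ} {u : ℝ → ℝ} {J : Set ℝ}
    (hst : s < t) (hu : SuperOn a h μ J u) (hJ : Ioo s t ⊆ J)
    (hlip : ∀ x ∈ Icc s t, ∀ y ∈ Icc s t, |u x - u y| ≤ K * |x - y|) (hc : 0 < c)
    (hz : a z = 0) (hzst : z ∉ Icc s t)
    (hbig : 2 * K < c / (2 * κ ^ 2) * ((z - t)⁻¹ - (z - s)⁻¹))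
    (hbent : ∀ x ∈ Ioo s t, ∀ (U : ℝ → ℝ) (p : ℝ), HasDerivAt U p x →
      IsLocalMin (fun x => u x - U x) x → μ + c ≤ h x p) : False := by
  -- With this `C` the test function `C log |x - z| + β x` satisfies `a U'' ≥ -c / 2`.
  set C := c / (2 * κ ^ 2) with hC
  have hκ := E.κ_pos
  have hCpos : 0 < C := by positivity
  -- The slope of `U` falls by more than `2 K` across `[s, t]`; `β` centres it so that it exceeds
  -- `K` at `s` and is below `-K` at `t`. The minimum of `u - U` is then interior.
  obtain ⟨β, hβ1, hβ2⟩ : ∃ β, K < C * -(z - s)⁻¹ + β ∧ C * -(z - t)⁻¹ + β < -K := by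
    generalize (z - t)⁻¹ = i at hbig ⊢
    generalize (z - s)⁻¹ = j at hbig ⊢
    exact ⟨C * (j + i) / 2, by linarith, by linarith⟩
  have hne : ∀ x ∈ Icc s t, x - z ≠ 0 := fun x hx h0 => hzst (by
    rwa [show z = x by linarith])
  have hlin : ∀ x, HasDerivAt (fun x => x - z) 1 x := fun x => (hasDerivAt_id x).sub_const z
  -- `Real.log` is even, so `z` may lie on either side of `[s, t]`.
  have hU : ∀ x ∈ Icc s t, HasDerivAt (fun x => C * Real.log (x - z) + β * x)
      (C * (x - z)⁻¹ + β) x := fun x hx => by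
    have h1 := ((hlin x).log (hne x hx)).const_mul C
    rw [one_div] at h1
    have h2 : HasDerivAt (fun x : ℝ => β * x) β x := by simpa using (hasDerivAt_id x).const_mul β
    exact h1.fun_add h2
  set U : ℝ → ℝ := fun x => C * Real.log (x - z) + β * x with hUdef
  have hcont : ContinuousOn (fun x => u x - U x) (Icc s t) :=
    hu.1.continuousOn.sub fun x hx => (hU x hx).continuousAt.continuousWithinAt
  obtain ⟨x, hx, hmin⟩ := isCompact_Icc.exists_isMinOn (nonempty_Icc.2 hst.le) hcont
  have hsx : x ≠ s := by
    rintro rfl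
    have h1 := (hasDerivAt_iff_tendsto_slope_left_right.1 (hU x hx)).2
    have hK : K < C * (x - z)⁻¹ + β := by
      rw [← neg_sub z x, inv_neg]; exact hβ1
    obtain ⟨y, h2, h3⟩ := ((h1.eventually (lt_mem_nhds hK)).and (Ioo_mem_nhdsGT hst)).exists
    have hy : y ∈ Icc x t := ⟨h3.1.le, h3.2.le⟩
    have h4 : u x - U x ≤ u y - U y := hmin hy
    have h5 := (abs_le.1 (hlip y hy x hx)).2
    rw [abs_of_pos (by linarith [h3.1])] at h5
    rw [slope_def_field, lt_div_iff₀ (by linarith [h3.1])] at h2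
    linarith
  have htx : x ≠ t := by
    rintro rfl
    have h1 := (hasDerivAt_iff_tendsto_slope_left_right.1 (hU x hx)).1
    have hK : C * (x - z)⁻¹ + β < -K := by
      rw [← neg_sub z x, inv_neg]; exact hβ2
    obtain ⟨y, h2, h3⟩ := ((h1.eventually (gt_mem_nhds hK)).and (Ioo_mem_nhdsLT hst)).exists
    have hy : y ∈ Icc s x := ⟨h3.1.le, h3.2.le⟩
    have h4 : u x - U x ≤ u y - U y := hmin hy
    have h5 := (abs_le.1 (hlip y hy x hx)).2
    rw [abs_of_neg (by linarith [h3.2])] at h5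
    rw [slope_def_field, div_lt_iff_of_neg (by linarith [h3.2])] at h2
    linarith
  have hxI : x ∈ Ioo s t := ⟨lt_of_le_of_ne hx.1 hsx.symm, lt_of_le_of_ne hx.2 htx⟩
  have hloc : IsLocalMin (fun x => u x - U x) x := hmin.isLocalMin (Icc_mem_nhds hxI.1 hxI.2)
  have hev : ∀ᶠ y in 𝓝 x, HasDerivAt U (C * (y - z)⁻¹ + β) y := by
    filter_upwards [Icc_mem_nhds hxI.1 hxI.2] with y hy using hU y hy
  have hf : HasDerivAt (fun y => C * (y - z)⁻¹ + β) (C * (-1 / (x - z) ^ 2)) x :=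
    (((hlin x).fun_inv (hne x hx)).const_mul C).add_const β
  have h1 := hu.touch (hJ hxI) (E.nonneg x) hev hf hloc
  have h2 := hbent x hxI U _ (hU x hx) hloc
  have h3 : a x * (C / (x - z) ^ 2) ≤ c / 2 := by
    have hne' := hne x hx
    have hsq : 0 < (x - z) ^ 2 := by positivity
    calc a x * (C / (x - z) ^ 2) ≤ κ ^ 2 * (x - z) ^ 2 * (C / (x - z) ^ 2) := by
          gcongr; exact E.le_sq hz x
      _ = c / 2 := by rw [hC]; field_simp
  have h4 : a x * (C * (-1 / (x - z) ^ 2)) = - (a x * (C / (x - z) ^ 2)) := by ring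
  linarith

end IsEnvironment

end

/-! ### The largest root of the Hamiltonian, and its attraction near zeros of the diffusion -/

noncomputable section

/-- The largest root of `h(x, ·) = l`. -/
def topRoot (h : ℝ → ℝ → ℝ) (l x : ℝ) : ℝ := sSup {p | h x p ≤ l}

namespace IsEnvironment

variable {α₀ α₁ γ κ : ℝ} {a : ℝ → ℝ} {h : ℝ → ℝ → ℝ}

/-- Betweenness form of strict quasiconvexity. -/
lemma h_lt_max (E : IsEnvironment α₀ α₁ γ κ a h) (x : ℝ) {p q r : ℝ} (hpq : p < q) (hqr : q < r) :
    h x q < max (h x p) (h x r) := by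
  have h1 : 0 < r - p := by linarith
  have := E.quasiconvex x p r ((q - p) / (r - p)) (by linarith) (div_pos (by linarith) h1)
    ((div_lt_one h1).2 (by linarith))
  convert this using 2
  field_simp
  ring

lemma h_lt_of_lt_right (E : IsEnvironment α₀ α₁ γ κ a h) {x p q r : ℝ} (hpq : p < q) (hqr : q < r)
    (hlt : h x p < h x q) : h x q < h x r := by
  rcases lt_max_iff.1 (E.h_lt_max x hpq hqr) with h1 | h1
  · exact absurd h1 hlt.not_gt
  · exact h1

lemma h_lt_of_lt_left (E : IsEnvironment α₀ α₁ γ κ a h) {x p q r : ℝ} (hpq : p < q) (hqr : q < r)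
    (hlt : h x r < h x q) : h x q < h x p := by
  rcases lt_max_iff.1 (E.h_lt_max x hpq hqr) with h1 | h1
  · exact h1
  · exact absurd h1 hlt.not_gt

lemma abs_lt_of_h_le (E : IsEnvironment α₀ α₁ γ κ a h) {l x p : ℝ} (hp : h x p ≤ l) :
    |p| < slopeBound α₀ l := by
  by_contra hle
  exact absurd (E.lt_h x (not_lt.1 hle)) hp.not_gt

lemma bddAbove_sublevel (E : IsEnvironment α₀ α₁ γ κ a h) (l x : ℝ) :
    BddAbove {p | h x p ≤ l} :=
  ⟨slopeBound α₀ l, fun _ hp => (le_abs_self _).trans (E.abs_lt_of_h_le hp).le⟩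

lemma le_topRoot (E : IsEnvironment α₀ α₁ γ κ a h) {l x p : ℝ} (hp : h x p ≤ l) :
    p ≤ topRoot h l x := le_csSup (E.bddAbove_sublevel l x) hp

lemma lt_h_of_topRoot_lt (E : IsEnvironment α₀ α₁ γ κ a h) {l x p : ℝ} (hp : topRoot h l x < p) :
    l < h x p := by
  by_contra hle
  exact absurd (E.le_topRoot (not_lt.1 hle)) hp.not_ge

lemma h_topRoot (E : IsEnvironment α₀ α₁ γ κ a h) {l x : ℝ} (hne : ∃ p, h x p < l) :
    h x (topRoot h l x) = l := by
  obtain ⟨p, hp⟩ := hne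
  have hcl : IsClosed {p | h x p ≤ l} := isClosed_le (E.continuous_h_right x) continuous_const
  have hmem : topRoot h l x ∈ {p | h x p ≤ l} := hcl.csSup_mem ⟨p, hp.le⟩ (E.bddAbove_sublevel l x)
  refine le_antisymm hmem ?_
  refine ge_of_tendsto (x := 𝓝[>] (topRoot h l x))
    ((E.continuous_h_right x).continuousAt.continuousWithinAt) ?_
  filter_upwards [self_mem_nhdsWithin] with q hq using (E.lt_h_of_topRoot_lt hq).le

lemma lt_topRoot (E : IsEnvironment α₀ α₁ γ κ a h) {l x p : ℝ} (hp : h x p < l) :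
    p < topRoot h l x := by
  refine lt_of_le_of_ne (E.le_topRoot hp.le) fun he => ?_
  have := E.h_topRoot ⟨p, hp⟩
  rw [← he] at this
  linarith

lemma h_lt_of_lt_topRoot (E : IsEnvironment α₀ α₁ γ κ a h) {l x p q : ℝ} (hp : h x p < l)
    (hpq : p ≤ q) (hq : q < topRoot h l x) : h x q < l := by
  rcases hpq.eq_or_lt with rfl | hpq
  · exact hp
  · have := E.h_lt_max x hpq hq
    rwa [E.h_topRoot ⟨p, hp⟩, max_eq_right hp.le] at this

lemma abs_topRoot_lt (E : IsEnvironment α₀ α₁ γ κ a h) {l x : ℝ} (hne : ∃ p, h x p < l) :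
    |topRoot h l x| < slopeBound α₀ l := E.abs_lt_of_h_le (E.h_topRoot hne).le

/-- Uniform separation of the values of `h` near a point `z`. -/
lemma exists_separation (E : IsEnvironment α₀ α₁ γ κ a h) {μ l z ε B : ℝ} (hμ : μ < l)
    (hne : ∀ m, μ < m → ∃ p, h z p < m) (hε : 0 < ε) :
    ∃ q c δ ε', 0 < c ∧ 0 < δ ∧ 0 < ε' ∧ ε' ≤ ε ∧ q ≤ topRoot h l z - ε' ∧
      ∀ x, |x - z| ≤ δ → ∀ p, |p| ≤ B → (topRoot h l z + ε' ≤ p → l + c ≤ h x p) ∧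
      (q ≤ p → p ≤ topRoot h l z - ε' → h x p ≤ l - c) ∧ (p ≤ q → μ + c ≤ h x p) := by
  obtain ⟨m₁, hm1, hm1'⟩ := exists_between hμ
  obtain ⟨m₂, hm2, hm2'⟩ := exists_between hm1'
  obtain ⟨p₀, hp₀⟩ := hne m₁ hm1
  set P := topRoot h l z
  have hP : h z P = l := E.h_topRoot ⟨p₀, by linarith⟩
  -- `q` lies on the decreasing branch at a level `m₂` strictly between `μ` and `l`: left of it `h`
  -- stays above `μ`, and from it up to just below the largest root `h` stays below `l`.
  obtain ⟨q, hq, hqm⟩ : ∃ q < p₀, h z q = m₂ := by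
    set R := slopeBound α₀ m₂
    have hR : |p₀| < R := E.abs_lt_of_h_le (by linarith)
    have hR' := (abs_lt.1 hR).1
    have h1 : m₂ < h z (-R) := E.lt_h z (by rw [abs_neg]; exact le_abs_self _)
    have := intermediate_value_Icc' (by linarith : -R ≤ p₀) (E.continuous_h_right z).continuousOn
    obtain ⟨q, hq, hqm⟩ := this ⟨by linarith, h1.le⟩
    refine ⟨q, lt_of_le_of_ne hq.2 ?_, hqm⟩
    rintro rfl; linarith
  have hleft : ∀ p ≤ q, m₂ ≤ h z p := by
    intro p hp
    rcases hp.eq_or_lt with rfl | hp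
    · exact hqm.ge
    · rw [← hqm]; exact (E.h_lt_of_lt_left hp hq (by linarith)).le
  have hqP : q < P := E.lt_topRoot (by linarith)
  obtain ⟨ε', hε', hεε, hqε⟩ : ∃ ε' > 0, ε' ≤ ε ∧ q ≤ P - ε' :=
    ⟨min ε (P - q), lt_min hε (by linarith), min_le_left _ _, by linarith [min_le_right ε (P - q)]⟩
  have hright : ∀ p, P + ε' ≤ p → h z (P + ε') ≤ h z p := by
    intro p hp
    rcases hp.eq_or_lt with rfl | hp
    · exact le_rfl
    · exact (E.h_lt_of_lt_right (by linarith : P < P + ε') hp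
        (by rw [hP]; exact E.lt_h_of_topRoot_lt (by linarith))).le
  have hg1 : 0 < h z (P + ε') - l := by
    linarith [E.lt_h_of_topRoot_lt (by linarith : topRoot h l z < P + ε')]
  obtain ⟨g₂, hg2, hmid⟩ : ∃ g > 0, ∀ p, q ≤ p → p ≤ P - ε' → h z p ≤ l - g := by
    have h1 : h z (P - ε') < l := E.h_lt_of_lt_topRoot (by linarith) hqε (by simp only [P]; linarith)
    refine ⟨min (l - m₂) (l - h z (P - ε')), lt_min (by linarith) (by linarith), ?_⟩
    intro p hp1 hp2
    have hmax : h z p ≤ max (h z q) (h z (P - ε')) := by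
      rcases hp1.eq_or_lt with rfl | hp1
      · exact le_max_left _ _
      rcases hp2.eq_or_lt with rfl | hp2
      · exact le_max_right _ _
      exact (E.h_lt_max z hp1 hp2).le
    rcases le_max_iff.1 hmax with h2 | h2
    · linarith [min_le_left (l - m₂) (l - h z (P - ε'))]
    · linarith [min_le_right (l - m₂) (l - h z (P - ε'))]
  set g := min (h z (P + ε') - l) (min g₂ (m₂ - μ))
  have hg : 0 < g := lt_min hg1 (lt_min hg2 (by linarith))
  have hga : g ≤ h z (P + ε') - l := min_le_left _ _
  have hgb : g ≤ g₂ := (min_le_right _ _).trans (min_le_left _ _)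
  have hgc : g ≤ m₂ - μ := (min_le_right _ _).trans (min_le_right _ _)
  -- The radius `g / (2 D)` makes the variation in `x` cost at most half of the gap `g`.
  set D := α₁ * (|B| ^ γ + 1) with hD
  have hDpos : 0 < D := by have := E.α₁_pos; positivity
  refine ⟨q, g / 2, g / (2 * D), ε', by linarith, by positivity, hε', hεε, hqε, fun x hx p hp => ?_⟩
  have hdiff : |h x p - h z p| ≤ g / 2 := by
    refine (E.ham.lip_x x z p).trans ?_
    have h3 : |p| ^ γ ≤ |B| ^ γ :=
      Real.rpow_le_rpow (abs_nonneg _) (hp.trans (le_abs_self _)) (by linarith [E.two_lt])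
    calc α₁ * (|p| ^ γ + 1) * |x - z| ≤ D * (g / (2 * D)) := by
          have := E.α₁_pos
          rw [hD] at hx ⊢
          gcongr
      _ = g / 2 := by field_simp
  have hdiff' := abs_le.1 hdiff
  refine ⟨fun h1 => ?_, fun h1 h2 => ?_, fun h1 => ?_⟩
  · have := hright p h1; linarith
  · have := hmid p h1 h2; linarith
  · have := hleft p h1; linarith

end IsEnvironment

/-- `(s, t)` is a bounded connected component of `{a > 0}`. -/
structure IsComponent (a : ℝ → ℝ) (s t : ℝ) : Prop where
  lt : s < t
  left : a s = 0
  right : a t = 0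
  pos : ∀ x ∈ Ioo s t, 0 < a x

/-- `g` solves `a g' + h(x, g) = l` on `(s, t)`. -/
def OdeOn (a : ℝ → ℝ) (h : ℝ → ℝ → ℝ) (l s t : ℝ) (g : ℝ → ℝ) : Prop :=
  ∀ x ∈ Ioo s t, HasDerivAt g ((l - h x (g x)) / a x) x

lemma lipschitzOnWith_of_abs {u : ℝ → ℝ} {K s t : ℝ} (hK : 0 ≤ K)
    (hu : ∀ x ∈ Icc s t, ∀ y ∈ Icc s t, |u x - u y| ≤ K * |x - y|) :
    LipschitzOnWith ⟨K, hK⟩ u (Icc s t) :=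
  LipschitzOnWith.of_dist_le_mul fun x hx y hy => hu x hx y hy

lemma sub_le_of_ae_deriv_le {u : ℝ → ℝ} {K s t q : ℝ} (hst : s ≤ t) (hK : 0 ≤ K)
    (hu : ∀ x ∈ Icc s t, ∀ y ∈ Icc s t, |u x - u y| ≤ K * |x - y|)
    (hd : ∀ᵐ x, x ∈ Ioo s t → deriv u x ≤ q) : u t - u s ≤ q * (t - s) := by
  have hac : AbsolutelyContinuousOnInterval u s t := by
    apply LipschitzOnWith.absolutelyContinuousOnInterval
    rw [uIcc_of_le hst]
    exact lipschitzOnWith_of_abs hK hu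
  rw [← hac.integral_deriv_eq_sub]
  have : ∫ x in s..t, deriv u x ≤ ∫ _ in s..t, q := by
    refine intervalIntegral.integral_mono_ae_restrict hst hac.intervalIntegrable_deriv
      (by simp) ?_
    rw [← restrict_Ioo_eq_restrict_Icc]
    exact (ae_restrict_iff' measurableSet_Ioo).2 hd
  simpa [mul_comm] using this

lemma deriv_le_of_touching {u U : ℝ → ℝ} {p q x t : ℝ} (hxt : x < t)
    (hu : ∀ y ∈ Ioo x t, u y - u x ≤ q * (y - x)) (hU : HasDerivAt U p x)
    (hmin : IsLocalMin (fun x => u x - U x) x) : p ≤ q := by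
  by_contra hlt
  have h1 := (hasDerivAt_iff_tendsto_slope_left_right.1 hU).2
  obtain ⟨y, h2, h3, h4⟩ := ((h1.eventually (lt_mem_nhds (not_le.1 hlt))).and
    ((Ioo_mem_nhdsGT hxt : Ioo x t ∈ 𝓝[>] x) |> fun h => (show ∀ᶠ y in 𝓝[>] x, y ∈ Ioo x t from h).and
      (Filter.Eventually.filter_mono nhdsWithin_le_nhds hmin))).exists
  have h5 := hu y h3
  rw [slope_def_field, lt_div_iff₀ (by linarith [h3.1])] at h2
  linarith

namespace IsEnvironment

variable {α₀ α₁ γ κ : ℝ} {a : ℝ → ℝ} {h : ℝ → ℝ → ℝ}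

/-- Since `1 / a ≥ 1 / (κ² (z - x)²)`, whose primitive is `(z - x)⁻¹ / κ²`, a derivative below `-c /
a` forces a drop that is unbounded as the interval approaches `z`. -/
lemma travel (E : IsEnvironment α₀ α₁ γ κ a h) {s t z c : ℝ} {g g' : ℝ → ℝ} (hst : s ≤ t)
    (hc : 0 ≤ c) (hz : a z = 0) (hzst : z ∉ Icc s t) (hpos : ∀ x ∈ Icc s t, 0 < a x)
    (hd : ∀ x ∈ Icc s t, HasDerivAt g (g' x) x) (hle : ∀ x ∈ Icc s t, g' x ≤ -(c / a x)) :
    c / κ ^ 2 * ((z - t)⁻¹ - (z - s)⁻¹) ≤ g s - g t := by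
  have hne : ∀ x ∈ Icc s t, z - x ≠ 0 := fun x hx h0 => hzst (by
    rwa [show z = x by linarith])
  have hD : ∀ x ∈ Icc s t, HasDerivAt (fun x => g x + c / κ ^ 2 * (z - x)⁻¹)
      (g' x + c / κ ^ 2 * (-(-1) / (z - x) ^ 2)) x := fun x hx =>
    (hd x hx).fun_add ((((hasDerivAt_id x).const_sub z).fun_inv (hne x hx)).const_mul _)
  have hanti : AntitoneOn (fun x => g x + c / κ ^ 2 * (z - x)⁻¹) (Icc s t) := by
    refine antitoneOn_of_hasDerivWithinAt_nonpos (convex_Icc s t)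
      (HasDerivAt.continuousOn fun x hx => hD x hx)
      (fun x hx => (hD x (interior_subset hx)).hasDerivWithinAt) fun x hx => ?_
    have hx := interior_subset hx
    have h1 := hle x hx
    have h2 : c / κ ^ 2 * (-(-1) / (z - x) ^ 2) ≤ c / a x := by
      have h3 := E.le_sq hz x
      have h4 : κ ^ 2 * (x - z) ^ 2 = κ ^ 2 * (z - x) ^ 2 := by ring
      rw [neg_neg, div_mul_div_comm, mul_one, ← h4]
      exact div_le_div_of_nonneg_left hc (hpos x hx) h3
    linarith
  have := hanti (left_mem_Icc.2 hst) (right_mem_Icc.2 hst) hst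
  simp only at this
  linarith

/-- A solution of the ODE which is supported from below by a supersolution at a lower level gets
close to the largest root when `∫ 1 / a` is large. -/
lemma abs_sub_topRoot_le (E : IsEnvironment α₀ α₁ γ κ a h) {μ l P ε B K q c s m t z : ℝ}
    {g v : ℝ → ℝ} (hc : 0 < c) (hq : q ≤ P - ε) (hsm : s < m) (hmt : m < t) (hz : a z = 0) (hzst : z ∉ Icc s t)
    (hpos : ∀ x ∈ Icc s t, 0 < a x)
    (hsep : ∀ x ∈ Icc s t, ∀ p, |p| ≤ B → (P + ε ≤ p → l + c ≤ h x p) ∧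
      (q ≤ p → p ≤ P - ε → h x p ≤ l - c) ∧ (p ≤ q → μ + c ≤ h x p))
    (hg : ∀ x ∈ Icc s t, HasDerivAt g ((l - h x (g x)) / a x) x) (hgB : ∀ x ∈ Icc s t, |g x| ≤ B)
    (hv : SuperOn a h μ (Ioo s t) v) (hK : 0 ≤ K) (hKB : K ≤ B)
    (hlip : ∀ x ∈ Icc s t, ∀ y ∈ Icc s t, |v x - v y| ≤ K * |x - y|)
    (hvg : ∀ᵐ x, x ∈ Ioo s t → deriv v x ≤ g x)
    (hbig1 : 2 * B < c / (2 * κ ^ 2) * ((z - m)⁻¹ - (z - s)⁻¹))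
    (hbig2 : 2 * B < c / (2 * κ ^ 2) * ((z - t)⁻¹ - (z - m)⁻¹)) : |g t - P| ≤ ε := by
  have hκ := E.κ_pos
  have hcont : ContinuousOn g (Icc s t) := HasDerivAt.continuousOn fun x hx => hg x hx
  have hbig2' : 2 * B < c / κ ^ 2 * ((z - t)⁻¹ - (z - m)⁻¹) := by
    have hB : 0 ≤ B := hK.trans hKB
    have e : c / (2 * κ ^ 2) * ((z - t)⁻¹ - (z - m)⁻¹) =
        c / κ ^ 2 * ((z - t)⁻¹ - (z - m)⁻¹) / 2 := by
      rw [mul_comm 2, ← div_div]; ring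
    rw [e] at hbig2
    linarith
  have hmt' : Icc m t ⊆ Icc s t := Icc_subset_Icc hsm.le le_rfl
  have ht : t ∈ Icc s t := ⟨by linarith, le_rfl⟩
  have hm : m ∈ Icc s t := ⟨by linarith, by linarith⟩
  have hgt := abs_le.1 (hgB t ht)
  have hgm := abs_le.1 (hgB m hm)
  rw [abs_le]
  constructor
  · by_contra hlt
    push Not at hlt
    -- At the value `P - ε` the ODE forces `g' > 0`, so this value cannot be crossed downwards: if
    -- `g` ends below it, it was never above it.
    have hlow : ∀ y ∈ Icc s t, g y ≤ P - ε := by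
      intro y hy
      by_contra hy'
      push Not at hy'
      have hsub : Icc y t ⊆ Icc s t := Icc_subset_Icc hy.1 le_rfl
      have := image_le_of_deriv_right_lt_deriv_boundary (f := fun x => -g x)
        (B := fun _ => -(P - ε)) (B' := fun _ => 0) (hcont.mono hsub).neg
        (fun x hx => (hg x (hsub ⟨hx.1, hx.2.le⟩)).fun_neg.hasDerivWithinAt) (by linarith)
        (fun x => hasDerivAt_const x _) (fun x hx he => by
          have hx' := hsub ⟨hx.1, hx.2.le⟩
          have he' : g x = P - ε := by linarith
          have h1 := (hsep x hx' (g x) (hgB x hx')).2.1 (by rw [he']; exact hq) he'.le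
          have : 0 < (l - h x (g x)) / a x := div_pos (by linarith) (hpos x hx')
          linarith) (right_mem_Icc.2 hy.2)
      linarith
    -- Once above `q`, `g` stays there, and between `q` and `P - ε` it rises at rate at least `c /
    -- a`; on `[m, t]` this exceeds the room `2 B`. If instead `g < q` on all of `[s, m]`, the
    -- slopes of `v` are below `q`, where `h ≥ μ + c`, and `v` would be bent for too long.
    by_cases hex : ∃ y ∈ Icc s m, q ≤ g y
    · obtain ⟨y, hy, hqy⟩ := hex
      have hsub : Icc y t ⊆ Icc s t := Icc_subset_Icc hy.1 le_rfl
      have hup : ∀ x ∈ Icc y t, -g x ≤ -q :=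
        image_le_of_deriv_right_lt_deriv_boundary (f := fun x => -g x)
          (B := fun _ => -q) (B' := fun _ => 0) (hcont.mono hsub).neg
          (fun x hx => (hg x (hsub ⟨hx.1, hx.2.le⟩)).fun_neg.hasDerivWithinAt) (by linarith)
          (fun x => hasDerivAt_const x _) (fun x hx he => by
            have hx' := hsub ⟨hx.1, hx.2.le⟩
            have h1 := (hsep x hx' (g x) (hgB x hx')).2.1 (by linarith) (hlow x hx')
            have : 0 < (l - h x (g x)) / a x := div_pos (by linarith) (hpos x hx')
            linarith)
      have := E.travel (g := fun x => -g x) hmt.le hc.le hz (fun h => hzst (hmt' h))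
        (fun x hx => hpos x (hmt' hx)) (fun x hx => (hg x (hmt' hx)).fun_neg) (fun x hx => by
          have hx' := hmt' hx
          have h1 := (hsep x hx' (g x) (hgB x hx')).2.1
            (by linarith [hup x ⟨by linarith [hx.1, hy.2], hx.2⟩]) (hlow x hx')
          have := div_le_div_of_nonneg_right (by linarith : c ≤ l - h x (g x)) (hpos x hx').le
          linarith)
      linarith
    · push Not at hex
      have hsub : Icc s m ⊆ Icc s t := Icc_subset_Icc le_rfl hmt.le
      refine E.not_bent_of_superOn (K := B) hsm hv (Ioo_subset_Ioo le_rfl hmt.le)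
        (fun x hx y hy => (hlip x (hsub hx) y (hsub hy)).trans (by gcongr)) hc hz
        (fun h => hzst (hsub h)) hbig1 fun x hx U p hU hmin => ?_
      have hx' : x ∈ Icc s t := hsub ⟨hx.1.le, hx.2.le⟩
      refine (hsep x hx' p ((abs_deriv_le_of_isLocalMin ⟨hx.1, hx.2.trans hmt⟩ hlip hU hmin).trans
        hKB)).2.2 ?_
      refine deriv_le_of_touching hx.2 (fun y hy => ?_) hU hmin
      have hxy : Icc x y ⊆ Icc s t := Icc_subset_Icc hx.1.le (by linarith [hy.2])
      refine sub_le_of_ae_deriv_le hy.1.le hK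
        (fun x' hx' y' hy' => hlip x' (hxy hx') y' (hxy hy')) ?_
      filter_upwards [hvg] with w hw hwI
      exact (hw ⟨by linarith [hwI.1, hx.1], by linarith [hwI.2, hy.2]⟩).trans
        (hex w ⟨by linarith [hwI.1, hx.1], by linarith [hwI.2, hy.2]⟩).le
  · by_contra hlt
    push Not at hlt
    have hup : ∀ y ∈ Icc s t, P + ε ≤ g y := by
      intro y hy
      by_contra hy'
      push Not at hy'
      have hsub : Icc y t ⊆ Icc s t := Icc_subset_Icc hy.1 le_rfl
      have := image_le_of_deriv_right_lt_deriv_boundary (f := g)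
        (B := fun _ => P + ε) (B' := fun _ => 0) (hcont.mono hsub)
        (fun x hx => (hg x (hsub ⟨hx.1, hx.2.le⟩)).hasDerivWithinAt) (by linarith)
        (fun x => hasDerivAt_const x _) (fun x hx he => by
          have hx' := hsub ⟨hx.1, hx.2.le⟩
          have h1 := (hsep x hx' (g x) (hgB x hx')).1 he.ge
          exact div_neg_of_neg_of_pos (by linarith) (hpos x hx')) (right_mem_Icc.2 hy.2)
      linarith
    have := E.travel (g := g) hmt.le hc.le hz (fun h => hzst (hmt' h))
      (fun x hx => hpos x (hmt' hx)) (fun x hx => hg x (hmt' hx)) (fun x hx => by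
        have hx' := hmt' hx
        have h1 := (hsep x hx' (g x) (hgB x hx')).1 (hup x hx')
        rw [← neg_div]
        exact div_le_div_of_nonneg_right (by linarith) (hpos x hx').le)
    linarith

/-- Solutions of the ODE on components of `{a > 0}`, supported from below by a supersolution at a
lower level, approach the largest root near zeros of `a`, uniformly in the component. -/
lemma exists_forall_abs_sub_topRoot_le (E : IsEnvironment α₀ α₁ γ κ a h) {μ l z ε B : ℝ}
    (hμ : μ < l) (hne : ∀ m, μ < m → ∃ p, h z p < m) (hz : a z = 0) (hε : 0 < ε)
    (hB : slopeBound α₀ μ ≤ B) :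
    ∃ δ > 0, ∀ (s t : ℝ) (g v : ℝ → ℝ), IsComponent a s t → OdeOn a h l s t g →
      (∀ x ∈ Ioo s t, |g x| ≤ B) → SuperOn a h μ (Ioo (s - 1) (t + 1)) v →
      (∀ᵐ x, x ∈ Ioo s t → deriv v x ≤ g x) →
      ∀ x ∈ Ioo s t, |x - z| < δ → |g x - topRoot h l z| ≤ ε := by
  obtain ⟨q, c, δ, ε', hc, hδ, hε', hεε, hq, hsep⟩ := E.exists_separation (B := B) hμ hne hε
  have hκ := E.κ_pos
  have hKpos := slopeBound_pos E.α₀_pos μ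
  have hBpos : 0 < B := hKpos.trans_le hB
  set C := c / (2 * κ ^ 2)
  have hC : 0 < C := by positivity
  -- `R` is the increase of `(z - ·)⁻¹` needed for the two contradictions in `abs_sub_topRoot_le`.
  set R := 2 * B / C + 1
  have hR : 0 < R := by positivity
  have hCR : 2 * B < C * R := by
    have : C * R = 2 * B + C := by simp only [R]; field_simp
    linarith
  have hbig : ∀ {d}, R ≤ d → 2 * B < C * d := fun hd =>
    hCR.trans_le (mul_le_mul_of_nonneg_left hd hC.le)
  -- In terms of reciprocal distance to `z`, the steps from `δ / 2` to `d₁` and from `d₁` to `d₂`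
  -- have length `R` each.
  set d₁ := (2 / δ + R)⁻¹ with hd₁
  set d₂ := (2 / δ + 2 * R)⁻¹ with hd₂
  have hd1 : 0 < d₁ := by positivity
  have hd2 : 0 < d₂ := by positivity
  have hd12 : d₂ < d₁ := inv_strictAnti₀ (by positivity) (by linarith)
  have hd1δ : d₁ < δ / 2 := by
    rw [show δ / 2 = (2 / δ)⁻¹ by rw [inv_div]]
    exact inv_strictAnti₀ (by positivity) (by linarith)
  refine ⟨d₂, hd2, fun s t g v hI hg hgB hv hvg x hx hxz => ?_⟩
  refine le_trans ?_ hεε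
  have hxz' := abs_lt.1 hxz
  have hlip := E.lipschitz_of_superOn hv
  -- The zero `z'` that serves as pole need not be `z`; the left end of the component is used when
  -- it is close to `z`.
  have main : ∀ s' m z' : ℝ, s < s' → s' < m → m < x → a z' = 0 → z' ∉ Icc s' x →
      (∀ y ∈ Icc s' x, |y - z| ≤ δ) → R ≤ (z' - m)⁻¹ - (z' - s')⁻¹ → R ≤ (z' - x)⁻¹ - (z' - m)⁻¹ →
      |g x - topRoot h l z| ≤ ε' := by
    intro s' m z' hs' hm hmx hz' hzn hball h1 h2
    have hsub : Icc s' x ⊆ Ioo s t := fun y hy => ⟨by linarith [hy.1], by linarith [hy.2, hx.2]⟩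
    have hsub' : Icc s' x ⊆ Icc s t := hsub.trans Ioo_subset_Icc_self
    refine E.abs_sub_topRoot_le hc hq hm hmx hz' hzn (fun y hy => hI.pos y (hsub hy))
      (fun y hy => hsep y (hball y hy)) (fun y hy => hg y (hsub hy)) (fun y hy => hgB y (hsub hy))
      (hv.mono (fun y hy => ⟨by linarith [hy.1], by linarith [hy.2, hx.2]⟩) le_rfl) hKpos.le hB
      (fun y hy w hw => hlip y (hsub' hy) w (hsub' hw)) ?_ (hbig h1) (hbig h2)
    filter_upwards [hvg] with y hy hyI using hy (hsub ⟨hyI.1.le, hyI.2.le⟩)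
  by_cases hcase : z - δ < s
  · -- use the left end point of the component
    have hxs : 0 < x - s := by linarith [hx.1]
    -- Any amount of `∫ 1 / a` is available next to the zero `s`, however close `x` is to it. The
    -- reciprocal distances of `x`, `s + e₁`, `s + e₂` to `s` differ by `R`; this makes the estimate
    -- uniform in the component.
    set e₁ := ((x - s)⁻¹ + R)⁻¹
    set e₂ := ((x - s)⁻¹ + 2 * R)⁻¹
    have he1 : 0 < e₁ := by positivity
    have he2 : 0 < e₂ := by positivity
    have he12 : e₂ < e₁ := inv_strictAnti₀ (by positivity) (by linarith)
    have he1x : e₁ < x - s := by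
      rw [← inv_inv (x - s)]
      exact inv_strictAnti₀ (by positivity) (by linarith)
    refine main (s + e₂) (s + e₁) s (by linarith) (by linarith) (by linarith) hI.left
      (fun h => by linarith [h.1]) (fun y hy => ?_) ?_ ?_
    · rw [abs_le]; constructor <;> linarith [hy.1, hy.2]
    · rw [sub_add_cancel_left, sub_add_cancel_left, inv_neg, inv_neg, inv_inv, inv_inv]
      linarith
    · rw [sub_add_cancel_left, ← neg_sub x s, inv_neg, inv_neg, inv_inv]
      linarith
  · push Not at hcase
    -- The component begins at least `δ` before `z` and cannot contain the zero `z`, so `z` lies to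
    -- the right of `x` and the approach to `z` supplies the divergence.
    have hxz0 : x < z := by
      by_contra hle
      have := hI.pos z ⟨by linarith, by linarith [hx.2]⟩
      linarith
    refine main (z - δ / 2) (z - d₁) z (by linarith) (by linarith) (by linarith) hz
      (fun h => by linarith [h.2]) (fun y hy => ?_) ?_ ?_
    · rw [abs_le]; constructor <;> linarith [hy.1, hy.2]
    · rw [sub_sub_cancel, sub_sub_cancel, hd₁, inv_inv, inv_div]
      linarith
    · rw [sub_sub_cancel, hd₁, inv_inv]
      have : d₂⁻¹ ≤ (z - x)⁻¹ := inv_anti₀ (by linarith) (by linarith)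
      rw [hd₂, inv_inv] at this
      linarith

end IsEnvironment

end

/-! ### The ODE for the slope: solvability, comparison, limits, uniqueness at a singular end point
-/

noncomputable section

/-- Truncation of `p` to `[-B, B]`. -/
def clamp (B p : ℝ) : ℝ := max (-B) (min B p)

lemma abs_clamp_le {B : ℝ} (hB : 0 ≤ B) (p : ℝ) : |clamp B p| ≤ B :=
  abs_le.2 ⟨le_max_left _ _, max_le (by linarith) (min_le_left _ _)⟩

lemma clamp_eq {B p : ℝ} (hp : |p| ≤ B) : clamp B p = p := by
  rw [abs_le] at hp
  rw [clamp, min_eq_right hp.2, max_eq_right hp.1]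

lemma abs_clamp_sub_le (B p q : ℝ) : |clamp B p - clamp B q| ≤ |p - q| := by
  unfold clamp
  refine (abs_max_sub_max_le_max _ _ _ _).trans ?_
  rw [sub_self, abs_zero]
  refine max_le (abs_nonneg _) ((abs_min_sub_min_le_max _ _ _ _).trans ?_)
  simp

namespace IsEnvironment

variable {α₀ α₁ γ κ : ℝ} {a : ℝ → ℝ} {h : ℝ → ℝ → ℝ}

lemma exists_pos_le (E : IsEnvironment α₀ α₁ γ κ a h) {s t : ℝ} (hpos : ∀ x ∈ Icc s t, 0 < a x) :
    ∃ δ > 0, ∀ x ∈ Icc s t, δ ≤ a x := by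
  rcases (Icc s t).eq_empty_or_nonempty with he | hne
  · exact ⟨1, one_pos, fun x hx => by simp [he] at hx⟩
  · obtain ⟨y, hy, hmin⟩ := isCompact_Icc.exists_isMinOn hne E.continuous_a.continuousOn
    exact ⟨a y, hpos y hy, fun x hx => hmin hx⟩

lemma abs_h_le (E : IsEnvironment α₀ α₁ γ κ a h) {B p : ℝ} (x : ℝ) (hp : |p| ≤ B) :
    |h x p| ≤ α₁ * (B ^ γ + 1) + 1 / α₀ := by
  have h1 := E.ham.upper x p
  have h2 := E.neg_le x p
  have h3 : |p| ^ γ ≤ B ^ γ :=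
    Real.rpow_le_rpow (abs_nonneg _) hp (by linarith [E.two_lt])
  have h4 := mul_le_mul_of_nonneg_left h3 E.α₁_pos.le
  have h5 : 0 < 1 / α₀ := by have := E.α₀_pos; positivity
  have h6 : 0 ≤ α₁ * (B ^ γ + 1) := by
    have := E.α₁_pos
    have : 0 ≤ B ^ γ := (Real.rpow_nonneg (abs_nonneg p) _).trans h3
    positivity
  rw [abs_le]
  constructor <;> linarith

lemma exists_field_bounds (E : IsEnvironment α₀ α₁ γ κ a h) {s t : ℝ} (l B : ℝ) (hB : 0 ≤ B)
    (hpos : ∀ x ∈ Icc s t, 0 < a x) :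
    ∃ L M : NNReal, ∀ x ∈ Icc s t,
      LipschitzOnWith L (fun p => (l - h x p) / a x) (Icc (-B) B) ∧
      ∀ p, |p| ≤ B → |(l - h x p) / a x| ≤ M := by
  obtain ⟨δ, hδ, hle⟩ := E.exists_pos_le hpos
  have h₁ := E.α₁_pos
  have h₀ := E.α₀_pos
  refine ⟨⟨α₁ * (2 * B + 1) ^ (γ - 1) / δ, by positivity⟩,
    ⟨(|l| + (α₁ * (B ^ γ + 1) + 1 / α₀)) / δ, by positivity⟩, fun x hx => ⟨?_, fun p hp => ?_⟩⟩
  · refine LipschitzOnWith.of_dist_le_mul fun p hp q hq => ?_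
    rw [Real.dist_eq, Real.dist_eq, ← sub_div, abs_div, abs_of_pos (hpos x hx)]
    have := E.lip_p_of_le (x := x) (abs_le.2 hp) (abs_le.2 hq)
    rw [show l - h x p - (l - h x q) = -(h x p - h x q) by ring, abs_neg]
    show _ ≤ α₁ * (2 * B + 1) ^ (γ - 1) / δ * |p - q|
    rw [div_mul_eq_mul_div]
    exact div_le_div₀ (by positivity) this hδ (hle x hx)
  · rw [abs_div, abs_of_pos (hpos x hx)]
    exact div_le_div₀ (by positivity) ((abs_sub _ _).trans (by gcongr; exact E.abs_h_le x hp)) hδ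
      (hle x hx)

/-- Solvability of the truncated ODE. -/
lemma exists_truncated_ode (E : IsEnvironment α₀ α₁ γ κ a h) {s t : ℝ} (l : ℝ) {B : ℝ}
    (hst : s < t) (hB : 0 ≤ B) (hpos : ∀ x ∈ Icc s t, 0 < a x) :
    ∃ f : ℝ → ℝ, Continuous f ∧ f s = B ∧
      (∀ x ∈ Ico s t, HasDerivWithinAt f ((l - h x (clamp B (f x))) / a x) (Ici x) x) ∧
      ∀ x ∈ Ioo s t, HasDerivAt f ((l - h x (clamp B (f x))) / a x) x := by
  obtain ⟨L, M, hLM⟩ := E.exists_field_bounds l B hB hpos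
  -- The clamped field is bounded by `M` for all `p`, so a ball of radius `M (t - s)` suffices and
  -- the solution exists on the whole interval.
  have hpl : IsPicardLindelof (fun x p => (l - h x (clamp B p)) / a x)
      (⟨s, left_mem_Icc.2 hst.le⟩ : Icc s t) B (M * ⟨t - s, by linarith⟩) 0 M L := by
    refine ⟨fun x hx => ?_, fun p _ => ?_, fun x hx p _ => ?_, ?_⟩
    · refine LipschitzOnWith.of_dist_le_mul fun p _ q _ => ?_
      refine ((hLM x hx).1.dist_le_mul _ (abs_le.1 (abs_clamp_le hB p)) _
        (abs_le.1 (abs_clamp_le hB q))).trans ?_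
      gcongr
      exact abs_clamp_sub_le B p q
    · exact (continuousOn_const.sub (E.continuous_h_left _).continuousOn).div
        E.continuous_a.continuousOn fun x hx => (hpos x hx).ne'
    · exact (hLM x hx).2 _ (abs_clamp_le hB p)
    · have : max (t - s) (s - s) = t - s := by rw [sub_self]; exact max_eq_left (by linarith)
      simp only [this]
      simp
      rfl
  obtain ⟨f₀, hf0, hf⟩ := hpl.exists_eq_forall_mem_Icc_hasDerivWithinAt₀
  simp only at hf0
  have hc : ContinuousOn f₀ (Icc s t) := fun x hx => (hf x hx).continuousWithinAt
  let f := IccExtend hst.le ((Icc s t).domRestrict f₀)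
  have hfc : Continuous f := hc.domRestrict.Icc_extend'
  have hfe : ∀ x ∈ Icc s t, f x = f₀ x := fun x hx => by
    simp only [f, IccExtend_of_mem hst.le _ hx, domRestrict_apply]
  have hfW : ∀ x ∈ Icc s t, HasDerivWithinAt f ((l - h x (clamp B (f x))) / a x) (Icc s t) x :=
    fun x hx => by
      rw [hfe x hx]
      exact (hf x hx).congr hfe (hfe x hx)
  refine ⟨f, hfc, by rw [hfe s (left_mem_Icc.2 hst.le), hf0], fun x hx => ?_, fun x hx => ?_⟩
  · exact (hfW x ⟨hx.1, hx.2.le⟩).mono_of_mem_nhdsWithin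
      (mem_of_superset (Icc_mem_nhdsGE hx.2) (Icc_subset_Icc hx.1 le_rfl))
  · exact (hfW x ⟨hx.1.le, hx.2.le⟩).hasDerivAt (Icc_mem_nhds hx.1 hx.2)

/-- Uniqueness for the ODE, forward in `x`. -/
lemma ode_unique (E : IsEnvironment α₀ α₁ γ κ a h) {s t l B : ℝ} {f g : ℝ → ℝ} (hB : 0 ≤ B)
    (hpos : ∀ x ∈ Icc s t, 0 < a x) (hfc : ContinuousOn f (Icc s t))
    (hgc : ContinuousOn g (Icc s t))
    (hf : ∀ x ∈ Ico s t, HasDerivWithinAt f ((l - h x (f x)) / a x) (Ici x) x)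
    (hg : ∀ x ∈ Ico s t, HasDerivWithinAt g ((l - h x (g x)) / a x) (Ici x) x)
    (hfB : ∀ x ∈ Ico s t, |f x| ≤ B) (hgB : ∀ x ∈ Ico s t, |g x| ≤ B) (heq : f s = g s) :
    EqOn f g (Icc s t) := by
  obtain ⟨L, M, hLM⟩ := E.exists_field_bounds l B hB hpos
  exact ODE_solution_unique_of_mem_Icc_right (v := fun x p => (l - h x p) / a x)
    (s := fun _ => Icc (-B) B) (fun x hx => (hLM x ⟨hx.1, hx.2.le⟩).1) hfc hf
    (fun x hx => abs_le.1 (hfB x hx)) hgc hg (fun x hx => abs_le.1 (hgB x hx)) heq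

/-- Comparison for the ODE, forward in `x`. -/
lemma ode_le (E : IsEnvironment α₀ α₁ γ κ a h) {s t l B : ℝ} {f g : ℝ → ℝ} (hB : 0 ≤ B)
    (hpos : ∀ x ∈ Icc s t, 0 < a x) (hfc : ContinuousOn f (Icc s t))
    (hgc : ContinuousOn g (Icc s t))
    (hf : ∀ x ∈ Ico s t, HasDerivWithinAt f ((l - h x (f x)) / a x) (Ici x) x)
    (hg : ∀ x ∈ Ico s t, HasDerivWithinAt g ((l - h x (g x)) / a x) (Ici x) x)
    (hfB : ∀ x ∈ Ico s t, |f x| ≤ B) (hgB : ∀ x ∈ Ico s t, |g x| ≤ B) (hle : f s ≤ g s) :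
    ∀ x ∈ Icc s t, f x ≤ g x := by
  intro x hx
  by_contra hlt
  push Not at hlt
  have hsub : Icc s x ⊆ Icc s t := Icc_subset_Icc le_rfl hx.2
  -- At a crossing the two solutions agree, and forward uniqueness makes them agree afterwards,
  -- including at `x`.
  obtain ⟨y, hy, hy0⟩ : ∃ y ∈ Icc s x, f y - g y = 0 :=
    intermediate_value_Icc hx.1 ((hfc.sub hgc).mono hsub) ⟨by simpa using hle, by simpa using hlt.le⟩
  have hsub2 : Icc y x ⊆ Icc s t := Icc_subset_Icc hy.1 hx.2
  have hsub3 : Ico y x ⊆ Ico s t := Ico_subset_Ico hy.1 hx.2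
  have := E.ode_unique hB (fun w hw => hpos w (hsub2 hw)) (hfc.mono hsub2) (hgc.mono hsub2)
    (fun w hw => hf w (hsub3 hw)) (fun w hw => hg w (hsub3 hw)) (fun w hw => hfB w (hsub3 hw))
    (fun w hw => hgB w (hsub3 hw)) (sub_eq_zero.1 hy0) (right_mem_Icc.2 hy.2)
  linarith

/-- Pointwise limits of bounded solutions of the ODE are solutions. -/
lemma ode_limit (E : IsEnvironment α₀ α₁ γ κ a h) {s t l B : ℝ} {F : ℕ → ℝ → ℝ} {f : ℝ → ℝ}
    {L : ℕ → ℝ} (hB : 0 ≤ B) (hpos : ∀ x ∈ Ioo s t, 0 < a x) (hF : ∀ n, OdeOn a h (L n) s t (F n))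
    (hFB : ∀ n, ∀ x ∈ Ioo s t, |F n x| ≤ B) (hL : Tendsto L atTop (𝓝 l))
    (hlim : ∀ x ∈ Ioo s t, Tendsto (fun n => F n x) atTop (𝓝 (f x))) : OdeOn a h l s t f := by
  intro x hx
  obtain ⟨s', hs1, hs2⟩ := exists_between hx.1
  obtain ⟨t', ht1, ht2⟩ := exists_between hx.2
  have hsub : Icc s' t' ⊆ Ioo s t := fun y hy => ⟨by linarith [hy.1], by linarith [hy.2]⟩
  obtain ⟨δ, hδ, hδle⟩ := E.exists_pos_le fun y hy => hpos y (hsub hy)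
  obtain ⟨Λ, hΛ⟩ : ∃ Λ, ∀ n, |L n| ≤ Λ := by
    obtain ⟨Λ, hΛ⟩ := hL.abs.bddAbove_range
    exact ⟨Λ, fun n => hΛ (mem_range_self n)⟩
  have h₁ := E.α₁_pos
  have h₀ := E.α₀_pos
  have hΛ0 : 0 ≤ Λ := (abs_nonneg _).trans (hΛ 0)
  set M := (Λ + (α₁ * (B ^ γ + 1) + 1 / α₀)) / δ with hM
  have hMn : ∀ (c p y : ℝ), |c| ≤ Λ → y ∈ Icc s' t' → |p| ≤ B → |(c - h y p) / a y| ≤ M := by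
    intro c p y hc hy hp
    rw [abs_div, abs_of_pos (hpos y (hsub hy))]
    exact div_le_div₀ (by positivity) ((abs_sub _ _).trans (by gcongr; exact E.abs_h_le y hp)) hδ
      (hδle y hy)
  have hfB : ∀ y ∈ Ioo s t, |f y| ≤ B := fun y hy =>
    le_of_tendsto (hlim y hy).abs (Eventually.of_forall fun n => hFB n y hy)
  have hl : |l| ≤ Λ := le_of_tendsto hL.abs (Eventually.of_forall hΛ)
  have huIcc : ∀ y ∈ Icc s' t', ∀ w ∈ Icc s' t', uIcc y w ⊆ Icc s' t' := fun y hy w hw =>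
    uIcc_subset_Icc hy hw
  have hcF : ∀ n, ContinuousOn (F n) (Icc s' t') := fun n =>
    HasDerivAt.continuousOn fun y hy => hF n y (hsub hy)
  have hcb : ∀ (c : ℝ) (g : ℝ → ℝ), ContinuousOn g (Icc s' t') →
      ContinuousOn (fun y => (c - h y (g y)) / a y) (Icc s' t') := fun c g hg =>
    (continuousOn_const.sub (E.continuous_h.comp_continuousOn
      (continuousOn_id.prodMk hg))).div E.continuous_a.continuousOn
      fun y hy => (hpos y (hsub hy)).ne'
  -- The integral form passes to a merely pointwise limit by dominated convergence; it first gives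
  -- that `f` is Lipschitz, hence that the integrand is continuous, and then the ODE.
  have hint : ∀ y ∈ Icc s' t', ∀ w ∈ Icc s' t',
      f w - f y = ∫ r in y..w, (l - h r (f r)) / a r := by
    intro y hy w hw
    have h1 : Tendsto (fun n => ∫ r in y..w, (L n - h r (F n r)) / a r) atTop
        (𝓝 (∫ r in y..w, (l - h r (f r)) / a r)) := by
      refine intervalIntegral.tendsto_integral_filter_of_dominated_convergence (fun _ => M)
        (Eventually.of_forall fun n => ?_) (Eventually.of_forall fun n => ?_) (by simp) ?_
      · exact (((hcb (L n) (F n) (hcF n)).mono (huIcc y hy w hw)).mono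
          uIoc_subset_uIcc).aestronglyMeasurable measurableSet_uIoc
      · refine Eventually.of_forall fun r hr => ?_
        have hr' := huIcc y hy w hw (uIoc_subset_uIcc hr)
        exact hMn _ _ _ (hΛ n) hr' (hFB n r (hsub hr'))
      · refine Eventually.of_forall fun r hr => ?_
        have hr' := hsub (huIcc y hy w hw (uIoc_subset_uIcc hr))
        exact (hL.sub (((E.continuous_h_right r).tendsto _).comp (hlim r hr'))).div_const _
    have h2 : ∀ n, ∫ r in y..w, (L n - h r (F n r)) / a r = F n w - F n y := fun n =>
      intervalIntegral.integral_eq_sub_of_hasDerivAt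
        (fun r hr => hF n r (hsub (huIcc y hy w hw hr)))
        ((hcb (L n) (F n) (hcF n)).mono (huIcc y hy w hw)).intervalIntegrable
    simp only [h2] at h1
    exact tendsto_nhds_unique ((hlim w (hsub hw)).sub (hlim y (hsub hy))) h1
  have hfc : ContinuousOn f (Icc s' t') := by
    have : LipschitzOnWith ⟨M, by positivity⟩ f (Icc s' t') := by
      refine LipschitzOnWith.of_dist_le_mul fun w hw y hy => ?_
      rw [Real.dist_eq, hint y hy w hw]
      have hbd : ∀ r ∈ uIoc y w, ‖(l - h r (f r)) / a r‖ ≤ M := fun r hr => by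
        have hr' := huIcc y hy w hw (uIoc_subset_uIcc hr)
        exact hMn _ _ _ hl hr' (hfB r (hsub hr'))
      exact intervalIntegral.norm_integral_le_of_norm_le_const hbd
    exact this.continuousOn
  have hx' : x ∈ Ioo s' t' := ⟨hs2, ht1⟩
  have hb := hcb l f hfc
  have hd : HasDerivAt (fun w => ∫ r in x..w, (l - h r (f r)) / a r) ((l - h x (f x)) / a x) x := by
    refine intervalIntegral.integral_hasDerivAt_right (by simp) ?_
      (hb.continuousAt (Icc_mem_nhds hx'.1 hx'.2))
    exact (hb.mono Ioo_subset_Icc_self).stronglyMeasurableAtFilter isOpen_Ioo x hx'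
  refine (hd.const_add (f x)).congr_of_eventuallyEq ?_
  filter_upwards [Ioo_mem_nhds hx'.1 hx'.2] with w hw
  rw [← hint x ⟨hx'.1.le, hx'.2.le⟩ w ⟨hw.1.le, hw.2.le⟩]; ring

/-- Solutions of the ODE with a common limit `topRoot` at the left end of a component agree. -/
lemma eqOn_of_tendsto (E : IsEnvironment α₀ α₁ γ κ a h) {s t l B : ℝ} {f g : ℝ → ℝ} (hB : 0 ≤ B)
    (hI : IsComponent a s t) (hf : OdeOn a h l s t f) (hg : OdeOn a h l s t g)
    (hfB : ∀ x ∈ Ioo s t, |f x| ≤ B) (hgB : ∀ x ∈ Ioo s t, |g x| ≤ B) (hne : ∃ p, h s p < l)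
    (hft : Tendsto f (𝓝[>] s) (𝓝 (topRoot h l s))) (hgt : Tendsto g (𝓝[>] s) (𝓝 (topRoot h l s))) :
    EqOn f g (Ioo s t) := by
  suffices key : ∀ f g : ℝ → ℝ, OdeOn a h l s t f → OdeOn a h l s t g →
      (∀ x ∈ Ioo s t, |f x| ≤ B) → (∀ x ∈ Ioo s t, |g x| ≤ B) →
      Tendsto f (𝓝[>] s) (𝓝 (topRoot h l s)) → Tendsto g (𝓝[>] s) (𝓝 (topRoot h l s)) →
      ∀ x ∈ Ioo s t, f x ≤ g x from fun x hx =>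
    le_antisymm (key f g hf hg hfB hgB hft hgt x hx) (key g f hg hf hgB hfB hgt hft x hx)
  clear hf hg hfB hgB hft hgt f g
  intro f g hf hg hfB hgB hft hgt x hx
  by_contra hlt
  push Not at hlt
  -- Forward comparison, read backwards: a strict inequality at `x` must hold on all of `(s, x]`.
  have hgf : ∀ y ∈ Ioc s x, g y < f y := by
    intro y hy
    by_contra hle
    push Not at hle
    have hsub : Icc y x ⊆ Ioo s t := fun w hw => ⟨by linarith [hw.1, hy.1], by linarith [hw.2, hx.2]⟩
    have := E.ode_le hB (fun w hw => hI.pos w (hsub hw))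
      (HasDerivAt.continuousOn fun w hw => hf w (hsub hw))
      (HasDerivAt.continuousOn fun w hw => hg w (hsub hw))
      (fun w hw => (hf w (hsub ⟨hw.1, hw.2.le⟩)).hasDerivWithinAt)
      (fun w hw => (hg w (hsub ⟨hw.1, hw.2.le⟩)).hasDerivWithinAt)
      (fun w hw => hfB w (hsub ⟨hw.1, hw.2.le⟩)) (fun w hw => hgB w (hsub ⟨hw.1, hw.2.le⟩)) hle
      x (right_mem_Icc.2 hy.2)
    linarith
  obtain ⟨p₀, hp₀⟩ := hne
  have hP := E.h_topRoot ⟨p₀, hp₀⟩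
  obtain ⟨m, hm1, hm2⟩ := exists_between hp₀
  have e1 : ∀ᶠ y in 𝓝[>] s, h y p₀ < m :=
    Filter.Eventually.filter_mono nhdsWithin_le_nhds
      ((E.continuous_h_left p₀).tendsto s |>.eventually (gt_mem_nhds hm1))
  have e2 : ∀ᶠ y in 𝓝[>] s, m < h y (g y) := by
    have : Tendsto (fun y => h y (g y)) (𝓝[>] s) (𝓝 (h s (topRoot h l s))) :=
      (E.continuous_h.tendsto (s, topRoot h l s)).comp
        ((tendsto_id.mono_left nhdsWithin_le_nhds).prodMk_nhds hgt)
    rw [hP] at this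
    exact this.eventually (lt_mem_nhds hm2)
  have e3 : ∀ᶠ y in 𝓝[>] s, p₀ < g y := hgt.eventually (lt_mem_nhds (E.lt_topRoot hp₀))
  obtain ⟨r, hr, hall⟩ := mem_nhdsGT_iff_exists_Ioo_subset.1 (e1.and (e2.and e3))
  have hr' : s < r := hr
  set r' := min r x
  have hr'1 : s < r' := lt_min hr' hx.1
  have hder : ∀ y ∈ Ioo s r', HasDerivAt (fun y => f y - g y)
      ((l - h y (f y)) / a y - (l - h y (g y)) / a y) y := fun y hy =>
    (hf y ⟨hy.1, by linarith [hy.2, min_le_right r x, hx.2]⟩).fun_sub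
      (hg y ⟨hy.1, by linarith [hy.2, min_le_right r x, hx.2]⟩)
  -- Near `s` both solutions lie on the increasing branch of `h(y, ·)`, so the larger one grows more
  -- slowly and `f - g` decreases. A positive decreasing function cannot have limit `0` at the left
  -- end.
  have hanti : StrictAntiOn (fun y => f y - g y) (Ioo s r') := by
    refine strictAntiOn_of_hasDerivWithinAt_neg (convex_Ioo _ _)
      (HasDerivAt.continuousOn hder) (fun y hy => (hder y (interior_subset hy)).hasDerivWithinAt)
      fun y hy => ?_
    have hy := interior_subset hy
    obtain ⟨h1, h2, h3⟩ := hall ⟨hy.1, hy.2.trans_le (min_le_left _ _)⟩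
    have h4 := hgf y ⟨hy.1, hy.2.le.trans (min_le_right _ _)⟩
    have h5 := E.h_lt_of_lt_right h3 h4 (by linarith)
    rw [← sub_div]
    exact div_neg_of_neg_of_pos (by linarith)
      (hI.pos y ⟨hy.1, by linarith [hy.2, min_le_right r x, hx.2]⟩)
  obtain ⟨y, hy1, hy2⟩ := exists_between hr'1
  have hpos : 0 < f y - g y := by
    linarith [hgf y ⟨hy1, hy2.le.trans (min_le_right _ _)⟩]
  have hlim : Tendsto (fun y => f y - g y) (𝓝[>] s) (𝓝 0) := by simpa using hft.sub hgt
  have : f y - g y ≤ 0 := by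
    refine ge_of_tendsto hlim ?_
    filter_upwards [Ioo_mem_nhdsGT hy1] with w hw
    exact (hanti ⟨hw.1, hw.2.trans hy2⟩ ⟨hy1, hy2⟩ hw.2).le
  linarith

end IsEnvironment

end

/-! ### Construction of the maximal slope -/

noncomputable section

/-- A continuous function without interior local maxima which increases at the left end is
monotone. -/
lemma monotoneOn_of_no_isLocalMax {D : ℝ → ℝ} {s t : ℝ} (hc : ContinuousOn D (Icc s t))
    (hno : ∀ x ∈ Ioo s t, ¬ IsLocalMax D x) (hinc : ∃ r > s, ∀ x ∈ Ioo s r, D s < D x) :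
    MonotoneOn D (Icc s t) := by
  intro x hx y hy hxy
  by_contra hlt
  push Not at hlt
  have hsub : Icc s y ⊆ Icc s t := Icc_subset_Icc le_rfl hy.2
  obtain ⟨m, hm, hmax⟩ := isCompact_Icc.exists_isMaxOn (nonempty_Icc.2 hy.1) (hc.mono hsub)
  have hmx : D x ≤ D m := hmax ⟨hx.1, hxy⟩
  have hmy : m ≠ y := by rintro rfl; linarith
  have hsy : s < y := lt_of_le_of_ne hy.1 (by
    rintro rfl
    have : x = s := le_antisymm hxy hx.1
    rw [this] at hlt
    exact lt_irrefl _ hlt)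
  have hms : m ≠ s := by
    rintro rfl
    obtain ⟨r, hr, hinc⟩ := hinc
    obtain ⟨w, hw1, hw2⟩ := exists_between (lt_min hr hsy)
    have h1 := hinc w ⟨hw1, hw2.trans_le (min_le_left _ _)⟩
    have h2 : D w ≤ D m := hmax ⟨hw1.le, (hw2.trans_le (min_le_right _ _)).le⟩
    linarith
  have hm1 : s < m := lt_of_le_of_ne hm.1 hms.symm
  have hm2 : m < y := lt_of_le_of_ne hm.2 hmy
  exact hno m ⟨hm1, hm2.trans_le hy.2⟩ (hmax.isLocalMax (Icc_mem_nhds hm1 hm2))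

lemma ae_differentiableAt_of_abs {u : ℝ → ℝ} {K s t : ℝ} (hst : s ≤ t) (hK : 0 ≤ K)
    (hu : ∀ x ∈ Icc s t, ∀ y ∈ Icc s t, |u x - u y| ≤ K * |x - y|) :
    ∀ᵐ x, x ∈ Ioo s t → DifferentiableAt ℝ u x := by
  have hac : AbsolutelyContinuousOnInterval u s t := by
    apply LipschitzOnWith.absolutelyContinuousOnInterval
    rw [uIcc_of_le hst]
    exact lipschitzOnWith_of_abs hK hu
  filter_upwards [hac.ae_differentiableAt] with x hx hxI
  exact hx (by rw [uIcc_of_le hst]; exact ⟨hxI.1.le, hxI.2.le⟩)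

lemma hasDerivAt_integral_of_continuous {f : ℝ → ℝ} (hf : Continuous f) (s x : ℝ) :
    HasDerivAt (fun x => ∫ y in s..x, f y) (f x) x :=
  intervalIntegral.integral_hasDerivAt_right (hf.intervalIntegrable _ _)
    hf.stronglyMeasurable.stronglyMeasurableAtFilter hf.continuousAt

lemma deriv_nonneg_of_monotoneOn {D : ℝ → ℝ} {d s t x : ℝ} (hD : MonotoneOn D (Icc s t))
    (hx : x ∈ Ioo s t) (hd : HasDerivAt D d x) : 0 ≤ d := by
  have h1 := (hasDerivAt_iff_tendsto_slope_left_right.1 hd).2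
  refine ge_of_tendsto h1 ?_
  filter_upwards [Ioo_mem_nhdsGT hx.2] with y hy
  rw [slope_def_field]
  exact div_nonneg (by linarith [hD ⟨hx.1.le, hx.2.le⟩ ⟨by linarith [hx.1, hy.1], hy.2.le⟩ hy.1.le])
    (by linarith [hy.1])

namespace IsEnvironment

variable {α₀ α₁ γ κ : ℝ} {a : ℝ → ℝ} {h : ℝ → ℝ → ℝ}

/-- The solution of the ODE started at a large slope dominates the slopes of supersolutions at
lower levels. -/
lemma exists_ode_from_large_slope (E : IsEnvironment α₀ α₁ γ κ a h) {s t l μ₀ : ℝ} {w : ℝ → ℝ}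
    (hst : s < t) (hpos : ∀ x ∈ Icc s t, 0 < a x) (hμ₀ : μ₀ < l)
    (hw : SuperOn a h μ₀ (Ioo (s - 1) (t + 1)) w) :
    ∃ f : ℝ → ℝ, Continuous f ∧ f s = slopeBound α₀ l + 1 ∧
      (∀ x ∈ Ico s t, HasDerivWithinAt f ((l - h x (f x)) / a x) (Ici x) x) ∧
      (∀ x ∈ Ioo s t, HasDerivAt f ((l - h x (f x)) / a x) x) ∧
      (∀ x ∈ Ico s t, |f x| ≤ slopeBound α₀ l + 1) ∧
      ∀ (v : ℝ → ℝ) (μ : ℝ), μ < l → SuperOn a h μ (Ioo (s - 1) (t + 1)) v →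
        ∀ x ∈ Ioo s t, ∀ p, HasDerivAt v p x → p ≤ f x := by
  set K := slopeBound α₀ l with hK
  have hKpos : 0 < K := slopeBound_pos E.α₀_pos l
  set B := K + 1 with hB
  obtain ⟨f, hfc, hfs, hfr, hfd⟩ := E.exists_truncated_ode l hst (by linarith : 0 ≤ B) hpos
  -- At the value `B` the Hamiltonian exceeds `l`, so the derivative is negative and `f` cannot
  -- leave through `B`.
  have hup : ∀ x ∈ Icc s t, f x ≤ B := by
    refine image_le_of_deriv_right_lt_deriv_boundary (B := fun _ => B) (B' := fun _ => 0)
      hfc.continuousOn hfr hfs.le (fun x => hasDerivAt_const x _) fun x hx he => ?_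
    have hBB : |B| ≤ B := (abs_of_pos (by linarith)).le
    rw [he, clamp_eq hBB]
    refine div_neg_of_neg_of_pos ?_ (hpos x ⟨hx.1, hx.2.le⟩)
    have := E.lt_h (l := l) (p := B) x (by rw [← hK]; exact le_trans (by linarith) (le_abs_self _))
    linarith
  set U : ℝ → ℝ := fun x => ∫ y in s..x, f y with hU
  have hUd : ∀ x, HasDerivAt U (f x) x := hasDerivAt_integral_of_continuous hfc s
  have hUc : Continuous U := continuous_iff_continuousAt.2 fun x => (hUd x).continuousAt
  -- An interior maximum of `U - v` would let `U`, which satisfies the equation at level `l`, touch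
  -- a supersolution at level `μ < l` from below. Since `U` starts with a slope above the Lipschitz
  -- constant of `v`, the difference `U - v` is monotone.
  have mono : ∀ (v : ℝ → ℝ) (μ : ℝ), μ < l → SuperOn a h μ (Ioo (s - 1) (t + 1)) v →
      MonotoneOn (fun x => U x - v x) (Icc s t) ∧
      ∀ x ∈ Icc s t, ∀ y ∈ Icc s t, |v x - v y| ≤ K * |x - y| := by
    intro v μ hμ hv
    have hlip : ∀ x ∈ Icc s t, ∀ y ∈ Icc s t, |v x - v y| ≤ K * |x - y| := fun x hx y hy =>
      (E.lipschitz_of_superOn hv x hx y hy).trans (by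
        gcongr; exact slopeBound_mono E.α₀_pos hμ.le)
    refine ⟨monotoneOn_of_no_isLocalMax (hUc.sub hv.1).continuousOn (fun x hx hmax => ?_) ?_, hlip⟩
    · have hmin : IsLocalMin (fun x => v x - U x) x := by
        refine hmax.neg.congr (Eventually.of_forall fun y => ?_); simp
      -- At a touching point the slope is at most `K < B`, so the truncation is inactive there and
      -- the true equation may be used.
      have habs := abs_deriv_le_of_isLocalMin hx hlip (hUd x) hmin
      have hd := hfd x hx
      rw [clamp_eq (by linarith)] at hd
      have := hv.touch ⟨by linarith [hx.1], by linarith [hx.2]⟩ (E.nonneg x)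
        (Eventually.of_forall hUd) hd hmin
      have hax := hpos x ⟨hx.1.le, hx.2.le⟩
      rw [mul_div_cancel₀ _ hax.ne'] at this
      linarith
    · have h1 : ∀ᶠ x in 𝓝[>] s, K < slope U s x := by
        refine (hasDerivAt_iff_tendsto_slope_left_right.1 (hUd s)).2.eventually (lt_mem_nhds ?_)
        rw [hfs]; linarith
      obtain ⟨r, hr, hall⟩ := mem_nhdsGT_iff_exists_Ioo_subset.1 h1
      refine ⟨min r t, lt_min hr hst, fun x hx => ?_⟩
      have h2 : K < slope U s x := hall ⟨hx.1, hx.2.trans_le (min_le_left _ _)⟩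
      have hxt := (hx.2.trans_le (min_le_right _ _)).le
      rw [slope_def_field, lt_div_iff₀ (by linarith [hx.1])] at h2
      have h3 := (abs_le.1 (hlip x ⟨hx.1.le, hxt⟩ s ⟨le_rfl, hst.le⟩)).2
      rw [abs_of_pos (by linarith [hx.1])] at h3
      linarith
  -- Comparison with the supersolution `w` bounds `f` from below, which removes the truncation
  -- altogether.
  have hlow : ∀ x ∈ Ioo s t, -K ≤ f x := by
    obtain ⟨hm, hlip⟩ := mono w μ₀ hμ₀ hw
    intro x hx
    have hm2 : MonotoneOn (fun x => U x + K * x) (Icc s t) := by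
      intro y hy z hz hyz
      have h1 := hm hy hz hyz
      have h2 := (abs_le.1 (hlip z hz y hy)).1
      rw [abs_of_nonneg (by linarith)] at h2
      simp only at h1 ⊢
      linarith
    have := deriv_nonneg_of_monotoneOn hm2 hx
      ((hUd x).fun_add ((hasDerivAt_id x).const_mul K))
    simp at this
    linarith
  have habs : ∀ x ∈ Ico s t, |f x| ≤ B := by
    intro x hx
    rcases hx.1.eq_or_lt with rfl | hsx
    · rw [hfs, abs_of_pos (by linarith)]
    · exact abs_le.2 ⟨by linarith [hlow x ⟨hsx, hx.2⟩], hup x ⟨hx.1, hx.2.le⟩⟩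
  refine ⟨f, hfc, hfs, fun x hx => ?_, fun x hx => ?_, habs, fun v μ hμ hv x hx p hp => ?_⟩
  · have := hfr x hx
    rwa [clamp_eq (habs x hx)] at this
  · have := hfd x hx
    rwa [clamp_eq (habs x ⟨hx.1.le, hx.2⟩)] at this
  · have := deriv_nonneg_of_monotoneOn (mono v μ hμ hv).1 hx ((hUd x).fun_sub hp)
    linarith

/-- The maximal solution of the ODE on a component of `{a > 0}`. -/
lemma exists_ode_component (E : IsEnvironment α₀ α₁ γ κ a h) {s t l μ₀ : ℝ} {w : ℝ → ℝ}
    (hI : IsComponent a s t) (hμ₀ : μ₀ < l) (hw : SuperOn a h μ₀ (Ioo (s - 1) (t + 1)) w) :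
    ∃ f : ℝ → ℝ, OdeOn a h l s t f ∧ (∀ x ∈ Ioo s t, |f x| ≤ slopeBound α₀ l + 1) ∧
      ∀ (v : ℝ → ℝ) (μ : ℝ), μ < l → SuperOn a h μ (Ioo (s - 1) (t + 1)) v →
        ∀ x ∈ Ioo s t, ∀ p, HasDerivAt v p x → p ≤ f x := by
  set K := slopeBound α₀ l
  have hKpos : 0 < K := slopeBound_pos E.α₀_pos l
  set B := K + 1
  set d := t - s
  have hd : 0 < d := sub_pos.2 hI.lt
  -- The shift by `3` gives `2 e n < d` already for `n = 0`, so that every interval `[s + e n, t - e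
  -- n]` is nondegenerate.
  let e : ℕ → ℝ := fun n => d / (n + 3)
  have he : ∀ n, 0 < e n := fun n => by positivity
  have he2 : ∀ n, 2 * e n < d := fun n => by
    simp only [e]
    rw [← mul_div_assoc, div_lt_iff₀ (by positivity)]
    have : (0 : ℝ) ≤ n := Nat.cast_nonneg n
    nlinarith
  have hanti : ∀ n, e (n + 1) < e n := fun n => by
    simp only [e]
    apply div_lt_div_of_pos_left hd (by positivity)
    push_cast; linarith
  have helim : Tendsto e atTop (𝓝 0) := by
    have : Tendsto (fun n : ℕ => (n : ℝ) + 3) atTop atTop :=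
      tendsto_atTop_add_const_right _ _ tendsto_natCast_atTop_atTop
    exact this.const_div_atTop d
  have hsub : ∀ n, Icc (s + e n) (t - e n) ⊆ Ioo s t := fun n x hx =>
    ⟨by linarith [hx.1, he n], by linarith [hx.2, he n]⟩
  have hJ : ∀ n, Ioo (s + e n - 1) (t - e n + 1) ⊆ Ioo (s - 1) (t + 1) := fun n =>
    Ioo_subset_Ioo (by linarith [he n]) (by linarith [he n])
  have hex := fun n => E.exists_ode_from_large_slope (s := s + e n) (t := t - e n)
    (by linarith [he2 n]) (fun x hx => hI.pos x (hsub n hx)) hμ₀ (hw.mono (hJ n) le_rfl)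
  choose F hFc hFs hFr hFd hFB hFv using hex
  let G : ℕ → ℝ → ℝ := fun n x => if x ∈ Ioo (s + e n) (t - e n) then F n x else B
  have hG : ∀ n, ∀ x ∈ Ioo (s + e n) (t - e n), G n x = F n x := fun n x hx => if_pos hx
  have hGB : ∀ n x, |G n x| ≤ B := fun n x => by
    by_cases hx : x ∈ Ioo (s + e n) (t - e n)
    · rw [hG n x hx]; exact hFB n x ⟨hx.1.le, hx.2⟩
    · simp only [G, if_neg hx]; rw [abs_of_pos (by linarith)]
  -- Each `F n` starts at the common upper bound `B`, so a solution started earlier is below it at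
  -- its starting point, and stays below by comparison. Extending by `B` outside the interval
  -- preserves this order.
  have hGanti : ∀ x, Antitone fun n => G n x := fun x => antitone_nat_of_succ_le fun n => by
    by_cases hx : x ∈ Ioo (s + e n) (t - e n)
    · have hx' : x ∈ Ioo (s + e (n + 1)) (t - e (n + 1)) :=
        ⟨by linarith [hx.1, hanti n], by linarith [hx.2, hanti n]⟩
      rw [hG n x hx, hG (n + 1) x hx']
      have hs' : s + e n ∈ Ico (s + e (n + 1)) (t - e (n + 1)) :=
        ⟨by linarith [hanti n], by linarith [hx'.2, hx.1]⟩
      refine E.ode_le (s := s + e n) (t := x) (B := B) (by linarith) (fun y hy => hI.pos y (hsub n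
        ⟨hy.1, hy.2.trans hx.2.le⟩)) (hFc _).continuousOn (hFc _).continuousOn (fun y hy => ?_)
        (fun y hy => hFr n y ⟨hy.1, hy.2.trans hx.2⟩) (fun y hy => hFB (n + 1) y ?_)
        (fun y hy => hFB n y ⟨hy.1, hy.2.trans hx.2⟩) ?_ x ⟨hx.1.le, le_rfl⟩
      · exact hFr (n + 1) y ⟨by linarith [hy.1, hanti n], by linarith [hy.2, hx'.2]⟩
      · exact ⟨by linarith [hy.1, hanti n], by linarith [hy.2, hx'.2]⟩
      · rw [hFs n]; exact (le_abs_self _).trans (hFB (n + 1) _ hs')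
    · have : G n x = B := if_neg hx
      rw [this]; exact (le_abs_self _).trans (hGB _ _)
  have hbdd : ∀ x, BddBelow (range fun n => G n x) := fun x =>
    ⟨-B, by rintro _ ⟨n, rfl⟩; exact (abs_le.1 (hGB n x)).1⟩
  let f : ℝ → ℝ := fun x => ⨅ n, G n x
  have hlim : ∀ x, Tendsto (fun n => G n x) atTop (𝓝 (f x)) := fun x =>
    tendsto_atTop_ciInf (hGanti x) (hbdd x)
  have hev : ∀ x ∈ Ioo s t, ∃ N, ∀ n ≥ N, x ∈ Ioo (s + e n) (t - e n) := by
    intro x hx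
    have h1 := helim.eventually (gt_mem_nhds (sub_pos.2 hx.1))
    have h2 := helim.eventually (gt_mem_nhds (sub_pos.2 hx.2))
    obtain ⟨N, hN⟩ := eventually_atTop.1 (h1.and h2)
    exact ⟨N, fun n hn => ⟨by linarith [(hN n hn).1], by linarith [(hN n hn).2]⟩⟩
  refine ⟨f, fun x hx => ?_, fun x hx => ?_, fun v μ hμ hv x hx p hp => ?_⟩
  · obtain ⟨N, hN⟩ := hev x hx
    have heN : ∀ n, e (n + N) ≤ e N := fun n =>
      (antitone_nat_of_succ_le fun n => (hanti n).le) (Nat.le_add_left N n)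
    have hmem : ∀ n, ∀ y ∈ Ioo (s + e N) (t - e N), y ∈ Ioo (s + e (n + N)) (t - e (n + N)) :=
      fun n y hy => ⟨by linarith [hy.1, heN n], by linarith [hy.2, heN n]⟩
    refine E.ode_limit (s := s + e N) (t := t - e N) (B := B) (F := fun n => F (n + N))
      (L := fun _ => l) (by linarith) (fun y hy => hI.pos y (hsub N ⟨hy.1.le, hy.2.le⟩))
      (fun n y hy => hFd (n + N) y (hmem n y hy))
      (fun n y hy => hFB (n + N) y ⟨(hmem n y hy).1.le, (hmem n y hy).2⟩) tendsto_const_nhds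
      (fun y hy => ?_) x (hN N le_rfl)
    refine ((tendsto_add_atTop_iff_nat N).2 (hlim y)).congr fun n => hG _ _ (hmem n y hy)
  · exact le_of_tendsto (hlim x).abs (Eventually.of_forall fun n => hGB n x)
  · obtain ⟨N, hN⟩ := hev x hx
    refine ge_of_tendsto (hlim x) (eventually_atTop.2 ⟨N, fun n hn => ?_⟩)
    rw [hG n x (hN n hn)]
    exact hFv n v μ hμ (hv.mono (hJ n) le_rfl) x (hN n hn) p hp

/-- Every point where `a > 0` lies in a bounded component. -/
lemma exists_component (E : IsEnvironment α₀ α₁ γ κ a h) {x : ℝ} (hx : 0 < a x) :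
    ∃ s t, IsComponent a s t ∧ x ∈ Ioo s t := by
  have hcl : IsClosed {z | a z = 0} := isClosed_eq E.continuous_a continuous_const
  have hA : IsClosed ({z | a z = 0} ∩ Iic x) := hcl.inter isClosed_Iic
  have hB : IsClosed ({z | a z = 0} ∩ Ici x) := hcl.inter isClosed_Ici
  obtain ⟨z₁, hz1, hz1'⟩ := E.zeros_left x
  obtain ⟨z₂, hz2, hz2'⟩ := E.zeros_right x
  have bA : BddAbove ({z | a z = 0} ∩ Iic x) := ⟨x, fun z hz => hz.2⟩
  have bB : BddBelow ({z | a z = 0} ∩ Ici x) := ⟨x, fun z hz => hz.2⟩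
  have hs := hA.csSup_mem ⟨z₁, hz1', hz1⟩ bA
  have ht := hB.csInf_mem ⟨z₂, hz2', hz2⟩ bB
  set s := sSup ({z | a z = 0} ∩ Iic x)
  set t := sInf ({z | a z = 0} ∩ Ici x)
  have hs0 : a s = 0 := hs.1
  have ht0 : a t = 0 := ht.1
  have hsx : s < x := lt_of_le_of_ne hs.2 (by intro he; rw [he] at hs0; linarith)
  have hxt : x < t := lt_of_le_of_ne ht.2 (by intro he; rw [← he] at ht0; linarith)
  refine ⟨s, t, ⟨hsx.trans hxt, hs0, ht0, fun y hy => E.pos_of_ne fun h0 => ?_⟩, hsx, hxt⟩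
  rcases le_total y x with hyx | hyx
  · exact absurd (le_csSup bA ⟨h0, hyx⟩) (not_le.2 hy.1)
  · exact absurd (csInf_le bB ⟨h0, hyx⟩) (not_le.2 hy.2)

end IsEnvironment

lemma IsComponent.unique {a : ℝ → ℝ} {s t s' t' x : ℝ} (hI : IsComponent a s t)
    (hI' : IsComponent a s' t') (hx : x ∈ Ioo s t) (hx' : x ∈ Ioo s' t') : s = s' ∧ t = t' := by
  have key : ∀ {s t s' t'}, IsComponent a s t → IsComponent a s' t' → x ∈ Ioo s t →
      x ∈ Ioo s' t' → s ≤ s' ∧ t' ≤ t := by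
    intro s t s' t' hI hI' hx hx'
    constructor
    · by_contra hlt
      have := hI'.pos s ⟨not_le.1 hlt, by linarith [hx.1, hx'.2]⟩
      linarith [hI.left]
    · by_contra hlt
      have := hI'.pos t ⟨by linarith [hx.2, hx'.1], not_le.1 hlt⟩
      linarith [hI.right]
  have h1 := key hI hI' hx hx'
  have h2 := key hI' hI hx' hx
  exact ⟨le_antisymm h1.1 h2.1, le_antisymm h2.2 h1.2⟩

/-- `f` is the slope of the maximal solution at level `l`: it solves the ODE where `a > 0` and equals
the largest root where `a = 0`. -/
structure IsMaxSlope (a : ℝ → ℝ) (h : ℝ → ℝ → ℝ) (l B : ℝ) (f : ℝ → ℝ) : Prop where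
  cont : Continuous f
  nonempty : ∀ z, a z = 0 → ∃ p, h z p < l
  zero : ∀ z, a z = 0 → f z = topRoot h l z
  ode : ∀ x, 0 < a x → HasDerivAt f ((l - h x (f x)) / a x) x
  bound : ∀ x, |f x| ≤ B

namespace IsEnvironment

variable {α₀ α₁ γ κ : ℝ} {a : ℝ → ℝ} {h : ℝ → ℝ → ℝ}

/-- The component solutions are glued with the largest root at the zeros of `a`. Supersolutions are
required on bounded intervals only, with no compatibility between them; this is what later allows a
countable description of the critical value. -/
lemma exists_isMaxSlope (E : IsEnvironment α₀ α₁ γ κ a h) {l μ : ℝ} (hμ : μ < l)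
    (hw : ∀ n : ℕ, ∃ w, SuperOn a h μ (Ioo (-n : ℝ) n) w) :
    ∃ f, IsMaxSlope a h l (slopeBound α₀ l + 1) f ∧
      ∀ (v : ℝ → ℝ) (μ' : ℝ), μ' < l → IsViscositySupersolution a h μ' v →
        ∀ x p, HasDerivAt v p x → p ≤ f x := by
  have hw' : ∀ s t : ℝ, ∃ w, SuperOn a h μ (Ioo s t) w := fun s t => by
    obtain ⟨n, hn⟩ := exists_nat_ge (max |s| |t|)
    obtain ⟨w, hw⟩ := hw n
    refine ⟨w, hw.mono (Ioo_subset_Ioo ?_ ?_) le_rfl⟩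
    · linarith [neg_abs_le s, le_max_left |s| |t|]
    · linarith [le_abs_self t, le_max_right |s| |t|]
  have hne : ∀ z, a z = 0 → ∀ m, μ < m → ∃ p, h z p < m := fun z hz m hm => by
    obtain ⟨w, hw⟩ := hw' (z - 2) (z + 2)
    exact E.exists_h_lt hm hz hw
  have hex : ∀ s t, ∃ f : ℝ → ℝ, IsComponent a s t → OdeOn a h l s t f ∧
      (∀ x ∈ Ioo s t, |f x| ≤ slopeBound α₀ l + 1) ∧
      ∀ (v : ℝ → ℝ) (μ : ℝ), μ < l → SuperOn a h μ (Ioo (s - 1) (t + 1)) v →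
        ∀ x ∈ Ioo s t, ∀ p, HasDerivAt v p x → p ≤ f x := fun s t => by
    by_cases hI : IsComponent a s t
    · obtain ⟨w, hw⟩ := hw' (s - 1) (t + 1)
      obtain ⟨f, hf⟩ := E.exists_ode_component hI hμ hw
      exact ⟨f, fun _ => hf⟩
    · exact ⟨0, fun h => absurd h hI⟩
  choose F hF using hex
  have hcomp : ∀ x, ∃ st : ℝ × ℝ, 0 < a x → IsComponent a st.1 st.2 ∧ x ∈ Ioo st.1 st.2 := fun x => by
    by_cases hx : 0 < a x
    · obtain ⟨s, t, hst⟩ := E.exists_component hx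
      exact ⟨(s, t), fun _ => hst⟩
    · exact ⟨(0, 0), fun h => absurd h hx⟩
  choose c hc using hcomp
  let f : ℝ → ℝ := fun x => if a x = 0 then topRoot h l x else F (c x).1 (c x).2 x
  have hfz : ∀ z, a z = 0 → f z = topRoot h l z := fun z hz => if_pos hz
  have hfI : ∀ s t, IsComponent a s t → ∀ x ∈ Ioo s t, f x = F s t x := fun s t hI x hx => by
    have hpos := hI.pos x hx
    obtain ⟨h1, h2⟩ := hc x hpos
    obtain ⟨e1, e2⟩ := hI.unique h1 hx h2
    simp only [f, if_neg hpos.ne', ← e1, ← e2]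
  set B := slopeBound α₀ l + 1
  have hfB : ∀ x, |f x| ≤ B := fun x => by
    rcases (E.nonneg x).eq_or_lt with h0 | h0
    · rw [hfz x h0.symm]
      have := E.abs_topRoot_lt (hne x h0.symm l hμ)
      linarith
    · obtain ⟨h1, h2⟩ := hc x h0
      rw [hfI _ _ h1 x h2]
      exact (hF _ _ h1).2.1 x h2
  have hode : ∀ x, 0 < a x → HasDerivAt f ((l - h x (f x)) / a x) x := fun x hx => by
    obtain ⟨h1, h2⟩ := hc x hx
    rw [hfI _ _ h1 x h2]
    refine ((hF _ _ h1).1 x h2).congr_of_eventuallyEq ?_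
    filter_upwards [Ioo_mem_nhds h2.1 h2.2] with y hy using hfI _ _ h1 y hy
  have htop : ∀ (v : ℝ → ℝ) (μ' : ℝ), μ' < l → IsViscositySupersolution a h μ' v →
        ∀ x p, HasDerivAt v p x → p ≤ f x := fun v μ' hμ' hv x p hp => by
    rcases (E.nonneg x).eq_or_lt with h0 | h0
    · rw [hfz x h0.symm]
      refine E.le_topRoot ((h_deriv_le (hv.superOn univ) univ_mem (E.le_sq h0.symm) E.continuous_h
        hp).trans hμ'.le)
    · obtain ⟨h1, h2⟩ := hc x h0
      rw [hfI _ _ h1 x h2]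
      exact (hF _ _ h1).2.2 v μ' hμ' (hv.superOn _) x h2 p hp
  refine ⟨f, ⟨?_, fun z hz => hne z hz l hμ, hfz, hode, hfB⟩, htop⟩
  -- Only continuity at a zero `z` of `a` is in question. Nearby points with `a > 0` are handled by
  -- the uniform attraction to the largest root, nearby zeros by the separation of the values of
  -- `h`.
  rw [continuous_iff_continuousAt]
  intro z
  rcases (E.nonneg z).eq_or_lt with h0 | h0
  swap
  · exact (hode z h0).continuousAt
  rw [Metric.continuousAt_iff]
  intro ε hε
  have hz : a z = 0 := h0.symm
  have hP := E.h_topRoot (hne z hz l hμ)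
  obtain ⟨δ₁, hδ1, hcl⟩ := E.exists_forall_abs_sub_topRoot_le (B := B) hμ (hne z hz) hz
    (half_pos hε) ((slopeBound_mono E.α₀_pos hμ.le).trans (by simp only [B]; linarith))
  -- Capping the tolerance by `1` keeps `topRoot h l z - ε'` in `[-B, B]`, where the separation
  -- applies.
  obtain ⟨q, g, δ₂, ε', hg, hδ2, hε', hεε, hq, hsep⟩ := E.exists_separation (B := B) hμ (hne z hz)
    (lt_min (half_pos hε) one_pos)
  have hεε1 : ε' ≤ 1 := hεε.trans (min_le_right _ _)
  replace hεε : ε' ≤ ε / 2 := hεε.trans (min_le_left _ _)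
  refine ⟨min δ₁ δ₂, lt_min hδ1 hδ2, fun x hx => ?_⟩
  rw [Real.dist_eq] at hx
  rw [Real.dist_eq, hfz z hz]
  refine lt_of_le_of_lt ?_ (half_lt_self hε)
  rcases (E.nonneg x).eq_or_lt with hx0 | hx0
  · -- both points are zeros of `a`
    have hxz : |x - z| ≤ δ₂ := hx.le.trans (min_le_right _ _)
    have hPx := E.h_topRoot (hne x hx0.symm l hμ)
    have hb := hfB x
    have hs := hsep x hxz (f x) hb
    rw [hfz x hx0.symm] at hs hb ⊢
    have hqP : topRoot h l z - ε' ≤ topRoot h l x := by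
      refine E.le_topRoot ?_
      have hPz := E.abs_topRoot_lt (hne z hz l hμ)
      have hab : |topRoot h l z - ε'| ≤ B := by
        rw [abs_lt] at hPz
        rw [abs_le]; constructor <;> simp only [B] <;> linarith
      linarith [(hsep x hxz _ hab).2.1 hq le_rfl]
    refine le_trans ?_ hεε
    rw [abs_le]
    constructor
    · linarith
    · by_contra hlt
      push Not at hlt
      linarith [hs.1 (by linarith)]
  · obtain ⟨h1, h2⟩ := hc x hx0
    obtain ⟨w, hw⟩ := hw' ((c x).1 - 1) ((c x).2 + 1)
    have hFx := hF _ _ h1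
    rw [hfI _ _ h1 x h2]
    refine hcl _ _ _ w h1 hFx.1 hFx.2.1 hw ?_ x h2 (hx.trans_le (min_le_left _ _))
    filter_upwards [ae_differentiableAt_of_abs h1.lt.le (slopeBound_pos E.α₀_pos μ).le
      (E.lipschitz_of_superOn hw)] with y hd hy
    exact hFx.2.2 w μ hμ hw y hy _ (hd hy).hasDerivAt

end IsEnvironment

end

/-! ### Comparison and stability of maximal slopes; critical solutions -/

noncomputable section

namespace IsMaxSlope

variable {α₀ α₁ γ κ : ℝ} {a : ℝ → ℝ} {h : ℝ → ℝ → ℝ} {l B : ℝ} {f : ℝ → ℝ}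

lemma h_eq (hf : IsMaxSlope a h l B f) (E : IsEnvironment α₀ α₁ γ κ a h) {z : ℝ} (hz : a z = 0) :
    h z (f z) = l := by
  rw [hf.zero z hz]; exact E.h_topRoot (hf.nonempty z hz)

lemma hasDerivAt_integral (hf : IsMaxSlope a h l B f) (x : ℝ) :
    HasDerivAt (fun x => ∫ y in (0 : ℝ)..x, f y) (f x) x :=
  hasDerivAt_integral_of_continuous hf.cont 0 x

lemma deriv_integral (hf : IsMaxSlope a h l B f) :
    deriv (fun x => ∫ y in (0 : ℝ)..x, f y) = f :=
  funext fun x => (hf.hasDerivAt_integral x).deriv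

lemma contDiff (hf : IsMaxSlope a h l B f) : ContDiff ℝ 1 fun x => ∫ y in (0 : ℝ)..x, f y := by
  rw [contDiff_one_iff_deriv, hf.deriv_integral]
  exact ⟨fun x => (hf.hasDerivAt_integral x).differentiableAt, hf.cont⟩

lemma bound_nonneg (hf : IsMaxSlope a h l B f) : 0 ≤ B := (abs_nonneg _).trans (hf.bound 0)

/-- The primitive is `C¹`. At a zero of `a` only its first derivative matters, and `h = l` there;
elsewhere it is twice differentiable and solves the equation classically. -/
lemma isLipschitzSolution (hf : IsMaxSlope a h l B f) (E : IsEnvironment α₀ α₁ γ κ a h) :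
    IsLipschitzSolution a h l fun x => ∫ y in (0 : ℝ)..x, f y := by
  set u : ℝ → ℝ := fun x => ∫ y in (0 : ℝ)..x, f y with hu
  have hd : ∀ x, HasDerivAt u (f x) x := hf.hasDerivAt_integral
  have hc : Continuous u := hf.contDiff.continuous
  refine ⟨⟨hc, fun φ x hφ hm => ?_⟩, ⟨hc, fun φ x hφ hm => ?_⟩, ⟨⟨B, hf.bound_nonneg⟩, ?_⟩, by simp [hu]⟩
  · rcases (E.nonneg x).eq_or_lt with h0 | h0
    · have hφ1 : Differentiable ℝ φ := hφ.differentiable (by norm_num)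
      have := hm.hasDerivAt_eq_zero ((hd x).sub (hφ1 x).hasDerivAt)
      rw [← h0, zero_mul, zero_add, ← sub_eq_zero.1 this, hf.h_eq E h0.symm]
    · obtain ⟨h1, h2⟩ := deriv_deriv_le_of_isLocalMin hφ (Eventually.of_forall hd) (hf.ode x h0) hm
      rw [h1]
      have := mul_le_mul_of_nonneg_left h2 h0.le
      rw [mul_div_cancel₀ _ h0.ne'] at this
      linarith
  · rcases (E.nonneg x).eq_or_lt with h0 | h0
    · have hφ1 : Differentiable ℝ φ := hφ.differentiable (by norm_num)
      have := hm.hasDerivAt_eq_zero ((hd x).sub (hφ1 x).hasDerivAt)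
      rw [← h0, zero_mul, zero_add, ← sub_eq_zero.1 this, hf.h_eq E h0.symm]
    · have hm' : IsLocalMin (fun x => -u x - -φ x) x := by
        refine hm.neg.congr (Eventually.of_forall fun y => ?_); ring
      obtain ⟨h1, h2⟩ := deriv_deriv_le_of_isLocalMin hφ.neg
        (Eventually.of_forall fun y => (hd y).fun_neg) (hf.ode x h0).fun_neg hm'
      have e1 : deriv (fun x => -φ x) = fun x => -deriv φ x := by ext x; exact deriv.fun_neg
      have e2 : deriv (fun x => -deriv φ x) x = -deriv (deriv φ) x := deriv.fun_neg
      rw [e1] at h1 h2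
      rw [e2] at h2
      rw [neg_inj.1 h1]
      have := mul_le_mul_of_nonneg_left (neg_le_neg_iff.1 h2) h0.le
      rw [mul_div_cancel₀ _ h0.ne'] at this
      linarith
  · refine lipschitzWith_of_nnnorm_deriv_le (fun x => (hd x).differentiableAt) fun x => ?_
    rw [(hd x).deriv]
    exact hf.bound x

/-- Strict subfunctions of the ODE stay below the maximal slope. -/
lemma lt_of_strict (hf : IsMaxSlope a h l B f) (E : IsEnvironment α₀ α₁ γ κ a h) {z b : ℝ}
    {g : ℝ → ℝ} (hz : a z = 0) (hg : ContinuousOn g (Icc z b))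
    (hg0 : ∀ x ∈ Icc z b, a x = 0 → h x (g x) < l)
    (hg1 : ∀ x ∈ Icc z b, 0 < a x → ∃ g', HasDerivAt g g' x ∧ a x * g' + h x (g x) < l) :
    ∀ x ∈ Icc z b, g x < f x := by
  by_contra hex
  push Not at hex
  obtain ⟨x, hx, hle⟩ := hex
  -- The inequality is strict at `z`, because `f z` is the largest root. At a first contact `y`,
  -- either `a y = 0`, and `h y (f y) = l` contradicts strictness of `g`, or `a y > 0`, and then `f'
  -- > g'` at `y` is incompatible with `f > g` just before.
  let S := {x ∈ Icc z b | f x - g x ≤ 0}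
  have hcD : ContinuousOn (fun x => f x - g x) (Icc z b) := hf.cont.continuousOn.sub hg
  have hScl : IsClosed S := hcD.preimage_isClosed_of_isClosed isClosed_Icc isClosed_Iic
  have hSb : BddBelow S := ⟨z, fun y hy => hy.1.1⟩
  have hmem := hScl.csInf_mem ⟨x, hx, by linarith⟩ hSb
  set y := sInf S
  have hzb : z ≤ b := hx.1.trans hx.2
  have hz0 : g z < f z := by
    rw [hf.zero z hz]; exact E.lt_topRoot (hg0 z ⟨le_rfl, hzb⟩ hz)
  have hzy : z < y := lt_of_le_of_ne hmem.1.1 (by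
    intro he; have := hmem.2; rw [← he] at this; linarith)
  have hlt : ∀ w ∈ Ico z y, 0 < f w - g w := fun w hw => by
    by_contra hn
    exact absurd (csInf_le hSb ⟨⟨hw.1, hw.2.le.trans hmem.1.2⟩, not_lt.1 hn⟩) (not_le.2 hw.2)
  have heq : f y - g y = 0 := by
    refine le_antisymm hmem.2 ?_
    have h1 : Tendsto (fun x => f x - g x) (𝓝[Ico z y] y) (𝓝 (f y - g y)) :=
      (hcD y hmem.1).mono_left (nhdsWithin_mono _ fun w hw => ⟨hw.1, hw.2.le.trans hmem.1.2⟩)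
    have : (𝓝[Ico z y] y).NeBot := by
      rw [← mem_closure_iff_nhdsWithin_neBot, closure_Ico hzy.ne]
      exact ⟨hzy.le, le_rfl⟩
    exact ge_of_tendsto h1 (by filter_upwards [self_mem_nhdsWithin] with w hw using (hlt w hw).le)
  have heq' : f y = g y := sub_eq_zero.1 heq
  rcases (E.nonneg y).eq_or_lt with h0 | h0
  · have h1 := hg0 y hmem.1 h0.symm
    rw [← heq', hf.h_eq E h0.symm] at h1
    exact lt_irrefl _ h1
  · obtain ⟨g', hg', hlt'⟩ := hg1 y hmem.1 h0
    have hD := (hf.ode y h0).fun_sub hg'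
    have hpos : 0 < (l - h y (f y)) / a y - g' := by
      rw [sub_pos, lt_div_iff₀ h0, heq']
      linarith
    have h1 := (hasDerivAt_iff_tendsto_slope_left_right.1 hD).1
    obtain ⟨w, hw, hwI⟩ := ((h1.eventually (lt_mem_nhds hpos)).and (Ioo_mem_nhdsLT hzy)).exists
    rw [slope_def_field, heq, sub_zero] at hw
    have h2 := hlt w ⟨hwI.1.le, hwI.2⟩
    have := div_neg_of_pos_of_neg h2 (by linarith [hwI.2] : w - y < 0)
    linarith

/-- The slope at the lower level is a strict subfunction at level `l`, and a zero of `a` to the left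
of `x` starts the comparison. -/
lemma lt_of_level_lt (hf : IsMaxSlope a h l B f) (E : IsEnvironment α₀ α₁ γ κ a h) {l' B' : ℝ}
    {g : ℝ → ℝ} (hg : IsMaxSlope a h l' B' g) (hl : l' < l) (x : ℝ) : g x < f x := by
  obtain ⟨z, hzx, hz⟩ := E.zeros_left x
  refine hf.lt_of_strict E hz hg.cont.continuousOn (fun y _ hy => ?_) (fun y _ hy => ?_) x
    (right_mem_Icc.2 hzx)
  · rw [hg.h_eq E hy]; exact hl
  · exact ⟨_, hg.ode y hy, by rw [mul_div_cancel₀ _ hy.ne']; linarith⟩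

/-- Solutions of the ODE on a component which are supported from below by a supersolution at a lower
level agree with the maximal slope. -/
lemma eqOn_component (hf : IsMaxSlope a h l B f) (E : IsEnvironment α₀ α₁ γ κ a h)
    {s t μ : ℝ} {g v : ℝ → ℝ} (hI : IsComponent a s t) (hg : OdeOn a h l s t g)
    (hgB : ∀ x ∈ Ioo s t, |g x| ≤ B) (hμ : μ < l) (hB : slopeBound α₀ μ ≤ B)
    (hv : SuperOn a h μ (Ioo (s - 2) (t + 2)) v)
    (hvg : ∀ᵐ x, x ∈ Ioo s t → deriv v x ≤ g x) : EqOn g f (Ioo s t) := by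
  have hne : ∀ m, μ < m → ∃ p, h s p < m := fun m hm =>
    E.exists_h_lt hm hI.left (hv.mono (Ioo_subset_Ioo le_rfl (by linarith [hI.lt])) le_rfl)
  refine E.eqOn_of_tendsto hf.bound_nonneg hI hg (fun x hx => hf.ode x (hI.pos x hx)) hgB
    (fun x _ => hf.bound x) (hne l hμ) ?_ ?_
  · rw [Metric.tendsto_nhdsWithin_nhds]
    intro ε hε
    obtain ⟨δ, hδ, hcl⟩ := E.exists_forall_abs_sub_topRoot_le hμ hne hI.left (half_pos hε) hB
    refine ⟨min δ (t - s), lt_min hδ (by linarith [hI.lt]), fun x hx hxd => ?_⟩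
    rw [Real.dist_eq] at hxd ⊢
    have hx' : s < x := hx
    have h1 : |x - s| < t - s := hxd.trans_le (min_le_right _ _)
    rw [abs_of_pos (by linarith)] at h1
    exact (hcl s t g v hI hg hgB (hv.mono (Ioo_subset_Ioo (by linarith) (by linarith)) le_rfl) hvg x
      ⟨hx', by linarith⟩ (hxd.trans_le (min_le_left _ _))).trans_lt (half_lt_self hε)
  · rw [← hf.zero s hI.left]
    exact hf.cont.continuousAt.tendsto.mono_left nhdsWithin_le_nhds

/-- Continuity of the maximal slope in the level. -/
lemma eq_of_tendsto (hf : IsMaxSlope a h l B f) (E : IsEnvironment α₀ α₁ γ κ a h)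
    {F : ℕ → ℝ → ℝ} {g f₁ : ℝ → ℝ} {L : ℕ → ℝ} {l₁ B₁ : ℝ} (hF : ∀ n, IsMaxSlope a h (L n) B (F n))
    (hL : Tendsto L atTop (𝓝 l)) (hf₁ : IsMaxSlope a h l₁ B₁ f₁) (hl₁ : l₁ < l)
    (hB : slopeBound α₀ l₁ ≤ B) (hlL : ∀ n, l₁ < L n)
    (hlim : ∀ x, Tendsto (fun n => F n x) atTop (𝓝 (g x))) : g = f := by
  -- A fixed slope at a lower level stays below the limit. At zeros of `a` it excludes every root
  -- but the largest; on components it is the support required by `eqOn_component`.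
  have hge : ∀ x, f₁ x ≤ g x := fun x =>
    ge_of_tendsto (hlim x) (Eventually.of_forall fun n => ((hF n).lt_of_level_lt E hf₁ (hlL n) x).le)
  have hgB : ∀ x, |g x| ≤ B := fun x =>
    le_of_tendsto (hlim x).abs (Eventually.of_forall fun n => (hF n).bound x)
  ext x
  rcases (E.nonneg x).eq_or_lt with h0 | h0
  · have h1 : h x (g x) = l := by
      refine tendsto_nhds_unique (((E.continuous_h_right x).tendsto _).comp (hlim x)) ?_
      refine hL.congr fun n => ?_
      exact ((hF n).h_eq E h0.symm).symm
    rw [hf.zero x h0.symm]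
    refine le_antisymm (E.le_topRoot h1.le) (le_of_not_gt fun hlt => ?_)
    have := E.h_lt_of_lt_topRoot (by rw [hf₁.h_eq E h0.symm]; exact hl₁) (hge x) hlt
    linarith
  · obtain ⟨s, t, hI, hx⟩ := E.exists_component h0
    refine hf.eqOn_component E hI (v := fun x => ∫ y in (0 : ℝ)..x, f₁ y) ?_ (fun x _ => hgB x) hl₁ hB
      ((hf₁.isLipschitzSolution E).supersolution.superOn _)
      (Eventually.of_forall fun y _ => ?_) hx
    · exact E.ode_limit hf.bound_nonneg hI.pos (fun n y hy => (hF n).ode y (hI.pos y hy))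
        (fun n y _ => (hF n).bound y) hL fun y _ => hlim y
    · rw [hf₁.deriv_integral]; exact hge y

lemma unique (hf : IsMaxSlope a h l B f) (E : IsEnvironment α₀ α₁ γ κ a h) {g : ℝ → ℝ}
    (hg : IsMaxSlope a h l B g) : g = f := by
  ext x
  rcases (E.nonneg x).eq_or_lt with h0 | h0
  · rw [hf.zero x h0.symm, hg.zero x h0.symm]
  · obtain ⟨s, t, hI, hx⟩ := E.exists_component h0
    refine E.eqOn_of_tendsto hf.bound_nonneg hI (fun y hy => hg.ode y (hI.pos y hy))
      (fun y hy => hf.ode y (hI.pos y hy)) (fun y _ => hg.bound y) (fun y _ => hf.bound y)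
      (hf.nonempty s hI.left) ?_ ?_ hx
    · rw [← hg.zero s hI.left]
      exact hg.cont.continuousAt.tendsto.mono_left nhdsWithin_le_nhds
    · rw [← hf.zero s hI.left]
      exact hf.cont.continuousAt.tendsto.mono_left nhdsWithin_le_nhds

end IsMaxSlope

/-- Stability of supersolutions under locally uniform convergence. -/
lemma IsViscositySupersolution.of_tendsto {a : ℝ → ℝ} {h : ℝ → ℝ → ℝ} {l : ℝ} {L : ℕ → ℝ}
    {U : ℕ → ℝ → ℝ} {u : ℝ → ℝ} (ha : Continuous a) (hh : Continuous fun q : ℝ × ℝ => h q.1 q.2)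
    (hu : Continuous u) (hU : ∀ n, IsViscositySupersolution a h (L n) (U n))
    (hL : Tendsto L atTop (𝓝 l))
    (hlim : ∀ R : ℝ, ∀ ε > 0, ∀ᶠ n in atTop, ∀ x, |x| ≤ R → |U n x - u x| < ε) :
    IsViscositySupersolution a h l u := by
  refine ⟨hu, fun φ x₀ hφ hmin => ?_⟩
  by_contra hlt
  push Not at hlt
  have hφ1 : Differentiable ℝ φ := hφ.differentiable (by norm_num)
  have hφ2 : ContDiff ℝ 1 (deriv φ) := by
    rw [← one_add_one_eq_two] at hφ
    exact (contDiff_succ_iff_deriv.1 hφ).2.2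
  have hφ3 : Differentiable ℝ (deriv φ) := hφ2.differentiable (by norm_num)
  have hφ4 : Continuous (deriv (deriv φ)) := (contDiff_one_iff_deriv.1 hφ2).2
  -- perturbed test functions
  let G : ℝ × ℝ → ℝ := fun q => a q.2 * (deriv (deriv φ) q.2 - 2 * q.1)
    + h q.2 (deriv φ q.2 - 2 * q.1 * (q.2 - x₀))
  have hG : Continuous G := by
    have h1 : Continuous fun q : ℝ × ℝ => h q.2 (deriv φ q.2 - 2 * q.1 * (q.2 - x₀)) := by
      refine hh.comp (continuous_snd.prodMk ?_)
      have := hφ2.continuous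
      fun_prop
    have h2 : Continuous fun q : ℝ × ℝ => a q.2 := ha.comp continuous_snd
    have h3 : Continuous fun q : ℝ × ℝ => deriv (deriv φ) q.2 := hφ4.comp continuous_snd
    exact (h2.mul (h3.sub (by fun_prop))).add h1
  obtain ⟨c, hc1, hc2⟩ := exists_between hlt
  have hG0 : c < G (0, x₀) := by simpa [G] using hc2
  obtain ⟨ρ, hρ, hball⟩ := Metric.eventually_nhds_iff.1 (hG.tendsto (0, x₀) |>.eventually (lt_mem_nhds hG0))
  obtain ⟨ρ', hρ', hmin'⟩ := Metric.eventually_nhds_iff.1 hmin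
  obtain ⟨r, hr, hrr⟩ := exists_between (lt_min hρ hρ')
  have hrρ : r < ρ := hrr.trans_le (min_le_left _ _)
  have hrρ' : r < ρ' := hrr.trans_le (min_le_right _ _)
  -- The perturbation gains `r * r ^ 2` at distance `r`, and closeness within half of this keeps the
  -- minimum of `U n - ψ` in the interior.
  have hev := (hL.eventually (gt_mem_nhds hc1)).and
    (hlim (|x₀| + r) (r * r ^ 2 / 2) (by positivity))
  obtain ⟨n, hLn, hn⟩ := hev.exists
  let ψ : ℝ → ℝ := fun x => φ x - r * (x - x₀) ^ 2
  have hψ : ContDiff ℝ 2 ψ := hφ.sub (by fun_prop)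
  have hq : ∀ x, HasDerivAt (fun x => r * (x - x₀) ^ 2) (2 * r * (x - x₀)) x := fun x => by
    simpa using hasDerivAt_quadratic 0 0 r x₀ x
  have hψ1 : deriv ψ = fun x => deriv φ x - 2 * r * (x - x₀) :=
    funext fun x => ((hφ1 x).hasDerivAt.fun_sub (hq x)).deriv
  have hψ2 : ∀ x, deriv (deriv ψ) x = deriv (deriv φ) x - 2 * r := fun x => by
    rw [hψ1]
    have := hasDerivAt_affine 0 (2 * r) x₀ x
    simp only [zero_add] at this
    exact ((hφ3 x).hasDerivAt.fun_sub this).deriv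
  have hcont : ContinuousOn (fun x => U n x - ψ x) (Icc (x₀ - r) (x₀ + r)) :=
    ((hU n).1.sub hψ.continuous).continuousOn
  obtain ⟨x, hx, hxmin⟩ := isCompact_Icc.exists_isMinOn (nonempty_Icc.2 (by linarith)) hcont
  have hxr : |x - x₀| ≤ r := abs_le.2 ⟨by linarith [hx.1], by linarith [hx.2]⟩
  have hbd : ∀ y, |y - x₀| ≤ r → |y| ≤ |x₀| + r := fun y hy => by
    have := abs_add_le (y - x₀) x₀
    rw [sub_add_cancel] at this
    linarith
  have hxr' : |x - x₀| ≠ r := by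
    intro he
    have h1 : U n x - ψ x ≤ U n x₀ - ψ x₀ := hxmin ⟨by linarith, by linarith⟩
    have h2 := (abs_lt.1 (hn x (hbd x hxr))).1
    have h3 := (abs_lt.1 (hn x₀ (hbd x₀ (by simp [hr.le])))).2
    have h4 : u x₀ - φ x₀ ≤ u x - φ x := hmin' (by rw [Real.dist_eq]; linarith)
    have h5 : (x - x₀) ^ 2 = r ^ 2 := by rw [← sq_abs, he]
    simp only [ψ, h5, sub_self] at h1
    nlinarith
  have hxl := abs_lt.1 (lt_of_le_of_ne hxr hxr')
  have key := (hU n).2 ψ x hψ (hxmin.isLocalMin (Icc_mem_nhds (by linarith) (by linarith)))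
  rw [hψ2, hψ1] at key
  have := hball (y := (r, x)) (by
    rw [Prod.dist_eq, Real.dist_eq, Real.dist_eq]
    exact max_lt (by simpa [abs_of_pos hr] using hrρ) (by simpa using hxr.trans_lt hrρ))
  simp only [G] at this
  linarith

/-- Stability of subsolutions under locally uniform convergence. -/
lemma IsViscositySubsolution.of_tendsto {a : ℝ → ℝ} {h : ℝ → ℝ → ℝ} {l : ℝ} {L : ℕ → ℝ}
    {U : ℕ → ℝ → ℝ} {u : ℝ → ℝ} (ha : Continuous a) (hh : Continuous fun q : ℝ × ℝ => h q.1 q.2)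
    (hu : Continuous u) (hU : ∀ n, IsViscositySubsolution a h (L n) (U n))
    (hL : Tendsto L atTop (𝓝 l))
    (hlim : ∀ R : ℝ, ∀ ε > 0, ∀ᶠ n in atTop, ∀ x, |x| ≤ R → |U n x - u x| < ε) :
    IsViscositySubsolution a h l u := by
  refine IsViscositySupersolution.neg (IsViscositySupersolution.of_tendsto ha ?_ hu.neg
    (fun n => (hU n).neg) hL.neg fun R ε hε => ?_)
  · exact (hh.comp (continuous_fst.prodMk continuous_snd.neg)).neg
  · filter_upwards [hlim R ε hε] with n hn x hx
    rw [neg_sub_neg, abs_sub_comm]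
    exact hn x hx

namespace IsEnvironment

variable {α₀ α₁ γ κ : ℝ} {a : ℝ → ℝ} {h : ℝ → ℝ → ℝ}

/-- Solutions at the infimum of the admissible levels. -/
lemma exists_solution_of_forall_gt (E : IsEnvironment α₀ α₁ γ κ a h) {l₀ : ℝ}
    (hex : ∀ l, l₀ < l → ∃ f, IsMaxSlope a h l (slopeBound α₀ l + 1) f) :
    ∃ v, IsLipschitzSolution a h l₀ v := by
  let L : ℕ → ℝ := fun n => l₀ + 1 / (n + 1)
  have hLpos : ∀ n : ℕ, 0 < 1 / ((n : ℝ) + 1) := fun n => by positivity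
  have hL0 : ∀ n, l₀ < L n := fun n => by simp only [L]; linarith [hLpos n]
  have hLanti : ∀ n, L (n + 1) < L n := fun n => by
    simp only [L]
    have : 1 / (((n + 1 : ℕ) : ℝ) + 1) < 1 / ((n : ℝ) + 1) := by
      apply one_div_lt_one_div_of_lt (by positivity); push_cast; linarith
    linarith
  have hLlim : Tendsto L atTop (𝓝 l₀) := by
    have := tendsto_one_div_add_atTop_nhds_zero_nat (𝕜 := ℝ) |>.const_add l₀
    rwa [add_zero] at this
  choose F hF using fun n => hex (L n) (hL0 n)
  set B := slopeBound α₀ (L 0) + 1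
  have hL1 : ∀ n, L n ≤ L 0 := fun n =>
    (antitone_nat_of_succ_le fun n => (hLanti n).le) (Nat.zero_le n)
  have hFB : ∀ n x, |F n x| ≤ B := fun n x => ((hF n).bound x).trans (by
    have := slopeBound_mono E.α₀_pos (hL1 n)
    simp only [B]; linarith)
  have hanti : ∀ x, Antitone fun n => F n x := fun x =>
    antitone_nat_of_succ_le fun n => ((hF n).lt_of_level_lt E (hF (n + 1)) (hLanti n) x).le
  -- The decreasing limit of the slopes is only known to be bounded and measurable. So one passes to
  -- the primitives, which converge locally uniformly, and uses stability of viscosity solutions.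
  let g : ℝ → ℝ := fun x => ⨅ n, F n x
  have hlim : ∀ x, Tendsto (fun n => F n x) atTop (𝓝 (g x)) := fun x =>
    tendsto_atTop_ciInf (hanti x) ⟨-B, by rintro _ ⟨n, rfl⟩; exact (abs_le.1 (hFB n x)).1⟩
  have hgB : ∀ x, |g x| ≤ B := fun x =>
    le_of_tendsto (hlim x).abs (Eventually.of_forall fun n => hFB n x)
  have hgm : Measurable g := measurable_of_tendsto_metrizable (fun n => (hF n).cont.measurable)
    (tendsto_pi_nhds.2 hlim)
  have hgi : ∀ x y, IntervalIntegrable g volume x y := fun x y => by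
    refine (intervalIntegrable_const (c := B)).mono_fun hgm.aestronglyMeasurable
      (Eventually.of_forall fun w => ?_)
    exact (hgB w).trans (le_abs_self _)
  have hBpos : 0 ≤ B := (abs_nonneg _).trans (hgB 0)
  set u : ℝ → ℝ := fun x => ∫ y in (0 : ℝ)..x, g y
  have hlip : LipschitzWith ⟨B, hBpos⟩ u := by
    refine LipschitzWith.of_dist_le_mul fun x y => ?_
    rw [Real.dist_eq]
    simp only [u]
    rw [intervalIntegral.integral_interval_sub_left (hgi _ _) (hgi _ _)]
    have hbd : ∀ r ∈ uIoc y x, ‖g r‖ ≤ B := fun r _ => hgB r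
    exact intervalIntegral.norm_integral_le_of_norm_le_const hbd
  have hunif : ∀ R : ℝ, ∀ ε > 0, ∀ᶠ n in atTop, ∀ x, |x| ≤ R →
      |(∫ y in (0 : ℝ)..x, F n y) - u x| < ε := by
    intro R ε hε
    have hFi : ∀ n x y, IntervalIntegrable (F n) volume x y := fun n x y =>
      (hF n).cont.intervalIntegrable x y
    have h1 : Tendsto (fun n => ∫ y in (-R)..R, |F n y - g y|) atTop (𝓝 (∫ _ in (-R)..R, (0 : ℝ))) := by
      refine intervalIntegral.tendsto_integral_filter_of_dominated_convergence (fun _ => 2 * B)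
        (Eventually.of_forall fun n => ?_) (Eventually.of_forall fun n => ?_) (by simp)
        (Eventually.of_forall fun y _ => ?_)
      · exact ((hF n).cont.measurable.sub hgm).abs.aestronglyMeasurable
      · refine Eventually.of_forall fun y _ => ?_
        rw [Real.norm_eq_abs, abs_abs]
        exact (abs_sub _ _).trans (by linarith [hFB n y, hgB y])
      · have := ((hlim y).sub_const (g y)).abs
        simpa using this
    rw [intervalIntegral.integral_zero] at h1
    filter_upwards [h1.eventually (gt_mem_nhds hε)] with n hn x hx
    refine lt_of_le_of_lt ?_ hn
    simp only [u]
    rw [← intervalIntegral.integral_sub (hFi _ _ _) (hgi _ _)]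
    have hx' := abs_le.1 hx
    have hR : -R ≤ R := by linarith
    calc |∫ y in (0 : ℝ)..x, (F n y - g y)| ≤ ∫ y in uIoc 0 x, |F n y - g y| := by
          simpa only [Real.norm_eq_abs] using
            intervalIntegral.norm_integral_le_integral_norm_uIoc (f := fun y => F n y - g y)
              (μ := volume) (a := 0) (b := x)
      _ ≤ ∫ y in Ioc (-R) R, |F n y - g y| := by
          have hi := (((hFi n (-R) R).sub (hgi (-R) R)).abs).1
          refine setIntegral_mono_set hi (Eventually.of_forall fun y => abs_nonneg _)
            (LE.le.eventuallyLE fun y hy => ?_)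
          rw [mem_uIoc] at hy
          rcases hy with hy | hy
          · exact ⟨by linarith [hy.1], by linarith [hy.2]⟩
          · exact ⟨by linarith [hy.1], by linarith [hy.2]⟩
      _ = ∫ y in (-R)..R, |F n y - g y| := by rw [intervalIntegral.integral_of_le hR]
  have hsol := fun n => (hF n).isLipschitzSolution E
  exact ⟨u, IsViscositySupersolution.of_tendsto E.continuous_a E.continuous_h hlip.continuous
      (fun n => (hsol n).supersolution) hLlim hunif,
    IsViscositySubsolution.of_tendsto E.continuous_a E.continuous_h hlip.continuous
      (fun n => (hsol n).subsolution) hLlim hunif, ⟨_, hlip⟩, by simp [u]⟩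

end IsEnvironment

end

/-! ### Regularity of viscosity solutions where `a > 0`, and uniqueness of the upper corrector -/

noncomputable section

/-- Lipschitz supersolutions are semiconcave where the diffusion does not degenerate. -/
lemma SuperOn.semiconcave {a : ℝ → ℝ} {h : ℝ → ℝ → ℝ} {l s t K M δ C : ℝ} {u : ℝ → ℝ}
    (hu : SuperOn a h l (Ioo s t) u)
    (hlip : ∀ x ∈ Icc s t, ∀ y ∈ Icc s t, |u x - u y| ≤ K * |x - y|)
    (ha : ∀ x ∈ Icc s t, δ ≤ a x) (hC0 : 0 ≤ C) (hC : l + M < 2 * C * δ)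
    (hM : ∀ x ∈ Icc s t, ∀ p, |p| ≤ K → -M ≤ h x p) :
    ConvexOn ℝ (Icc s t) fun x => C * x ^ 2 - u x := by
  set G : ℝ → ℝ := fun x => C * x ^ 2 - u x
  have hGc : Continuous G := by have := hu.1; fun_prop
  refine convexOn_of_slope_mono_adjacent (convex_Icc s t) fun {x y z} hx hz hxy hyz => ?_
  by_contra hlt
  push Not at hlt
  set m := (G z - G x) / (z - x)
  have hxz : 0 < z - x := by linarith
  have hm : m * (z - x) = G z - G x := div_mul_cancel₀ _ hxz.ne'
  -- If `G` exceeds one of its chords, the parabola built from the chord touches `u` from below with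
  -- second derivative `2 C`; then `a φ'' ≥ 2 C δ > l + M` violates the supersolution inequality.
  let D : ℝ → ℝ := fun w => G w - (G x + m * (w - x))
  have hDx : D x = 0 := by simp [D]
  have hDz : D z = 0 := by simp only [D]; linarith
  have hDy : 0 < D y := by
    rw [div_lt_div_iff₀ (by linarith) (by linarith)] at hlt
    have : 0 < (z - x) * D y := by
      simp only [D]
      have e : (z - x) * (G y - (G x + m * (y - x))) =
        (G y - G x) * (z - x) - (m * (z - x)) * (y - x) := by ring
      rw [e, hm]; nlinarith
    exact pos_of_mul_pos_right this hxz.le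
  have hDc : Continuous D := by fun_prop
  obtain ⟨w, hw, hmax⟩ := isCompact_Icc.exists_isMaxOn (nonempty_Icc.2 (by linarith)) hDc.continuousOn (s := Icc x z)
  have hDw : 0 < D w := hDy.trans_le (hmax ⟨hxy.le, hyz.le⟩)
  have hwx : x < w := lt_of_le_of_ne hw.1 (by rintro rfl; linarith)
  have hwz : w < z := lt_of_le_of_ne hw.2 (by rintro rfl; linarith)
  have hwI : w ∈ Ioo s t := ⟨by linarith [hx.1], by linarith [hz.2]⟩
  have hloc := hmax.isLocalMax (Icc_mem_nhds hwx hwz)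
  let φ : ℝ → ℝ := fun y => (-(G x) + m * x) + (-m) * (y - 0) + C * (y - 0) ^ 2
  have hmin : IsLocalMin (fun y => u y - φ y) w := by
    refine hloc.neg.congr (Eventually.of_forall fun y => ?_)
    simp only [D, G, φ]; ring
  have hd : HasDerivAt φ (-m + 2 * C * (w - 0)) w := hasDerivAt_quadratic _ _ _ _ _
  have hp := abs_deriv_le_of_isLocalMin hwI hlip hd hmin
  have key := hu.2 φ w hwI (contDiff_quadratic _ _ _ _) hmin
  rw [deriv_deriv_quadratic, hd.deriv] at key
  have h1 := hM w ⟨hwI.1.le, hwI.2.le⟩ _ hp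
  have h2 := mul_le_mul_of_nonneg_right (ha w ⟨hwI.1.le, hwI.2.le⟩) (by linarith : 0 ≤ 2 * C)
  linarith

/-- A function which is both semiconvex and semiconcave is `C^{1,1}`. -/
lemma exists_lipschitz_deriv_of_convexOn {u : ℝ → ℝ} {C s t : ℝ}
    (h1 : ConvexOn ℝ (Icc s t) fun x => C * x ^ 2 - u x)
    (h2 : ConvexOn ℝ (Icc s t) fun x => C * x ^ 2 + u x) :
    (∀ x ∈ Ioo s t, DifferentiableAt ℝ u x) ∧
      ∀ x ∈ Ioo s t, ∀ y ∈ Ioo s t, |deriv u x - deriv u y| ≤ 2 * C * |x - y| := by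
  have hq : ∀ x, HasDerivAt (fun x : ℝ => C * x ^ 2) (2 * C * x) x := fun x => by
    simpa using hasDerivAt_quadratic 0 0 C 0 x
  have hdiff : ∀ x ∈ Ioo s t, DifferentiableAt ℝ u x := by
    intro x hx
    have hx' : x ∈ interior (Icc s t) := by rwa [interior_Icc]
    have r1 := h1.hasDerivWithinAt_rightDeriv_of_mem_interior hx'
    have r2 := h2.hasDerivWithinAt_rightDeriv_of_mem_interior hx'
    have l1 := h1.hasDerivWithinAt_leftDeriv_of_mem_interior hx'
    have l2 := h2.hasDerivWithinAt_leftDeriv_of_mem_interior hx'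
    have o1 := h1.leftDeriv_le_rightDeriv_of_mem_interior hx'
    have o2 := h2.leftDeriv_le_rightDeriv_of_mem_interior hx'
    set R1 := derivWithin (fun x => C * x ^ 2 - u x) (Ioi x) x
    set R2 := derivWithin (fun x => C * x ^ 2 + u x) (Ioi x) x
    set L1 := derivWithin (fun x => C * x ^ 2 - u x) (Iio x) x
    set L2 := derivWithin (fun x => C * x ^ 2 + u x) (Iio x) x
    -- The two convex functions have a smooth sum. Their gaps between right and left derivatives are
    -- nonnegative and add up to zero, so both vanish.
    have e : ((fun x => C * x ^ 2 - u x) + fun x => C * x ^ 2 + u x) =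
        fun x => 2 * (C * x ^ 2) := by ext y; simp; ring
    have rs := r1.add r2
    have ls := l1.add l2
    rw [e] at rs ls
    have hq2 := (hq x).const_mul 2
    have er := (uniqueDiffWithinAt_Ioi x).eq_deriv _ rs hq2.hasDerivWithinAt
    have el := (uniqueDiffWithinAt_Iio x).eq_deriv _ ls hq2.hasDerivWithinAt
    have hLR : L1 = R1 := by linarith
    have hG : HasDerivAt (fun x => C * x ^ 2 - u x) R1 x := by
      rw [hLR] at l1
      have := l1.Iic_of_Iio.union r1.Ici_of_Ioi
      rwa [Iic_union_Ici, hasDerivWithinAt_univ] at this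
    have := ((hq x).fun_sub hG).differentiableAt
    simpa using this
  refine ⟨hdiff, ?_⟩
  have hS : Ioo s t ⊆ Icc s t := Ioo_subset_Icc_self
  have m1 := (h1.subset hS (convex_Ioo s t)).monotoneOn_deriv
    fun x hx => (hq x).differentiableAt.fun_sub (hdiff x hx)
  have m2 := (h2.subset hS (convex_Ioo s t)).monotoneOn_deriv
    fun x hx => (hq x).differentiableAt.fun_add (hdiff x hx)
  have key : ∀ x ∈ Ioo s t, ∀ y ∈ Ioo s t, x ≤ y → |deriv u x - deriv u y| ≤ 2 * C * (y - x) := by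
    intro x hx y hy hxy
    have k1 := m1 hx hy hxy
    have k2 := m2 hx hy hxy
    rw [((hq x).fun_sub (hdiff x hx).hasDerivAt).deriv,
      ((hq y).fun_sub (hdiff y hy).hasDerivAt).deriv] at k1
    rw [((hq x).fun_add (hdiff x hx).hasDerivAt).deriv,
      ((hq y).fun_add (hdiff y hy).hasDerivAt).deriv] at k2
    rw [abs_le]; constructor <;> linarith
  intro x hx y hy
  rcases le_total x y with hxy | hxy
  · rw [abs_sub_comm x y, abs_of_nonneg (by linarith : 0 ≤ y - x)]; exact key x hx y hy hxy
  · rw [abs_sub_comm, abs_of_nonneg (by linarith : 0 ≤ x - y)]; exact key y hy x hx hxy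

namespace IsEnvironment

variable {α₀ α₁ γ κ : ℝ} {a : ℝ → ℝ} {h : ℝ → ℝ → ℝ}

lemma abs_sub_le_of_supersolution (E : IsEnvironment α₀ α₁ γ κ a h) {l : ℝ} {u : ℝ → ℝ}
    (hu : IsViscositySupersolution a h l u) (x y : ℝ) : |u x - u y| ≤ slopeBound α₀ l * |x - y| :=
  E.lipschitz_of_superOn (s := min x y) (t := max x y) (hu.superOn _) x
    ⟨min_le_left _ _, le_max_left _ _⟩ y ⟨min_le_right _ _, le_max_right _ _⟩

/-- Lipschitz viscosity solutions are classical where `a > 0`. -/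
lemma odeOn_deriv (E : IsEnvironment α₀ α₁ γ κ a h) {l s t : ℝ} {u : ℝ → ℝ}
    (hpos : ∀ x ∈ Ioo s t, 0 < a x) (hu : IsViscositySupersolution a h l u)
    (hu' : IsViscositySubsolution a h l u) :
    (∀ x ∈ Ioo s t, DifferentiableAt ℝ u x) ∧ OdeOn a h l s t (deriv u) := by
  set K := slopeBound α₀ l
  have hKpos : 0 < K := slopeBound_pos E.α₀_pos l
  have hlip := E.abs_sub_le_of_supersolution hu
  have hlip' : ∀ x y, |(-u x) - (-u y)| ≤ K * |x - y| := fun x y => by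
    rw [neg_sub_neg, abs_sub_comm]; exact hlip x y
  have hun := hu'.neg
  -- On compact subintervals `a` is bounded below, so `u` is semiconcave as a supersolution and
  -- semiconvex as a subsolution.
  have loc : ∀ s' t', s < s' → t' < t → s' < t' → (∀ x ∈ Ioo s' t', DifferentiableAt ℝ u x) ∧
      ∃ C, 0 ≤ C ∧ ∀ x ∈ Ioo s' t', ∀ y ∈ Ioo s' t', |deriv u x - deriv u y| ≤ C * |x - y| := by
    intro s' t' hs' ht' hst
    have hsub : Icc s' t' ⊆ Ioo s t := fun y hy => ⟨by linarith [hy.1], by linarith [hy.2]⟩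
    obtain ⟨δ, hδ, hδle⟩ := E.exists_pos_le fun y hy => hpos y (hsub hy)
    set M := α₁ * (K ^ γ + 1) + 1 / α₀
    have hM : 0 ≤ M := (abs_nonneg _).trans (E.abs_h_le 0 (by rw [abs_of_pos hKpos] : |K| ≤ K))
    set C := (|l| + M) / δ + 1
    have hC : 0 < C := by positivity
    have hC2 : |l| + M < 2 * C * δ := by
      have : C * δ = |l| + M + δ := by simp only [C]; field_simp
      nlinarith [abs_nonneg l]
    have c1 := (hu.superOn (Ioo s' t')).semiconcave (fun x _ y _ => hlip x y) hδle hC.le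
      (M := M) (by linarith [le_abs_self l]) fun x _ p hp => by
        linarith [neg_abs_le (h x p), E.abs_h_le x hp]
    have c2 := (hun.superOn (Ioo s' t')).semiconcave (fun x _ y _ => hlip' x y) hδle hC.le
      (M := M) (by linarith [neg_abs_le l]) fun x _ p hp => by
        have := E.abs_h_le (B := K) x (p := -p) (by rwa [abs_neg])
        linarith [le_abs_self (h x (-p))]
    simp only [sub_neg_eq_add] at c2
    obtain ⟨d1, d2⟩ := exists_lipschitz_deriv_of_convexOn c1 c2
    exact ⟨d1, 2 * C, by linarith, d2⟩
  have hdiff : ∀ x ∈ Ioo s t, DifferentiableAt ℝ u x := by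
    intro x hx
    obtain ⟨s', hs1, hs2⟩ := exists_between hx.1
    obtain ⟨t', ht1, ht2⟩ := exists_between hx.2
    exact (loc s' t' hs1 ht2 (hs2.trans ht1)).1 x ⟨hs2, ht1⟩
  refine ⟨hdiff, fun x hx => ?_⟩
  obtain ⟨s₁, hs1, hs2⟩ := exists_between hx.1
  obtain ⟨t₁, ht1, ht2⟩ := exists_between hx.2
  obtain ⟨s₂, hs3, hs4⟩ := exists_between hs2
  obtain ⟨t₂, ht3, ht4⟩ := exists_between ht1
  obtain ⟨-, C, hC, hCl⟩ := loc s₁ t₁ hs1 ht2 (hs2.trans ht1)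
  have hsub1 : Icc s₂ t₂ ⊆ Ioo s₁ t₁ := fun y hy => ⟨by linarith [hy.1], by linarith [hy.2]⟩
  have hsub : Icc s₂ t₂ ⊆ Ioo s t := fun y hy => ⟨by linarith [hy.1], by linarith [hy.2]⟩
  have hCl' : ∀ y ∈ Icc s₂ t₂, ∀ w ∈ Icc s₂ t₂, |deriv u y - deriv u w| ≤ C * |y - w| :=
    fun y hy w hw => hCl y (hsub1 hy) w (hsub1 hw)
  have hst : s₂ ≤ t₂ := (hs4.trans ht3).le
  -- The Lipschitz function `deriv u` is differentiable almost everywhere; at such points `u` may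
  -- serve as its own test function from both sides. Integrating yields the ODE everywhere.
  have hae : ∀ᵐ y, y ∈ Ioo s₂ t₂ → deriv (deriv u) y = (l - h y (deriv u y)) / a y := by
    filter_upwards [ae_differentiableAt_of_abs hst hC hCl'] with y hy hyI
    have hyI' := hsub ⟨hyI.1.le, hyI.2.le⟩
    have hev : ∀ᶠ w in 𝓝 y, HasDerivAt u (deriv u w) w := by
      filter_upwards [Ioo_mem_nhds hyI'.1 hyI'.2] with w hw using (hdiff w hw).hasDerivAt
    have hd := (hy hyI).hasDerivAt
    have k1 := (hu.superOn univ).touch (mem_univ y) (E.nonneg y) hev hd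
      (by simp [IsLocalMin, IsMinFilter])
    have hev' : ∀ᶠ w in 𝓝 y, HasDerivAt (fun w => -u w) (-deriv u w) w := by
      filter_upwards [hev] with w hw using hw.fun_neg
    have k2 := (hun.superOn univ).touch (mem_univ y) (E.nonneg y) hev' hd.fun_neg
      (by simp [IsLocalMin, IsMinFilter])
    simp only [neg_neg] at k2
    rw [eq_div_iff (hpos y hyI').ne']
    linarith
  have hlipg := lipschitzOnWith_of_abs hC hCl'
  have hgc : ContinuousOn (deriv u) (Icc s₂ t₂) := hlipg.continuousOn
  have hb : ContinuousOn (fun y => (l - h y (deriv u y)) / a y) (Icc s₂ t₂) :=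
    (continuousOn_const.sub (E.continuous_h.comp_continuousOn
      (continuousOn_id.prodMk hgc))).div E.continuous_a.continuousOn
      fun y hy => (hpos y (hsub hy)).ne'
  have hx' : x ∈ Ioo s₂ t₂ := ⟨hs4, ht3⟩
  have hint : ∀ w ∈ Icc s₂ t₂, deriv u w - deriv u x =
      ∫ r in x..w, (l - h r (deriv u r)) / a r := by
    intro w hw
    have hxw : uIcc x w ⊆ Icc s₂ t₂ := uIcc_subset_Icc ⟨hx'.1.le, hx'.2.le⟩ hw
    have hac : AbsolutelyContinuousOnInterval (deriv u) x w :=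
      (hlipg.mono hxw).absolutelyContinuousOnInterval
    rw [← hac.integral_deriv_eq_sub]
    refine intervalIntegral.integral_congr_ae ?_
    have hne : ∀ᵐ y : ℝ, y ≠ s₂ ∧ y ≠ t₂ := by
      filter_upwards [measure_eq_zero_iff_ae_notMem.1 (measure_singleton (μ := volume) s₂),
        measure_eq_zero_iff_ae_notMem.1 (measure_singleton (μ := volume) t₂)] with y h1 h2
      exact ⟨h1, h2⟩
    filter_upwards [hae, hne] with y hy hyne hyI
    have := hxw (uIoc_subset_uIcc hyI)
    exact hy ⟨lt_of_le_of_ne this.1 (Ne.symm hyne.1), lt_of_le_of_ne this.2 hyne.2⟩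
  have hd : HasDerivAt (fun w => ∫ r in x..w, (l - h r (deriv u r)) / a r)
      ((l - h x (deriv u x)) / a x) x := by
    refine intervalIntegral.integral_hasDerivAt_right (by simp) ?_
      (hb.continuousAt (Icc_mem_nhds hx'.1 hx'.2))
    exact (hb.mono Ioo_subset_Icc_self).stronglyMeasurableAtFilter isOpen_Ioo x hx'
  refine (hd.const_add (deriv u x)).congr_of_eventuallyEq ?_
  filter_upwards [Ioo_mem_nhds hx'.1 hx'.2] with w hw
  rw [← hint w ⟨hw.1.le, hw.2.le⟩]; ring

end IsEnvironment

/-- Lipschitz functions with almost everywhere equal derivatives and equal values at `0` agree. -/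
lemma eq_of_ae_deriv_eq {u f : ℝ → ℝ} {K : NNReal} (hu : LipschitzWith K u) (h0 : u 0 = 0)
    (hd : ∀ᵐ x, deriv u x = f x) : u = fun x => ∫ y in (0 : ℝ)..x, f y := by
  ext x
  have hac : AbsolutelyContinuousOnInterval u 0 x :=
    (hu.lipschitzOnWith (s := uIcc 0 x)).absolutelyContinuousOnInterval
  have h1 := hac.integral_deriv_eq_sub
  rw [h0, sub_zero] at h1
  rw [← h1]
  exact intervalIntegral.integral_congr_ae (hd.mono fun y hy _ => hy)

namespace IsMaxSlope

variable {α₀ α₁ γ κ : ℝ} {a : ℝ → ℝ} {h : ℝ → ℝ → ℝ} {l B : ℝ} {f : ℝ → ℝ}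

/-- Uniqueness of the upper corrector. -/
lemma eq_of_isUpperCorrector (hf : IsMaxSlope a h l B f) (E : IsEnvironment α₀ α₁ γ κ a h)
    {l₀ : ℝ} {u v : ℝ → ℝ} (hl : l₀ < l) (hB : slopeBound α₀ l ≤ B)
    (hv : IsViscositySupersolution a h l₀ v) (hu : IsUpperCorrector a h v l u) :
    u = fun x => ∫ y in (0 : ℝ)..x, f y := by
  obtain ⟨⟨hsup, hsub, ⟨K, hK⟩, h0⟩, hge⟩ := hu
  refine eq_of_ae_deriv_eq hK h0 ?_
  have hvlip : LipschitzWith ⟨slopeBound α₀ l₀, (slopeBound_pos E.α₀_pos l₀).le⟩ v :=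
    LipschitzWith.of_dist_le_mul fun x y => E.abs_sub_le_of_supersolution hv x y
  filter_upwards [hge, hK.ae_differentiableAt, hvlip.ae_differentiableAt] with x hx hdu hdv
  rcases (E.nonneg x).eq_or_lt with hx0 | hx0
  · have hz := hx0.symm
    -- At a zero of `a` where both functions are differentiable, `h(u') = l` while `h(v') ≤ l₀ < l`.
    -- As `u' ≥ v'`, the slope `u'` can only be the largest root.
    have k1 := IsEnvironment.h_deriv_le (hv.superOn univ) univ_mem (E.le_sq hz) E.continuous_h
      hdv.hasDerivAt
    have k2 := IsEnvironment.h_deriv_le (hsup.superOn univ) univ_mem (E.le_sq hz) E.continuous_h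
      hdu.hasDerivAt
    have k3 := IsEnvironment.h_deriv_le (hsub.neg.superOn univ) univ_mem (E.le_sq hz)
      ((E.continuous_h.comp (continuous_fst.prodMk continuous_snd.neg)).neg) hdu.hasDerivAt.fun_neg
    rw [neg_neg] at k3
    rw [hf.zero x hz]
    refine le_antisymm (E.le_topRoot k2) (le_of_not_gt fun hlt => ?_)
    have := E.h_lt_of_lt_topRoot (k1.trans_lt hl) hx hlt
    linarith
  · obtain ⟨s, t, hI, hxI⟩ := E.exists_component hx0
    obtain ⟨hd, hode⟩ := E.odeOn_deriv hI.pos hsup hsub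
    refine hf.eqOn_component E hI hode (fun y hy => ?_) hl
      ((slopeBound_mono E.α₀_pos hl.le).trans hB) (hv.superOn _) (hge.mono fun y hy _ => hy) hxI
    exact (abs_deriv_le_of_isLocalMin (s := y - 1) (t := y + 1) ⟨by linarith, by linarith⟩
      (fun x _ w _ => E.abs_sub_le_of_supersolution hsup x w) (hd y hy).hasDerivAt
      (by simp [IsLocalMin, IsMinFilter])).trans hB

end IsMaxSlope

namespace IsEnvironment

variable {α₀ α₁ γ κ : ℝ} {a : ℝ → ℝ} {h : ℝ → ℝ → ℝ}

lemma isViscositySupersolution_zero (E : IsEnvironment α₀ α₁ γ κ a h) :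
    IsViscositySupersolution a h α₁ fun _ => 0 := by
  refine ⟨continuous_const, fun φ x hφ hm => ?_⟩
  obtain ⟨h1, h2⟩ := deriv_deriv_le_of_isLocalMin (f := fun _ => 0) hφ
    (Eventually.of_forall fun y => hasDerivAt_const y (0 : ℝ)) (hasDerivAt_const x (0 : ℝ)) hm
  rw [h1]
  have h3 := E.ham.upper x 0
  rw [abs_zero, Real.zero_rpow (by linarith [E.two_lt])] at h3
  have := mul_nonpos_of_nonneg_of_nonpos (E.nonneg x) h2
  linarith

/-- At a zero of `a` every level above `l` is attained from below by `h`, which is itself bounded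
below by `-1 / α₀`. -/
lemma neg_le_level (E : IsEnvironment α₀ α₁ γ κ a h) {l : ℝ} {u : ℝ → ℝ}
    (hu : IsViscositySupersolution a h l u) : -(1 / α₀) ≤ l := by
  refine le_of_forall_gt_imp_ge_of_dense fun m hm => ?_
  obtain ⟨z, -, hz⟩ := E.zeros_left 0
  obtain ⟨p, hp⟩ := E.exists_h_lt hm hz (hu.superOn _)
  linarith [E.neg_le z p]

lemma exists_isCriticalValue (E : IsEnvironment α₀ α₁ γ κ a h) :
    IsCriticalValue a h (sInf {l : ℝ | ∃ u : ℝ → ℝ, IsViscositySupersolution a h l u}) :=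
  isGLB_csInf ⟨α₁, _, E.isViscositySupersolution_zero⟩
    ⟨-(1 / α₀), fun _ ⟨_, hu⟩ => E.neg_le_level hu⟩

lemma exists_isMaxSlope_of_critical (E : IsEnvironment α₀ α₁ γ κ a h) {l₀ l : ℝ}
    (hc : IsCriticalValue a h l₀) (hl : l₀ < l) :
    ∃ f, IsMaxSlope a h l (slopeBound α₀ l + 1) f ∧
      ∀ (v : ℝ → ℝ) (μ' : ℝ), μ' < l → IsViscositySupersolution a h μ' v →
        ∀ x p, HasDerivAt v p x → p ≤ f x := by
  obtain ⟨μ, ⟨w, hw⟩, -, hμ⟩ := hc.exists_between hl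
  exact E.exists_isMaxSlope hμ fun n => ⟨w, hw.superOn _⟩

end IsEnvironment

/-- The slope of the maximal solution. -/
def maxSlope (α₀ : ℝ) (a : ℝ → ℝ) (h : ℝ → ℝ → ℝ) (l : ℝ) : ℝ → ℝ :=
  Classical.epsilon (IsMaxSlope a h l (slopeBound α₀ l + 1))

namespace IsEnvironment

variable {α₀ α₁ γ κ : ℝ} {a : ℝ → ℝ} {h : ℝ → ℝ → ℝ}

lemma isMaxSlope_maxSlope (E : IsEnvironment α₀ α₁ γ κ a h) {l₀ l : ℝ}
    (hc : IsCriticalValue a h l₀) (hl : l₀ < l) :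
    IsMaxSlope a h l (slopeBound α₀ l + 1) (maxSlope α₀ a h l) :=
  Classical.epsilon_spec
    ((E.exists_isMaxSlope_of_critical hc hl).imp fun _ hf => hf.1)

lemma exists_critical_solution (E : IsEnvironment α₀ α₁ γ κ a h) {l₀ : ℝ}
    (hc : IsCriticalValue a h l₀) : ∃ v, IsLipschitzSolution a h l₀ v :=
  E.exists_solution_of_forall_gt fun _ hl => ⟨_, E.isMaxSlope_maxSlope hc hl⟩

/-- The integral of the maximal slope is the unique upper corrector, for any critical solution. -/
lemma isUpperCorrector_iff (E : IsEnvironment α₀ α₁ γ κ a h) {l₀ l : ℝ} {u v : ℝ → ℝ}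
    (hc : IsCriticalValue a h l₀) (hl : l₀ < l) (hv : IsLipschitzSolution a h l₀ v) :
    IsUpperCorrector a h v l u ↔ u = fun x => ∫ y in (0 : ℝ)..x, maxSlope α₀ a h l y := by
  have hf := E.isMaxSlope_maxSlope hc hl
  refine ⟨fun hu => hf.eq_of_isUpperCorrector E hl (by linarith) hv.supersolution hu, ?_⟩
  rintro rfl
  refine ⟨hf.isLipschitzSolution E, ?_⟩
  obtain ⟨f, hf', htop⟩ := E.exists_isMaxSlope_of_critical hc hl
  -- Domination of critical slopes is part of the construction of `f`; uniqueness transfers it to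
  -- the slope chosen by `maxSlope`.
  rw [hf.deriv_integral, hf'.unique E hf]
  obtain ⟨K, hK⟩ := hv.lipschitz
  filter_upwards [hK.ae_differentiableAt] with x hx
  exact htop v l₀ hl hv.supersolution x _ hx.hasDerivAt

lemma upperCorrector_eq (E : IsEnvironment α₀ α₁ γ κ a h) {l₀ l : ℝ} {v : ℝ → ℝ}
    (hc : IsCriticalValue a h l₀) (hl : l₀ < l) (hv : IsLipschitzSolution a h l₀ v) :
    upperCorrector a h v l = fun x => ∫ y in (0 : ℝ)..x, maxSlope α₀ a h l y :=
  (E.isUpperCorrector_iff hc hl hv).1 (Classical.epsilon_spec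
    ⟨_, (E.isUpperCorrector_iff hc hl hv).2 rfl⟩)

end IsEnvironment

end

/-! ### Countable description of the critical value and of the slope at the origin -/

noncomputable section

/-- A continuous function vanishing on the zero set of `a` is small where `a` is small. -/
lemma exists_lt_of_sqrt_lt {a b : ℝ → ℝ} {R η : ℝ} (ha : Continuous a) (hnn : ∀ x, 0 ≤ a x)
    (hb : Continuous b) (hzero : ∀ x, a x = 0 → b x = 0) (hη : 0 < η) :
    ∃ δ > 0, ∀ x, |x| ≤ R → √(a x) < δ → |b x| < η := by
  have hK : IsCompact (Icc (-R) R ∩ {x | η ≤ |b x|}) :=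
    isCompact_Icc.inter_right (isClosed_le continuous_const hb.abs)
  rcases (Icc (-R) R ∩ {x | η ≤ |b x|}).eq_empty_or_nonempty with he | hne
  · refine ⟨1, one_pos, fun x hx _ => lt_of_not_ge fun hle => ?_⟩
    have : x ∈ Icc (-R) R ∩ {x | η ≤ |b x|} := ⟨abs_le.1 hx, hle⟩
    rw [he] at this; exact this
  · obtain ⟨y, hy, hmin⟩ := hK.exists_isMinOn hne (ha.sqrt.continuousOn)
    have hpos : 0 < a y := by
      refine lt_of_le_of_ne (hnn y) fun h0 => ?_
      have h1 : η ≤ |b y| := hy.2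
      rw [hzero y h0.symm, abs_zero] at h1
      linarith
    refine ⟨√(a y), Real.sqrt_pos.2 hpos, fun x hx hlt => lt_of_not_ge fun hle => ?_⟩
    have : √(a y) ≤ √(a x) := hmin (show x ∈ Icc (-R) R ∩ {x | η ≤ |b x|} from ⟨abs_le.1 hx, hle⟩)
    linarith

lemma exists_uniform_modulus {f : ℝ → ℝ} (hf : Continuous f) (R : ℝ) {η : ℝ} (hη : 0 < η) :
    ∃ δ ∈ Ioo (0 : ℝ) 1, ∀ x y, |x| ≤ R → |x - y| < δ → |f x - f y| < η := by
  have h1 := isCompact_Icc.uniformContinuousOn_of_continuous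
    (hf.continuousOn (s := Icc (-R - 1) (R + 1)))
  obtain ⟨δ, hδ, h2⟩ := Metric.uniformContinuousOn_iff.1 h1 η hη
  refine ⟨min δ (1 / 2), ⟨lt_min hδ (by norm_num), (min_le_right _ _).trans_lt (by norm_num)⟩,
    fun x y hx hxy => ?_⟩
  have h3 := abs_le.1 hx
  have h4 := abs_lt.1 (hxy.trans_le (min_le_right _ _))
  have := h2 x ⟨by linarith, by linarith⟩ y ⟨by linarith, by linarith⟩
    (by rw [Real.dist_eq]; exact hxy.trans_le (min_le_left _ _))
  rwa [Real.dist_eq] at this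

/-- Difference quotients of a solution of the degenerate equation `a f' = b` are approximate
subsolutions, locally uniformly. -/
lemma exists_mul_difference_quotient_le {a b f : ℝ → ℝ} {κ B C R η : ℝ} (hκ : 0 < κ)
    (ha : Continuous a) (hnn : ∀ x, 0 ≤ a x) (hlip : ∀ x y, |√(a x) - √(a y)| ≤ κ * |x - y|)
    (hf : Continuous f) (hfB : ∀ x, |f x| ≤ B) (hb : Continuous b) (hbC : ∀ x, |b x| ≤ C)
    (hzero : ∀ x, a x = 0 → b x = 0) (hode : ∀ x, 0 < a x → HasDerivAt f (b x / a x) x)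
    (hη : 0 < η) :
    ∃ ε₀ > 0, ∀ ε, 0 < ε → ε < ε₀ → ∀ x, |x| ≤ R → a x * ((f (x + ε) - f x) / ε) ≤ b x + η := by
  have hC : 0 ≤ C := (abs_nonneg _).trans (hbC 0)
  have hB : 0 ≤ B := (abs_nonneg _).trans (hfB 0)
  obtain ⟨δ, hδ, hsmall⟩ := exists_lt_of_sqrt_lt (R := R) ha hnn hb hzero (half_pos hη)
  obtain ⟨δ', hδ', hmod⟩ := exists_uniform_modulus hb R (half_pos hη)
  -- `N ≥ 2` makes `√a` at neighbouring points comparable, and `N η ≥ 12 C` turns the relative error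
  -- `6 / N` of `a`, multiplied by `|b| ≤ C`, into at most `η / 2`.
  set N : ℝ := 2 + 12 * C / η with hN
  have hNpos : 0 < N := by positivity
  have hN2 : 2 ≤ N := by simp only [hN]; have : 0 ≤ 12 * C / η := by positivity
                         linarith
  have hNC : 12 * C ≤ N * η := by
    have : N * η = 2 * η + 12 * C := by simp only [hN]; field_simp
    linarith
  refine ⟨min δ' (min (δ / (κ * N)) (η / (4 * (B + 1) * (κ * N) ^ 2))),
    lt_min hδ'.1 (lt_min (by positivity) (by positivity)), fun ε hε hlt x hx => ?_⟩
  have e1 : ε < δ' := hlt.trans_le (min_le_left _ _)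
  have e2 : ε * (κ * N) < δ := (lt_div_iff₀ (by positivity)).1
    (hlt.trans_le ((min_le_right _ _).trans (min_le_left _ _)))
  have e3 : ε * (4 * (B + 1) * (κ * N) ^ 2) < η := (lt_div_iff₀ (by positivity)).1
    (hlt.trans_le ((min_le_right _ _).trans (min_le_right _ _)))
  have hs0 := Real.sqrt_nonneg (a x)
  have hsq := Real.sq_sqrt (hnn x)
  -- If `√a` is at most of order `ε`, then `a` is of order `ε²` and beats the crude bound `2 B / ε`,
  -- while `b` is small. Otherwise `a` is nearly constant, in relative terms, on `[x, x + ε]`, and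
  -- the mean value theorem applies.
  rcases lt_or_ge (√(a x)) (ε * (κ * N)) with hcase | hcase
  · have h1 := (abs_lt.1 (hsmall x hx (hcase.trans e2))).1
    have h2 : (f (x + ε) - f x) / ε ≤ 2 * B / ε := by
      gcongr; linarith [(abs_le.1 (hfB (x + ε))).2, (abs_le.1 (hfB x)).1]
    have h3 : a x ≤ (ε * (κ * N)) ^ 2 := by rw [← hsq]; gcongr
    have h4 : a x * ((f (x + ε) - f x) / ε) ≤ (ε * (κ * N)) ^ 2 * (2 * B / ε) :=
      (mul_le_mul_of_nonneg_left h2 (hnn x)).trans (mul_le_mul_of_nonneg_right h3 (by positivity))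
    have h5 : (ε * (κ * N)) ^ 2 * (2 * B / ε) = ε * (2 * B * (κ * N) ^ 2) := by field_simp
    have h6 : 0 ≤ ε * (4 * (κ * N) ^ 2) := by positivity
    linarith
  · have hspos : 0 < √(a x) := lt_of_lt_of_le (by positivity) hcase
    have hnear : ∀ y ∈ Icc x (x + ε), N * |√(a x) - √(a y)| ≤ √(a x) := fun y hy => by
      have h1 := hlip x y
      have h2 : |x - y| ≤ ε := abs_le.2 ⟨by linarith [hy.2], by linarith [hy.1]⟩
      have h3 : κ * |x - y| ≤ κ * ε := by gcongr
      nlinarith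
    have hhalf : ∀ y ∈ Icc x (x + ε), √(a x) ≤ 2 * √(a y) := fun y hy => by
      have h1 := hnear y hy
      nlinarith [le_abs_self (√(a x) - √(a y)), abs_nonneg (√(a x) - √(a y))]
    have hpos : ∀ y ∈ Icc x (x + ε), 0 < a y := fun y hy =>
      Real.sqrt_pos.1 (by linarith [hhalf y hy])
    obtain ⟨ξ, hξ, hslope⟩ := exists_hasDerivAt_eq_slope f (fun y => b y / a y)
      (show x < x + ε by linarith) hf.continuousOn fun y hy => hode y (hpos y (Ioo_subset_Icc_self hy))
    rw [add_sub_cancel_left] at hslope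
    rw [← hslope]
    have hξ' := Ioo_subset_Icc_self hξ
    have h1 := hnear ξ hξ'
    have h2 := hhalf ξ hξ'
    have h3 := hpos ξ hξ'
    have h4 : √(a ξ) ^ 2 = a ξ := Real.sq_sqrt (hnn ξ)
    have hs : 0 < √(a ξ) := Real.sqrt_pos.2 h3
    have h5 : N * |a x - a ξ| ≤ 6 * a ξ := by
      have : a x - a ξ = (√(a x) - √(a ξ)) * (√(a x) + √(a ξ)) := by linear_combination h4 - hsq
      rw [this, abs_mul, abs_of_pos (by positivity : 0 < √(a x) + √(a ξ)), ← mul_assoc]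
      calc N * |√(a x) - √(a ξ)| * (√(a x) + √(a ξ)) ≤ (2 * √(a ξ)) * (3 * √(a ξ)) := by
            apply mul_le_mul <;> linarith
        _ = 6 * a ξ := by linear_combination 6 * h4
    have h6 := (abs_lt.1 (hmod x ξ hx (by
      rw [abs_lt]; exact ⟨by linarith [hξ.2], by linarith [hξ.1]⟩))).1
    have h7 : a x * (b ξ / a ξ) - b ξ ≤ η / 2 := by
      have : a x * (b ξ / a ξ) - b ξ = (a x - a ξ) * b ξ / a ξ := by field_simp
      rw [this, div_le_iff₀ h3]
      have k1 : (a x - a ξ) * b ξ ≤ |a x - a ξ| * C := by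
        refine (le_abs_self _).trans ?_
        rw [abs_mul]; gcongr; exact hbC ξ
      have k2 : N * (|a x - a ξ| * C) ≤ N * (η / 2 * a ξ) := by nlinarith
      exact k1.trans (le_of_mul_le_mul_left k2 hNpos)
    linarith

/-- On `[-n, n]`, the function `r + ∫ d` is a strict subfunction at level `l`. -/
def IsTestSlope (a : ℝ → ℝ) (h : ℝ → ℝ → ℝ) (l n : ℝ) (d : C(ℝ, ℝ)) (r : ℝ) : Prop :=
  ∀ x, |x| ≤ n → a x * d x + h x (r + ∫ y in (0 : ℝ)..x, d y) < l

lemma exists_denseSeq_abs_lt (g : C(ℝ, ℝ)) (R : ℝ) {δ : ℝ} (hδ : 0 < δ) :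
    ∃ k : ℕ, ∀ x, |x| ≤ R → |TopologicalSpace.denseSeq C(ℝ, ℝ) k x - g x| < δ := by
  have ho : IsOpen {d : C(ℝ, ℝ) | MapsTo (d - g) (Icc (-R) R) (Metric.ball 0 δ)} :=
    (ContinuousMap.isOpen_setOfPred_mapsTo isCompact_Icc Metric.isOpen_ball).preimage
      (continuous_id.sub continuous_const)
  obtain ⟨k, hk⟩ := (TopologicalSpace.denseRange_denseSeq C(ℝ, ℝ)).exists_mem_open ho
    ⟨g, fun x _ => by simp [hδ]⟩
  refine ⟨k, fun x hx => ?_⟩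
  have := hk (show x ∈ Icc (-R) R from abs_le.1 hx)
  simpa [Real.dist_eq] using this

namespace IsMaxSlope

variable {α₀ α₁ γ κ : ℝ} {a : ℝ → ℝ} {h : ℝ → ℝ → ℝ} {l B : ℝ} {f : ℝ → ℝ}

lemma of_le (hf : IsMaxSlope a h l B f) {B' : ℝ} (hB : B ≤ B') : IsMaxSlope a h l B' f :=
  { hf with bound := fun x => (hf.bound x).trans hB }

/-- The slope `f` need not be differentiable at the zeros of `a`, so it is replaced by a difference
quotient of its primitive, which is `C¹` and whose derivative is a difference quotient of `f`. That
derivative is then approximated from the dense sequence, and the initial value by a rational. -/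
lemma exists_isTestSlope (hf : IsMaxSlope a h l B f) (E : IsEnvironment α₀ α₁ γ κ a h)
    {l' c : ℝ} (hl : l < l') (hc : c < f 0) (n : ℕ) :
    ∃ (k : ℕ) (r : ℚ), c < r ∧ IsTestSlope a h l' n (TopologicalSpace.denseSeq C(ℝ, ℝ) k) r := by
  have hB := hf.bound_nonneg
  have hα₁ := E.α₁_pos
  -- Three errors of size `η` occur: from the difference quotient, from the change of slope in `h`,
  -- and from the dense approximation. A quarter of the gap leaves strict inequality.
  set η := (l' - l) / 4 with hη
  have hηpos : 0 < η := by simp only [hη]; linarith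
  set Λ := α₁ * (2 * (B + 1) + 1) ^ (γ - 1) with hΛ
  have hΛpos : 0 < Λ := by positivity
  -- `ρ` bounds the total change of slope: `ρ / 2` for the difference quotient, `ρ / 4` for the
  -- rational, `ρ / 4` for the integral of the dense approximation.
  set ρ := min (η / Λ) (min 1 (f 0 - c)) with hρ
  have hρpos : 0 < ρ := lt_min (by positivity) (lt_min one_pos (by linarith))
  have hρ1 : ρ ≤ 1 := (min_le_right _ _).trans (min_le_left _ _)
  have hρΛ : Λ * ρ ≤ η := by
    rw [mul_comm]; exact (le_div_iff₀ hΛpos).1 (min_le_left _ _)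
  have hρc : ρ ≤ f 0 - c := (min_le_right _ _).trans (min_le_right _ _)
  obtain ⟨ε₀, hε₀, hquot⟩ := exists_mul_difference_quotient_le (R := n) (η := η) E.κ_pos
    E.continuous_a E.nonneg E.sqrt_lip hf.cont hf.bound (b := fun x => l - h x (f x))
    (C := |l| + (α₁ * (B ^ γ + 1) + 1 / α₀))
    (continuous_const.sub (E.continuous_h.comp (continuous_id.prodMk hf.cont)))
    (fun x => (abs_sub _ _).trans (by gcongr; exact E.abs_h_le x (hf.bound x)))
    (fun x hx => by rw [hf.h_eq E hx, sub_self]) hf.ode hηpos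
  obtain ⟨ε₁, hε₁, hmod⟩ := exists_uniform_modulus hf.cont (n : ℝ) (half_pos hρpos)
  obtain ⟨ε, hε, hlt⟩ := exists_between (lt_min hε₀ hε₁.1)
  have hlt0 := hlt.trans_le (min_le_left _ _)
  have hlt1 := hlt.trans_le (min_le_right _ _)
  set U : ℝ → ℝ := fun x => ∫ y in (0 : ℝ)..x, f y with hU
  have hUd : ∀ x, HasDerivAt U (f x) x := hf.hasDerivAt_integral
  let g : ℝ → ℝ := fun x => (U (x + ε) - U x) / ε
  let g' : C(ℝ, ℝ) := ⟨fun x => (f (x + ε) - f x) / ε,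
    ((hf.cont.comp (continuous_id.add continuous_const)).sub hf.cont).div_const ε⟩
  have hgd : ∀ x, HasDerivAt g (g' x) x := fun x =>
    (((hUd (x + ε)).comp_add_const x ε).sub (hUd x)).div_const ε
  have hgf : ∀ x : ℝ, |x| ≤ n → |g x - f x| < ρ / 2 := fun x hx => by
    obtain ⟨ξ, hξ, hs⟩ := exists_hasDerivAt_eq_slope U f (show x < x + ε by linarith)
      (fun y _ => (hUd y).continuousAt.continuousWithinAt) fun y _ => hUd y
    rw [add_sub_cancel_left] at hs
    have : g x = f ξ := hs.symm
    rw [this, abs_sub_comm]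
    exact hmod x ξ hx (by rw [abs_lt]; exact ⟨by linarith [hξ.2], by linarith [hξ.1]⟩)
  set δ := min η (ρ / (4 * (n + 1))) with hδ
  have hδpos : 0 < δ := lt_min hηpos (by positivity)
  have hδη : δ ≤ η := min_le_left _ _
  have hδρ : δ * (4 * (n + 1)) ≤ ρ := (le_div_iff₀ (by positivity)).1 (min_le_right _ _)
  obtain ⟨k, hk⟩ := exists_denseSeq_abs_lt g' n hδpos
  obtain ⟨r, hr1, hr2⟩ := exists_rat_btwn (show g 0 - ρ / 4 < g 0 by linarith)
  set d := TopologicalSpace.denseSeq C(ℝ, ℝ) k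
  refine ⟨k, r, ?_, fun x hx => ?_⟩
  · have := (abs_lt.1 (hgf 0 (by simp))).1
    linarith
  have hint : |(∫ y in (0 : ℝ)..x, d y) - (g x - g 0)| ≤ δ * n := by
    have h1 : g x - g 0 = ∫ y in (0 : ℝ)..x, g' y :=
      (intervalIntegral.integral_eq_sub_of_hasDerivAt (fun y _ => hgd y)
        (g'.continuous.intervalIntegrable _ _)).symm
    rw [h1, ← intervalIntegral.integral_sub (d.continuous.intervalIntegrable _ _)
      (g'.continuous.intervalIntegrable _ _), ← Real.norm_eq_abs]
    refine (intervalIntegral.norm_integral_le_of_norm_le_const (C := δ) fun y hy => ?_).trans ?_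
    · refine (hk y ?_).le
      rw [uIoc, mem_Ioc] at hy
      have := abs_le.1 hx
      rw [abs_le]
      constructor
      · refine le_trans ?_ hy.1.le; exact le_min (by linarith) this.1
      · exact hy.2.trans (max_le (by linarith) this.2)
    · rw [sub_zero]; gcongr
  set q := (r : ℝ) + ∫ y in (0 : ℝ)..x, d y
  have hqf : |q - f x| ≤ ρ := by
    have h1 := abs_le.1 hint
    have h2 := abs_lt.1 (hgf x hx)
    simp only [q]
    rw [abs_le]; constructor <;> nlinarith
  have hfB := hf.bound x
  have h1 : h x q - h x (f x) ≤ η := by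
    have h2 := E.lip_p_of_le (x := x) (K := B + 1) (p := q) (q := f x) (by
      have := abs_le.1 hqf; have := abs_le.1 hfB
      rw [abs_le]; constructor <;> linarith) (by linarith)
    refine (le_abs_self _).trans (h2.trans ?_)
    exact (mul_le_mul_of_nonneg_left hqf hΛpos.le).trans hρΛ
  have h3 : a x * d x ≤ a x * g' x + η := by
    have h4 := (abs_lt.1 (hk x hx)).2
    have h5 := mul_le_mul_of_nonneg_left (show d x ≤ g' x + η by linarith) (E.nonneg x)
    have h6 : a x * η ≤ 1 * η := by gcongr; exact E.le_one x
    linarith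
  have h7 : a x * g' x ≤ l - h x (f x) + η := hquot ε hε hlt0 x hx
  simp only [hη] at *
  linarith

/-- A test slope on an interval reaching back to a zero of `a` left of the origin is a strict
subfunction, hence lies below `f` at `0`. -/
lemma lt_of_isTestSlope (hf : IsMaxSlope a h l B f) (E : IsEnvironment α₀ α₁ γ κ a h) {c : ℝ}
    (hc : ∀ n : ℕ, ∃ (k : ℕ) (r : ℚ), c < r ∧
      IsTestSlope a h l n (TopologicalSpace.denseSeq C(ℝ, ℝ) k) r) : c < f 0 := by
  obtain ⟨z, hz0, hz⟩ := E.zeros_left 0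
  obtain ⟨n, hn⟩ := exists_nat_ge |z|
  obtain ⟨k, r, hcr, ht⟩ := hc n
  set d := TopologicalSpace.denseSeq C(ℝ, ℝ) k
  have hq : ∀ x, HasDerivAt (fun x => (r : ℝ) + ∫ y in (0 : ℝ)..x, d y) (d x) x := fun x =>
    (hasDerivAt_integral_of_continuous d.continuous 0 x).const_add _
  have hx : ∀ x ∈ Icc z 0, |x| ≤ n := fun x hx => by
    rw [abs_of_nonpos hz0] at hn
    rw [abs_le]; exact ⟨by linarith [hx.1], hx.2.trans (Nat.cast_nonneg n)⟩
  have := hf.lt_of_strict E hz (fun x _ => (hq x).continuousAt.continuousWithinAt)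
    (fun x hxI hx0 => by have := ht x (hx x hxI); rwa [hx0, zero_mul, zero_add] at this)
    (fun x hxI _ => ⟨d x, hq x, ht x (hx x hxI)⟩) 0 (right_mem_Icc.2 hz0)
  simp only [intervalIntegral.integral_same, add_zero] at this
  linarith

/-- Constants are admissible strict subfunctions; this yields the growth of `θ⁺`. -/
lemma lt_of_forall_h_lt (hf : IsMaxSlope a h l B f) (E : IsEnvironment α₀ α₁ γ κ a h) {p : ℝ}
    (hp : ∀ x, h x p < l) (x : ℝ) : p < f x := by
  obtain ⟨z, hzx, hz⟩ := E.zeros_left x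
  exact hf.lt_of_strict E hz (g := fun _ => p) continuousOn_const (fun y _ _ => hp y)
    (fun y _ _ => ⟨0, hasDerivAt_const _ _, by rw [mul_zero, zero_add]; exact hp y⟩) x
    (right_mem_Icc.2 hzx)

end IsMaxSlope

/-- Integrating once more produces the local supersolutions from which `exists_isMaxSlope` starts.
-/
lemma IsTestSlope.superOn {a : ℝ → ℝ} {h : ℝ → ℝ → ℝ} {l n r : ℝ} {d : C(ℝ, ℝ)}
    (ht : IsTestSlope a h l n d r) (ha : ∀ x, 0 ≤ a x) :
    SuperOn a h l (Ioo (-n) n) fun x => ∫ w in (0 : ℝ)..x, (r + ∫ y in (0 : ℝ)..w, d y) := by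
  have hq : ∀ x, HasDerivAt (fun x => r + ∫ y in (0 : ℝ)..x, d y) (d x) x := fun x =>
    (hasDerivAt_integral_of_continuous d.continuous 0 x).const_add _
  have hqc : Continuous fun x => r + ∫ y in (0 : ℝ)..x, d y :=
    continuous_iff_continuousAt.2 fun x => (hq x).continuousAt
  have hw := hasDerivAt_integral_of_continuous hqc 0
  refine ⟨continuous_iff_continuousAt.2 fun x => (hw x).continuousAt, fun φ x hx hφ hm => ?_⟩
  obtain ⟨h1, h2⟩ := deriv_deriv_le_of_isLocalMin hφ (Eventually.of_forall hw) (hq x) hm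
  rw [h1]
  have := ht x (abs_le.2 ⟨hx.1.le, hx.2.le⟩)
  have := mul_le_mul_of_nonneg_left h2 (ha x)
  linarith

namespace IsEnvironment

variable {α₀ α₁ γ κ : ℝ} {a : ℝ → ℝ} {h : ℝ → ℝ → ℝ}

/-- Countable description of the critical value. -/
lemma critical_lt_iff (E : IsEnvironment α₀ α₁ γ κ a h) {l₀ l : ℝ} (hc : IsCriticalValue a h l₀) :
    l₀ < l ↔ ∃ μ : ℚ, (μ : ℝ) < l ∧ ∀ n : ℕ, ∃ (k : ℕ) (r : ℚ),
      IsTestSlope a h μ n (TopologicalSpace.denseSeq C(ℝ, ℝ) k) r := by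
  constructor
  · intro hl
    obtain ⟨μ, hμ1, hμ2⟩ := exists_rat_btwn hl
    obtain ⟨m, hm1, hm2⟩ := exists_between hμ1
    refine ⟨μ, hμ2, fun n => ?_⟩
    have hf := E.isMaxSlope_maxSlope hc hm1
    obtain ⟨k, r, -, ht⟩ := hf.exists_isTestSlope E hm2 (sub_one_lt _) n
    exact ⟨k, r, ht⟩
  · rintro ⟨μ, hμ, ht⟩
    -- The test slopes for different `n` are unrelated, but `exists_isMaxSlope` needs supersolutions
    -- only on bounded intervals. It gives a global solution at every level `m > μ`, so `l₀ ≤ μ`.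
    refine lt_of_le_of_lt (le_of_forall_gt_imp_ge_of_dense fun m hm => ?_) hμ
    obtain ⟨f, hf, -⟩ := E.exists_isMaxSlope hm fun n => by
      obtain ⟨k, r, ht⟩ := ht n
      exact ⟨_, ht.superOn E.nonneg⟩
    exact hc.1 ⟨_, (hf.isLipschitzSolution E).supersolution⟩

lemma maxSlope_lt (E : IsEnvironment α₀ α₁ γ κ a h) {l₀ l l' : ℝ} (hc : IsCriticalValue a h l₀)
    (hl : l₀ < l) (hll : l < l') (x : ℝ) : maxSlope α₀ a h l x < maxSlope α₀ a h l' x :=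
  (E.isMaxSlope_maxSlope hc (hl.trans hll)).lt_of_level_lt E (E.isMaxSlope_maxSlope hc hl) hll x

/-- By monotonicity in the level, the one-sided limits exist at every point; `eq_of_tendsto`
identifies them with the slope at level `l`. -/
lemma continuousAt_maxSlope (E : IsEnvironment α₀ α₁ γ κ a h) {l₀ l : ℝ}
    (hc : IsCriticalValue a h l₀) (hl : l₀ < l) (x : ℝ) :
    ContinuousAt (fun l => maxSlope α₀ a h l x) l := by
  obtain ⟨l₁, hl₁, hl₁l⟩ := exists_between hl
  have key : ∀ L : ℕ → ℝ, Tendsto L atTop (𝓝 l) → (∀ n, l₁ < L n) → (∀ n, L n ≤ l + 1) →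
      (∀ x, ∃ y, Tendsto (fun n => maxSlope α₀ a h (L n) x) atTop (𝓝 y)) →
      Tendsto (fun n => maxSlope α₀ a h (L n) x) atTop (𝓝 (maxSlope α₀ a h l x)) := by
    intro L hL hL1 hL2 hlim
    choose g hg using hlim
    have hB : ∀ m ≤ l + 1, slopeBound α₀ m + 1 ≤ slopeBound α₀ (l + 1) + 1 := fun m hm => by
      linarith [slopeBound_mono E.α₀_pos hm]
    have := ((E.isMaxSlope_maxSlope hc hl).of_le (hB l (by linarith))).eq_of_tendsto E
      (fun n => (E.isMaxSlope_maxSlope hc (hl₁.trans (hL1 n))).of_le (hB _ (hL2 n))) hL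
      (E.isMaxSlope_maxSlope hc hl₁) hl₁l (by linarith [hB l₁ (by linarith)]) hL1 hg
    rw [← this]; exact hg x
  have hmono : ∀ x m m', l₀ < m → m ≤ m' → maxSlope α₀ a h m x ≤ maxSlope α₀ a h m' x :=
    fun x m m' hm hmm => by
      rcases hmm.eq_or_lt with rfl | hlt
      · rfl
      · exact (E.maxSlope_lt hc hm hlt x).le
  have hdec : Antitone fun n : ℕ => 1 / ((n : ℝ) + 1) := fun m n hmn => by
    simp only
    gcongr
  have hdec0 := tendsto_one_div_add_atTop_nhds_zero_nat (𝕜 := ℝ)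
  have hdec1 : ∀ n : ℕ, 0 < 1 / ((n : ℝ) + 1) := fun n => by positivity
  have hdec2 : ∀ n : ℕ, 1 / ((n : ℝ) + 1) ≤ 1 := fun n => by
    rw [div_le_one (by positivity)]; linarith [Nat.cast_nonneg (α := ℝ) n]
  -- The scaling by `ρ` keeps the increasing sequence of levels above `l₁`.
  set ρ := (l - l₁) / 2 with hρ
  have hρpos : 0 < ρ := by simp only [hρ]; linarith
  have hρ1 : ∀ n : ℕ, ρ * (1 / ((n : ℝ) + 1)) ≤ ρ := fun n =>
    mul_le_of_le_one_right hρpos.le (hdec2 n)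
  have hρ0 : ∀ n : ℕ, 0 < ρ * (1 / ((n : ℝ) + 1)) := fun n => mul_pos hρpos (hdec1 n)
  have hρ2 : ∀ n : ℕ, l₁ < l - ρ * (1 / ((n : ℝ) + 1)) := fun n => by
    have := hρ1 n
    simp only [hρ] at *; linarith
  have hR : Tendsto (fun n : ℕ => maxSlope α₀ a h (l + 1 / ((n : ℝ) + 1)) x) atTop
      (𝓝 (maxSlope α₀ a h l x)) := by
    refine key _ (by simpa using hdec0.const_add l) (fun n => by linarith [hdec1 n])
      (fun n => by linarith [hdec2 n]) fun y => ⟨_, tendsto_atTop_ciInf ?_ ?_⟩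
    · intro m n hmn
      exact hmono y _ _ (by linarith [hdec1 n]) (add_le_add_right (hdec hmn) l)
    · refine ⟨maxSlope α₀ a h l₁ y, ?_⟩
      rintro - ⟨n, rfl⟩
      exact hmono y _ _ hl₁ (by linarith [hdec1 n])
  have hL : Tendsto (fun n : ℕ => maxSlope α₀ a h (l - ρ * (1 / ((n : ℝ) + 1))) x) atTop
      (𝓝 (maxSlope α₀ a h l x)) := by
    refine key _ (by simpa using (hdec0.const_mul ρ).const_sub l) hρ2
      (fun n => by linarith [hρ0 n]) fun y => ⟨_, tendsto_atTop_ciSup ?_ ?_⟩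
    · intro m n hmn
      exact hmono y _ _ (hl₁.trans (hρ2 m))
        (sub_le_sub_left (mul_le_mul_of_nonneg_left (hdec hmn) hρpos.le) l)
    · refine ⟨maxSlope α₀ a h l y, ?_⟩
      rintro - ⟨n, rfl⟩
      exact hmono y _ _ (hl₁.trans (hρ2 n)) (by linarith [hρ0 n])
  refine tendsto_order.2 ⟨fun c hcl => ?_, fun c hcl => ?_⟩
  · obtain ⟨n, hn⟩ := ((tendsto_order.1 hL).1 c hcl).exists
    filter_upwards [lt_mem_nhds (show l - ρ * (1 / ((n : ℝ) + 1)) < l by linarith [hρ0 n])] with m hm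
    exact hn.trans_le (hmono x _ _ (hl₁.trans (hρ2 n)) hm.le)
  · obtain ⟨n, hn⟩ := ((tendsto_order.1 hR).2 c hcl).exists
    filter_upwards [gt_mem_nhds (show l < l + 1 / ((n : ℝ) + 1) by linarith [hdec1 n]),
      lt_mem_nhds hl] with m hm hm0
    exact (hmono x _ _ hm0 hm.le).trans_lt hn

/-- Countable description of the maximal slope at the origin. -/
lemma lt_maxSlope_iff (E : IsEnvironment α₀ α₁ γ κ a h) {l₀ l c : ℝ} (hc : IsCriticalValue a h l₀)
    (hl : l₀ < l) : c < maxSlope α₀ a h l 0 ↔ ∀ n : ℕ, ∃ (k : ℕ) (r : ℚ), c < r ∧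
      IsTestSlope a h l n (TopologicalSpace.denseSeq C(ℝ, ℝ) k) r := by
  refine ⟨fun hlt n => ?_, (E.isMaxSlope_maxSlope hc hl).lt_of_isTestSlope E⟩
  -- Continuity provides a lower level `m < l` with the slope still above `c`; the gap `l - m` is
  -- the room that a strict subfunction needs.
  have h1 := ((E.continuousAt_maxSlope hc hl 0).eventually (lt_mem_nhds hlt)).filter_mono
    (nhdsWithin_le_nhds (s := Iio l))
  obtain ⟨m, hm1, hm2, hm3⟩ := (h1.and (Ioo_mem_nhdsLT hl)).exists
  exact (E.isMaxSlope_maxSlope hc hm2).exists_isTestSlope E hm3 hm1 n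

end IsEnvironment

end

/-! ### Measurability in `ω`, and the properties of `θ⁺` -/

noncomputable section

section Measurability

variable {Ω : Type*} [MeasurableSpace Ω] {P : Measure Ω}

/-- Measurability of a strict bound for a random continuous function on a compact interval. -/
lemma nullMeasurableSet_forall_lt {ψ : ℝ → Ω → ℝ} (hψ : ∀ x, AEMeasurable (ψ x) P)
    (hcont : ∀ᵐ ω ∂P, Continuous fun x => ψ x ω) {s t : ℝ} (hst : s ≤ t) (l : ℝ) :
    NullMeasurableSet {ω | ∀ x ∈ Icc s t, ψ x ω < l} P := by
  -- By compactness a strict bound has a uniform gap `1 / (k + 1)`, and by continuity it suffices to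
  -- test it at the rationals projected onto `[s, t]`.
  have hm : NullMeasurableSet
      (⋃ k : ℕ, ⋂ y : ℚ, {ω | ψ (projIcc s t hst y) ω ≤ l - 1 / ((k : ℝ) + 1)}) P :=
    NullMeasurableSet.iUnion fun k => NullMeasurableSet.iInter fun y =>
      nullMeasurableSet_le (hψ _) aemeasurable_const
  refine hm.congr (eventuallyEq_set.2 ?_)
  filter_upwards [hcont] with ω hω
  refine ⟨fun hmem => ?_, fun hmem => ?_⟩
  · obtain ⟨k, hk⟩ := mem_iUnion.1 hmem
    have hk' : ∀ y : ℝ, ψ (projIcc s t hst y) ω ≤ l - 1 / ((k : ℝ) + 1) := fun y =>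
      Rat.denseRange_cast.induction_on (p := fun y : ℝ =>
        ψ (projIcc s t hst y) ω ≤ l - 1 / ((k : ℝ) + 1)) y
        (isClosed_le (hω.comp (continuous_subtype_val.comp continuous_projIcc)) continuous_const)
        fun y => mem_iInter.1 hk y
    intro x hx
    have h1 := hk' x
    rw [projIcc_of_mem hst hx] at h1
    have : 0 < 1 / ((k : ℝ) + 1) := by positivity
    exact h1.trans_lt (by linarith)
  · obtain ⟨z, hz, hmax⟩ := isCompact_Icc.exists_isMaxOn (nonempty_Icc.2 hst) hω.continuousOn
    have hlt : ψ z ω < l := hmem z hz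
    obtain ⟨k, hk⟩ := exists_nat_one_div_lt (sub_pos.2 hlt)
    refine mem_iUnion.2 ⟨k, mem_iInter.2 fun y => ?_⟩
    have : ψ (projIcc s t hst y) ω ≤ ψ z ω := hmax (projIcc s t hst y).2
    simp only [mem_ofPred_eq]
    linarith

variable {α₀ α₁ γ κ : ℝ} {a : ℝ → Ω → ℝ} {H : ℝ → ℝ → Ω → ℝ}

lemma nullMeasurableSet_isTestSlope (ha : ∀ x, AEMeasurable (a x) P)
    (hH : ∀ x p, AEMeasurable (H x p) P)
    (hE : ∀ᵐ ω ∂P, IsEnvironment α₀ α₁ γ κ (fun x => a x ω) fun x p => H x p ω)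
    (l : ℝ) (n : ℕ) (d : C(ℝ, ℝ)) (r : ℝ) :
    NullMeasurableSet {ω | IsTestSlope (fun x => a x ω) (fun x p => H x p ω) l n d r} P := by
  have hq : Continuous fun x => r + ∫ y in (0 : ℝ)..x, d y :=
    continuous_const.add (continuous_iff_continuousAt.2 fun x =>
      (hasDerivAt_integral_of_continuous d.continuous 0 x).continuousAt)
  have := nullMeasurableSet_forall_lt (P := P)
    (ψ := fun x ω => a x ω * d x + H x (r + ∫ y in (0 : ℝ)..x, d y) ω)
    (fun x => ((ha x).mul_const _).add (hH x _)) (by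
      filter_upwards [hE] with ω E
      exact (E.continuous_a.mul d.continuous).add (E.continuous_h.comp (continuous_id.prodMk hq)))
    (show -(n : ℝ) ≤ n by linarith [Nat.cast_nonneg (α := ℝ) n]) l
  convert this using 2
  ext ω
  simp only [IsTestSlope, abs_le, mem_Icc]

/-- The slope is produced by choice and so carries no measurability of its own; its superlevel sets
are expressed through countably many test slopes. -/
lemma aemeasurable_maxSlope (ha : ∀ x, AEMeasurable (a x) P)
    (hH : ∀ x p, AEMeasurable (H x p) P)
    (hE : ∀ᵐ ω ∂P, IsEnvironment α₀ α₁ γ κ (fun x => a x ω) fun x p => H x p ω) {l₀ l : ℝ}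
    (hc : ∀ᵐ ω ∂P, IsCriticalValue (fun x => a x ω) (fun x p => H x p ω) l₀) (hl : l₀ < l) :
    AEMeasurable (fun ω => maxSlope α₀ (fun x => a x ω) (fun x p => H x p ω) l 0) P := by
  refine NullMeasurable.aemeasurable fun s hs => ?_
  have key : Measurable fun ω : NullMeasurableSpace Ω P =>
      maxSlope α₀ (fun x => a x ω) (fun x p => H x p ω) l 0 := by
    refine measurable_of_Ioi fun c => ?_
    have hm : NullMeasurableSet (⋂ n : ℕ, ⋃ k : ℕ, ⋃ r : ℚ, {ω | c < (r : ℝ) ∧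
        IsTestSlope (fun x => a x ω) (fun x p => H x p ω) l n
          (TopologicalSpace.denseSeq C(ℝ, ℝ) k) r}) P :=
      .iInter fun n => .iUnion fun k => .iUnion fun r =>
        (NullMeasurableSet.const _).inter (nullMeasurableSet_isTestSlope ha hH hE l n _ r)
    refine hm.congr (eventuallyEq_set.2 ?_)
    filter_upwards [hE, hc] with ω E hcω
    have := E.lt_maxSlope_iff hcω hl (c := c)
    simp only [mem_iInter, mem_iUnion, mem_ofPred_eq]
    exact this.symm
  exact key hs

lemma aemeasurable_criticalValue (ha : ∀ x, AEMeasurable (a x) P)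
    (hH : ∀ x p, AEMeasurable (H x p) P)
    (hE : ∀ᵐ ω ∂P, IsEnvironment α₀ α₁ γ κ (fun x => a x ω) fun x p => H x p ω) :
    AEMeasurable (fun ω => sInf {l : ℝ | ∃ u : ℝ → ℝ,
      IsViscositySupersolution (fun x => a x ω) (fun x p => H x p ω) l u}) P := by
  refine NullMeasurable.aemeasurable fun s hs => ?_
  have key : Measurable fun ω : NullMeasurableSpace Ω P => sInf {l : ℝ | ∃ u : ℝ → ℝ,
      IsViscositySupersolution (fun x => a x ω) (fun x p => H x p ω) l u} := by
    refine measurable_of_Iio fun l => ?_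
    have hm : NullMeasurableSet (⋃ μ : ℚ, {ω | (μ : ℝ) < l} ∩ ⋂ n : ℕ, ⋃ k : ℕ, ⋃ r : ℚ,
        {ω | IsTestSlope (fun x => a x ω) (fun x p => H x p ω) μ n
          (TopologicalSpace.denseSeq C(ℝ, ℝ) k) r}) P :=
      .iUnion fun μ => (NullMeasurableSet.const _).inter (.iInter fun n => .iUnion fun k =>
        .iUnion fun r => nullMeasurableSet_isTestSlope ha hH hE μ n _ r)
    refine hm.congr (eventuallyEq_set.2 ?_)
    filter_upwards [hE] with ω E
    have := E.critical_lt_iff E.exists_isCriticalValue (l := l)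
    simp only [mem_iInter, mem_iUnion, mem_ofPred_eq, mem_inter_iff]
    exact this.symm
  exact key hs

end Measurability

/-- A strictly increasing continuous function on `(l₀, ∞)`, extended by its infimum. -/
lemma extension_by_inf {θ : ℝ → ℝ} {l₀ : ℝ} (hmono : ∀ l l', l₀ < l → l < l' → θ l < θ l')
    (hcont : ∀ l, l₀ < l → ContinuousAt θ l) (hbdd : BddBelow (θ '' Ioi l₀))
    (h₀ : θ l₀ = sInf (θ '' Ioi l₀)) :
    IsGLB (θ '' Ioi l₀) (θ l₀) ∧ ContinuousOn θ (Ici l₀) ∧ StrictMonoOn θ (Ici l₀) ∧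
      MapsTo θ (Ioi l₀) (Ioi (θ l₀)) := by
  have hne : (θ '' Ioi l₀).Nonempty := ⟨_, mem_image_of_mem θ (mem_Ioi.2 (lt_add_one l₀))⟩
  have hglb : IsGLB (θ '' Ioi l₀) (θ l₀) := h₀ ▸ isGLB_csInf hne hbdd
  have hlt : ∀ l, l₀ < l → θ l₀ < θ l := fun l hl => by
    obtain ⟨m, hm1, hm2⟩ := exists_between hl
    exact (hglb.1 (mem_image_of_mem θ hm1)).trans_lt (hmono m l hm1 hm2)
  refine ⟨hglb, fun l hl => ?_, fun l hl l' hl' hll => ?_, fun l hl => hlt l hl⟩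
  · rcases (mem_Ici.1 hl).eq_or_lt with rfl | hl
    · refine tendsto_order.2 ⟨fun c hc => ?_, fun c hc => ?_⟩
      · filter_upwards [self_mem_nhdsWithin] with m hm
        rcases (mem_Ici.1 hm).eq_or_lt with rfl | hm
        · exact hc
        · exact hc.trans (hlt m hm)
      · obtain ⟨-, ⟨m, hm, rfl⟩, -, hmc⟩ := hglb.exists_between hc
        filter_upwards [self_mem_nhdsWithin, mem_nhdsWithin_of_mem_nhds (gt_mem_nhds hm)] with w hw1 hw2
        rcases (mem_Ici.1 hw1).eq_or_lt with rfl | hw1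
        · exact hc
        · exact (hmono w m hw1 hw2).trans hmc
    · exact (hcont l hl).continuousWithinAt
  · rcases (mem_Ici.1 hl).eq_or_lt with rfl | hl
    · exact hlt l' hll
    · exact hmono l l' hl hll

section Upper

variable {Ω : Type*} [MeasurableSpace Ω] {P : Measure Ω} {α₀ α₁ γ κ : ℝ} {a : ℝ → Ω → ℝ} {H : ℝ → ℝ → Ω → ℝ} {l₀ : ℝ} {v : Ω → ℝ → ℝ}

/-- One exceptional null set serves all levels, since the deterministic theory applies to each good
realization. The slope is independent of `v`, so no measurability of `v` is needed. -/
lemma ae_upperCorrector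
    (hE : ∀ᵐ ω ∂P, IsEnvironment α₀ α₁ γ κ (fun x => a x ω) fun x p => H x p ω)
    (hc : ∀ᵐ ω ∂P, IsCriticalValue (fun x => a x ω) (fun x p => H x p ω) l₀)
    (hv : ∀ᵐ ω ∂P, IsLipschitzSolution (fun x => a x ω) (fun x p => H x p ω) l₀ (v ω)) :
    ∀ᵐ ω ∂P, ∀ l : ℝ, l₀ < l →
      (∃! u : ℝ → ℝ, IsUpperCorrector (fun x => a x ω) (fun x p => H x p ω) (v ω) l u) ∧
      ContDiff ℝ 1 (upperCorrector (fun x => a x ω) (fun x p => H x p ω) (v ω) l) ∧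
      upperSlope a H v l ω = maxSlope α₀ (fun x => a x ω) (fun x p => H x p ω) l 0 := by
  filter_upwards [hE, hc, hv] with ω E hcω hvω l hl
  have hf := E.isMaxSlope_maxSlope hcω hl
  refine ⟨⟨_, (E.isUpperCorrector_iff hcω hl hvω).2 rfl,
    fun u hu => (E.isUpperCorrector_iff hcω hl hvω).1 hu⟩, ?_, ?_⟩
  · rw [E.upperCorrector_eq hcω hl hvω]; exact hf.contDiff
  · rw [upperSlope, E.upperCorrector_eq hcω hl hvω, hf.deriv_integral]

lemma integrable_upperSlope [IsFiniteMeasure P] (ha : ∀ x, AEMeasurable (a x) P) (hH : ∀ x p, AEMeasurable (H x p) P)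
    (hE : ∀ᵐ ω ∂P, IsEnvironment α₀ α₁ γ κ (fun x => a x ω) fun x p => H x p ω)
    (hc : ∀ᵐ ω ∂P, IsCriticalValue (fun x => a x ω) (fun x p => H x p ω) l₀)
    (hv : ∀ᵐ ω ∂P, IsLipschitzSolution (fun x => a x ω) (fun x p => H x p ω) l₀ (v ω))
    {l : ℝ} (hl : l₀ < l) : Integrable (upperSlope a H v l) P := by
  have heq : (fun ω => maxSlope α₀ (fun x => a x ω) (fun x p => H x p ω) l 0)
      =ᵐ[P] upperSlope a H v l := by
    filter_upwards [ae_upperCorrector hE hc hv] with ω hω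
    exact (hω l hl).2.2.symm
  refine Integrable.congr ?_ heq
  refine Integrable.of_bound (aemeasurable_maxSlope ha hH hE hc hl).aestronglyMeasurable
    (slopeBound α₀ l + 1) ?_
  filter_upwards [hE, hc] with ω E hcω
  exact (E.isMaxSlope_maxSlope hcω hl).bound 0

/-- Each property is inherited pointwise from the maximal slope: strict monotonicity in the level,
continuity under a bound uniform for nearby levels, and domination of constants for divergence. -/
lemma thetaPlus_properties [IsProbabilityMeasure P] (ha : ∀ x, AEMeasurable (a x) P) (hH : ∀ x p, AEMeasurable (H x p) P)
    (hE : ∀ᵐ ω ∂P, IsEnvironment α₀ α₁ γ κ (fun x => a x ω) fun x p => H x p ω)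
    (hc : ∀ᵐ ω ∂P, IsCriticalValue (fun x => a x ω) (fun x p => H x p ω) l₀)
    (hv : ∀ᵐ ω ∂P, IsLipschitzSolution (fun x => a x ω) (fun x p => H x p ω) l₀ (v ω)) :
    IsGLB (thetaPlus P a H v l₀ '' Ioi l₀) (thetaPlus P a H v l₀ l₀) ∧
      ContinuousOn (thetaPlus P a H v l₀) (Ici l₀) ∧
      Tendsto (thetaPlus P a H v l₀) atTop atTop ∧
      StrictMonoOn (thetaPlus P a H v l₀) (Ici l₀) ∧
      MapsTo (thetaPlus P a H v l₀) (Ioi l₀) (Ioi (thetaPlus P a H v l₀ l₀)) := by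
  set F : ℝ → Ω → ℝ := fun l ω => maxSlope α₀ (fun x => a x ω) (fun x p => H x p ω) l 0 with hF
  set θ := thetaPlus P a H v l₀ with hθ
  have hint : ∀ l, l₀ < l → Integrable (upperSlope a H v l) P := fun l hl =>
    integrable_upperSlope ha hH hE hc hv hl
  have heq : ∀ᵐ ω ∂P, ∀ l, l₀ < l → upperSlope a H v l ω = F l ω := by
    filter_upwards [ae_upperCorrector hE hc hv] with ω hω l hl
    exact (hω l hl).2.2
  have hval : ∀ l, l₀ < l → θ l = ∫ ω, upperSlope a H v l ω ∂P := fun l hl => if_pos hl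
  obtain ⟨ω₀, E₀⟩ := hE.exists
  have hα₀ := E₀.α₀_pos
  have hbound : ∀ l, l₀ < l → ∀ᵐ ω ∂P, |upperSlope a H v l ω| ≤ slopeBound α₀ l + 1 := by
    intro l hl
    filter_upwards [hE, hc, heq] with ω E hcω he
    rw [he l hl]
    exact (E.isMaxSlope_maxSlope hcω hl).bound 0
  have hmono : ∀ l l', l₀ < l → l < l' → θ l < θ l' := by
    intro l l' hl hll
    have hl' := hl.trans hll
    rw [hval l hl, hval l' hl', ← sub_pos, ← integral_sub (hint l' hl') (hint l hl)]
    have hlt : ∀ᵐ ω ∂P, 0 < upperSlope a H v l' ω - upperSlope a H v l ω := by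
      filter_upwards [hE, hc, heq] with ω E hcω he
      rw [he l hl, he l' hl']
      exact sub_pos.2 (E.maxSlope_lt hcω hl hll 0)
    rw [integral_pos_iff_support_of_nonneg_ae (hlt.mono fun _ h => h.le)
      ((hint l' hl').sub (hint l hl))]
    have : Function.support (fun ω => upperSlope a H v l' ω - upperSlope a H v l ω) =ᵐ[P] univ :=
      eventuallyEq_univ.2 (hlt.mono fun _ h => h.ne')
    rw [measure_congr this, measure_univ]
    exact one_pos
  have hcont : ∀ l, l₀ < l → ContinuousAt θ l := by
    intro l hl
    have h1 : ContinuousAt (fun l => ∫ ω, upperSlope a H v l ω ∂P) l := by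
      refine continuousAt_of_dominated (bound := fun _ => slopeBound α₀ (l + 1) + 1) ?_ ?_
        (integrable_const _) ?_
      · filter_upwards [lt_mem_nhds hl] with m hm
        exact (hint m hm).aestronglyMeasurable
      · filter_upwards [lt_mem_nhds hl, gt_mem_nhds (lt_add_one l)] with m hm hm'
        filter_upwards [hbound m hm] with ω hω
        exact hω.trans (by linarith [slopeBound_mono hα₀ hm'.le])
      · filter_upwards [hE, hc, heq] with ω E hcω he
        refine (E.continuousAt_maxSlope hcω hl 0).congr ?_
        filter_upwards [lt_mem_nhds hl] with m hm
        exact (he m hm).symm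
    refine h1.congr ?_
    filter_upwards [lt_mem_nhds hl] with m hm
    exact (hval m hm).symm
  have hbdd : BddBelow (θ '' Ioi l₀) := by
    refine ⟨-(slopeBound α₀ (l₀ + 1) + 1), ?_⟩
    rintro - ⟨l, hl, rfl⟩
    -- The slope bound is uniform for levels up to `l₀ + 1`; larger levels are covered by
    -- monotonicity.
    have hsmall : ∀ m, l₀ < m → m ≤ l₀ + 1 → -(slopeBound α₀ (l₀ + 1) + 1) ≤ θ m := by
      intro m hm hm1
      rw [hval m hm]
      have := integral_mono_ae (integrable_const (-(slopeBound α₀ (l₀ + 1) + 1))) (hint m hm) (by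
        filter_upwards [hbound m hm] with ω hω
        linarith [(abs_le.1 hω).1, slopeBound_mono hα₀ hm1])
      simpa using this
    rcases le_or_gt l (l₀ + 1) with h1 | h1
    · exact hsmall l hl h1
    · exact (hsmall (l₀ + 1) (lt_add_one _) le_rfl).trans (hmono _ _ (lt_add_one _) h1).le
  have h₀ : θ l₀ = sInf (θ '' Ioi l₀) := by
    rw [image_congr (g := fun m => ∫ ω, upperSlope a H v m ω ∂P) (fun m hm => hval m hm : ∀ m ∈ Ioi l₀, _)]
    exact if_neg (lt_irrefl _)
  obtain ⟨c1, c2, c3, c4⟩ := extension_by_inf hmono hcont hbdd h₀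
  refine ⟨c1, c2, tendsto_atTop.2 fun p => ?_, c3, c4⟩
  -- Beyond this level `h(·, p) < l` everywhere, for every good realization, so the slope at the
  -- origin exceeds `p`.
  filter_upwards [eventually_gt_atTop l₀, eventually_gt_atTop (α₁ * (|p| ^ γ + 1))] with l hl hlp
  rw [hval l hl]
  have := integral_mono_ae (integrable_const p) (hint l hl) (by
    filter_upwards [hE, hc, heq] with ω E hcω he
    rw [he l hl]
    exact ((E.isMaxSlope_maxSlope hcω hl).lt_of_forall_h_lt E
      (fun x => (E.ham.upper x p).trans_lt hlp) 0).le)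
  simpa using this

end Upper

end

/-! ### Reflection `x ↦ -x`, and the lower correctors -/

noncomputable section

section Reflection

variable {α₀ α₁ γ κ : ℝ} {a : ℝ → ℝ} {h : ℝ → ℝ → ℝ} {l l₀ : ℝ} {u v : ℝ → ℝ}

lemma deriv_deriv_comp_neg (φ : ℝ → ℝ) (x : ℝ) :
    deriv (deriv fun x => φ (-x)) x = deriv (deriv φ) (-x) := by
  have h1 : (deriv fun x => φ (-x)) = fun x => -deriv φ (-x) := funext fun x => deriv_comp_neg φ x
  rw [h1, deriv.fun_neg, deriv_comp_neg, neg_neg]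

lemma IsViscositySupersolution.reflect (hu : IsViscositySupersolution a h l u) :
    IsViscositySupersolution (fun x => a (-x)) (fun x p => h (-x) (-p)) l fun x => u (-x) := by
  refine ⟨hu.1.comp continuous_neg, fun φ x hφ hm => ?_⟩
  have h1 := hu.2 (fun x => φ (-x)) (-x) (hφ.comp contDiff_neg) (by
    have h2 : Tendsto (fun y : ℝ => -y) (𝓝 (-x)) (𝓝 x) := by
      simpa using (continuous_neg (G := ℝ)).tendsto (-x)
    filter_upwards [h2.eventually hm] with y hy
    simpa using hy)
  rw [deriv_deriv_comp_neg, deriv_comp_neg] at h1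
  simpa using h1

lemma IsViscositySubsolution.reflect (hu : IsViscositySubsolution a h l u) :
    IsViscositySubsolution (fun x => a (-x)) (fun x p => h (-x) (-p)) l fun x => u (-x) := by
  refine ⟨hu.1.comp continuous_neg, fun φ x hφ hm => ?_⟩
  have h1 := hu.2 (fun x => φ (-x)) (-x) (hφ.comp contDiff_neg) (by
    have h2 : Tendsto (fun y : ℝ => -y) (𝓝 (-x)) (𝓝 x) := by
      simpa using (continuous_neg (G := ℝ)).tendsto (-x)
    filter_upwards [h2.eventually hm] with y hy
    simpa using hy)
  rw [deriv_deriv_comp_neg, deriv_comp_neg] at h1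
  simpa using h1

lemma IsLipschitzSolution.reflect (hu : IsLipschitzSolution a h l u) :
    IsLipschitzSolution (fun x => a (-x)) (fun x p => h (-x) (-p)) l fun x => u (-x) := by
  obtain ⟨K, hK⟩ := hu.lipschitz
  refine ⟨hu.supersolution.reflect, hu.subsolution.reflect, ⟨K, ?_⟩, by simpa using hu.at_zero⟩
  exact LipschitzWith.of_dist_le_mul fun x y => by simpa using hK.dist_le_mul (-x) (-y)

lemma isLipschitzSolution_reflect_iff :
    IsLipschitzSolution (fun x => a (-x)) (fun x p => h (-x) (-p)) l (fun x => u (-x)) ↔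
      IsLipschitzSolution a h l u :=
  ⟨fun hu => by simpa using hu.reflect, fun hu => hu.reflect⟩

lemma IsCriticalValue.reflect (hc : IsCriticalValue a h l₀) :
    IsCriticalValue (fun x => a (-x)) (fun x p => h (-x) (-p)) l₀ := by
  unfold IsCriticalValue at *
  convert hc using 1
  ext l
  constructor
  · rintro ⟨u, hu⟩
    exact ⟨fun x => u (-x), by simpa using hu.reflect⟩
  · rintro ⟨u, hu⟩
    exact ⟨_, hu.reflect⟩

/-- The assumptions are symmetric under `(x, p) ↦ (-x, -p)`; the zeros of `a` on the two sides
change roles. -/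
lemma IsEnvironment.reflect (E : IsEnvironment α₀ α₁ γ κ a h) :
    IsEnvironment α₀ α₁ γ κ (fun x => a (-x)) fun x p => h (-x) (-p) where
  α₀_pos := E.α₀_pos
  α₁_pos := E.α₁_pos
  two_lt := E.two_lt
  κ_pos := E.κ_pos
  mem_Icc x := E.mem_Icc (-x)
  sqrt_lip x y := by simpa [abs_sub_comm, neg_add_eq_sub] using E.sqrt_lip (-x) (-y)
  ham :=
    { lower := fun x p => by simpa using E.ham.lower (-x) (-p)
      upper := fun x p => by simpa using E.ham.upper (-x) (-p)
      lip_p := fun x p q => by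
        simpa [abs_sub_comm, neg_add_eq_sub] using E.ham.lip_p (-x) (-p) (-q)
      lip_x := fun x y p => by
        simpa [abs_sub_comm, neg_add_eq_sub] using E.ham.lip_x (-x) (-y) (-p) }
  quasiconvex x p₀ p₁ s hp h0 h1 := by
    have := E.quasiconvex (-x) (-p₀) (-p₁) s (by simpa using hp) h0 h1
    convert this using 2
    ring
  zeros_left x := by
    obtain ⟨z, hz, h0⟩ := E.zeros_right (-x)
    exact ⟨-z, by linarith, by simpa using h0⟩
  zeros_right x := by
    obtain ⟨z, hz, h0⟩ := E.zeros_left (-x)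
    exact ⟨-z, by linarith, by simpa using h0⟩

lemma isUpperCorrector_reflect_iff :
    IsUpperCorrector (fun x => a (-x)) (fun x p => h (-x) (-p)) (fun x => v (-x)) l
      (fun x => u (-x)) ↔ IsLowerCorrector a h v l u := by
  have key : (∀ᵐ x : ℝ, deriv (fun x => v (-x)) x ≤ deriv (fun x => u (-x)) x) ↔
      ∀ᵐ x : ℝ, deriv u x ≤ deriv v x := by
    have hq := (Measure.measurePreserving_neg (volume : Measure ℝ)).quasiMeasurePreserving
    simp only [deriv_comp_neg, neg_le_neg_iff]
    exact ⟨fun hx => by simpa using hq.ae hx, fun hx => hq.ae hx⟩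
  rw [IsUpperCorrector, IsLowerCorrector, isLipschitzSolution_reflect_iff, key]

lemma isLowerCorrector_reflect (w : ℝ → ℝ) :
    IsLowerCorrector a h v l (fun x => w (-x)) ↔
      IsUpperCorrector (fun x => a (-x)) (fun x p => h (-x) (-p)) (fun x => v (-x)) l w := by
  rw [← isUpperCorrector_reflect_iff]; simp

/-- The lower corrector is the reflection of the upper corrector of the reflected equation. -/
lemma lowerCorrector_eq_reflect
    (hu : ∃! w, IsUpperCorrector (fun x => a (-x)) (fun x p => h (-x) (-p)) (fun x => v (-x)) l w) :
    (∃! u, IsLowerCorrector a h v l u) ∧ lowerCorrector a h v l = fun x =>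
      upperCorrector (fun x => a (-x)) (fun x p => h (-x) (-p)) (fun x => v (-x)) l (-x) := by
  obtain ⟨w, hw, huniq⟩ := hu
  have hlow : ∀ u, IsLowerCorrector a h v l u → u = fun x => w (-x) := fun u hu => by
    have := huniq _ (isUpperCorrector_reflect_iff.2 hu)
    ext x
    simpa using congrFun this (-x)
  have hex : IsLowerCorrector a h v l fun x => w (-x) := (isLowerCorrector_reflect w).2 hw
  refine ⟨⟨_, hex, hlow⟩, ?_⟩
  rw [show upperCorrector (fun x => a (-x)) (fun x p => h (-x) (-p)) (fun x => v (-x)) l = w from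
    huniq _ (Classical.epsilon_spec ⟨w, hw⟩)]
  exact hlow _ (Classical.epsilon_spec ⟨_, hex⟩)

end Reflection

section Lower

variable {Ω : Type*} [MeasurableSpace Ω] {P : Measure Ω} {α₀ α₁ γ κ : ℝ} {a : ℝ → Ω → ℝ}
  {H : ℝ → ℝ → Ω → ℝ} {l₀ : ℝ} {v : Ω → ℝ → ℝ}

/-- The upper theory uses only almost sure properties of the coefficients and no flow, so it applies
to the reflected ones as they stand. -/
lemma ae_lowerCorrector
    (hE : ∀ᵐ ω ∂P, IsEnvironment α₀ α₁ γ κ (fun x => a x ω) fun x p => H x p ω)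
    (hc : ∀ᵐ ω ∂P, IsCriticalValue (fun x => a x ω) (fun x p => H x p ω) l₀)
    (hv : ∀ᵐ ω ∂P, IsLipschitzSolution (fun x => a x ω) (fun x p => H x p ω) l₀ (v ω)) :
    ∀ᵐ ω ∂P, ∀ l : ℝ, l₀ < l →
      (∃! u : ℝ → ℝ, IsLowerCorrector (fun x => a x ω) (fun x p => H x p ω) (v ω) l u) ∧
      ContDiff ℝ 1 (lowerCorrector (fun x => a x ω) (fun x p => H x p ω) (v ω) l) ∧
      lowerSlope a H v l ω =
        -upperSlope (fun x => a (-x)) (fun x p => H (-x) (-p)) (fun ω x => v ω (-x)) l ω := by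
  have := ae_upperCorrector (P := P) (α₀ := α₀) (α₁ := α₁) (γ := γ) (κ := κ)
    (a := fun x => a (-x)) (H := fun x p => H (-x) (-p)) (v := fun ω x => v ω (-x)) (l₀ := l₀)
    (hE.mono fun _ E => E.reflect) (hc.mono fun _ h => h.reflect) (hv.mono fun _ h => h.reflect)
  filter_upwards [this] with ω hω l hl
  obtain ⟨h1, h2, -⟩ := hω l hl
  obtain ⟨h3, h4⟩ := lowerCorrector_eq_reflect (a := fun x => a x ω)
    (h := fun x p => H x p ω) (v := v ω) h1
  refine ⟨h3, ?_, ?_⟩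
  · rw [h4]; exact h2.comp contDiff_neg
  · rw [lowerSlope, h4, deriv_comp_neg, neg_zero, upperSlope]

variable [IsProbabilityMeasure P]

lemma integrable_lowerSlope (ha : ∀ x, AEMeasurable (a x) P) (hH : ∀ x p, AEMeasurable (H x p) P)
    (hE : ∀ᵐ ω ∂P, IsEnvironment α₀ α₁ γ κ (fun x => a x ω) fun x p => H x p ω)
    (hc : ∀ᵐ ω ∂P, IsCriticalValue (fun x => a x ω) (fun x p => H x p ω) l₀)
    (hv : ∀ᵐ ω ∂P, IsLipschitzSolution (fun x => a x ω) (fun x p => H x p ω) l₀ (v ω))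
    {l : ℝ} (hl : l₀ < l) : Integrable (lowerSlope a H v l) P := by
  have := (integrable_upperSlope (P := P) (α₀ := α₀) (α₁ := α₁) (γ := γ) (κ := κ)
    (a := fun x => a (-x)) (H := fun x p => H (-x) (-p)) (v := fun ω x => v ω (-x)) (l₀ := l₀)
    (fun x => ha (-x)) (fun x p => hH (-x) (-p)) (hE.mono fun _ E => E.reflect)
    (hc.mono fun _ h => h.reflect) (hv.mono fun _ h => h.reflect) hl).neg
  refine this.congr ?_
  filter_upwards [ae_lowerCorrector hE hc hv] with ω hω
  exact (hω l hl).2.2.symm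

lemma thetaMinus_properties (ha : ∀ x, AEMeasurable (a x) P) (hH : ∀ x p, AEMeasurable (H x p) P)
    (hE : ∀ᵐ ω ∂P, IsEnvironment α₀ α₁ γ κ (fun x => a x ω) fun x p => H x p ω)
    (hc : ∀ᵐ ω ∂P, IsCriticalValue (fun x => a x ω) (fun x p => H x p ω) l₀)
    (hv : ∀ᵐ ω ∂P, IsLipschitzSolution (fun x => a x ω) (fun x p => H x p ω) l₀ (v ω)) :
    IsLUB (thetaMinus P a H v l₀ '' Ioi l₀) (thetaMinus P a H v l₀ l₀) ∧
      ContinuousOn (thetaMinus P a H v l₀) (Ici l₀) ∧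
      Tendsto (thetaMinus P a H v l₀) atTop atBot ∧
      StrictAntiOn (thetaMinus P a H v l₀) (Ici l₀) ∧
      MapsTo (thetaMinus P a H v l₀) (Ioi l₀) (Iio (thetaMinus P a H v l₀ l₀)) := by
  obtain ⟨h1, h2, h3, h4, h5⟩ := thetaPlus_properties (P := P) (α₀ := α₀) (α₁ := α₁) (γ := γ)
    (κ := κ) (a := fun x => a (-x)) (H := fun x p => H (-x) (-p)) (v := fun ω x => v ω (-x))
    (l₀ := l₀) (fun x => ha (-x)) (fun x p => hH (-x) (-p)) (hE.mono fun _ E => E.reflect)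
    (hc.mono fun _ h => h.reflect) (hv.mono fun _ h => h.reflect)
  set θ := thetaPlus P (fun x => a (-x)) (fun x p => H (-x) (-p)) (fun ω x => v ω (-x)) l₀ with hθ
  have hint : ∀ m, l₀ < m → ∫ ω, lowerSlope a H v m ω ∂P = -∫ ω, upperSlope (fun x => a (-x))
      (fun x p => H (-x) (-p)) (fun ω x => v ω (-x)) m ω ∂P := fun m hm => by
    rw [← integral_neg]
    refine integral_congr_ae ?_
    filter_upwards [ae_lowerCorrector hE hc hv] with ω hω
    exact (hω m hm).2.2
  have heq : thetaMinus P a H v l₀ = fun l => -θ l := by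
    ext l
    simp only [thetaMinus, hθ, thetaPlus]
    split_ifs with hl
    · exact hint l hl
    -- The infimum of a set of reals is minus the supremum of the negated set, so the two boundary
    -- values also correspond.
    · rw [Real.sInf_def, neg_neg, ← image_neg_eq_neg, image_image]
      exact congrArg sSup (image_congr fun m hm => hint m hm)
  rw [heq]
  refine ⟨?_, h2.neg, tendsto_neg_atTop_atBot.comp h3, fun x hx y hy hxy => neg_lt_neg (h4 hx hy hxy),
    fun x hx => mem_Iio.2 (neg_lt_neg (h5 hx))⟩
  have : (fun l => -θ l) '' Ioi l₀ = -(θ '' Ioi l₀) := by rw [← image_neg_eq_neg, image_image]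
  rw [this]
  exact isLUB_neg.2 (by simpa using h1)

end Lower

/-! ### Consequences of stationarity and ergodicity -/

section Flow

lemma IsViscositySupersolution.translate {a : ℝ → ℝ} {h : ℝ → ℝ → ℝ} {l : ℝ} {u : ℝ → ℝ}
    (hu : IsViscositySupersolution a h l u) (y : ℝ) :
    IsViscositySupersolution (fun x => a (x + y)) (fun x p => h (x + y) p) l fun x => u (x + y) := by
  refine ⟨hu.1.comp (continuous_add_const y), fun φ x hφ hm => ?_⟩
  have h1 := hu.2 (fun x => φ (x - y)) (x + y) (hφ.comp (contDiff_id.sub contDiff_const)) (by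
    have h2 : Tendsto (fun w : ℝ => w - y) (𝓝 (x + y)) (𝓝 x) := by
      simpa using (tendsto_id (x := 𝓝 (x + y))).sub_const y
    filter_upwards [h2.eventually hm] with w hw
    simpa using hw)
  have h3 : (deriv fun x => φ (x - y)) = fun x => deriv φ (x - y) :=
    funext fun x => deriv_comp_sub_const φ y x
  rw [h3, deriv_comp_sub_const] at h1
  simpa using h1

namespace IsErgodicFlow

variable {Ω : Type*} [MeasurableSpace Ω] {P : Measure Ω} {τ : ℝ → Ω → Ω}

lemma neg_apply (hτ : IsErgodicFlow P τ) (x : ℝ) (ω : Ω) : τ (-x) (τ x ω) = ω := by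
  rw [← hτ.add, neg_add_cancel, hτ.zero]

lemma apply_neg (hτ : IsErgodicFlow P τ) (x : ℝ) (ω : Ω) : τ x (τ (-x) ω) = ω := by
  rw [← hτ.add, add_neg_cancel, hτ.zero]

/-- Measurable hulls extend the invariance to the outer measure of arbitrary sets, so neither
measurability of `S` nor Borel measurability of `τ x` is needed. -/
lemma measure_preimage (hτ : IsErgodicFlow P τ) (x : ℝ) (S : Set Ω) : P (τ x ⁻¹' S) = P S := by
  have key : ∀ (x : ℝ) (S : Set Ω), P (τ x ⁻¹' S) ≤ P S := fun x S => by
    rw [← measure_toMeasurable S, ← hτ.invariant (-x) _ (measurableSet_toMeasurable P S)]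
    exact measure_mono fun ω hω => ⟨τ x ω, subset_toMeasurable P S hω, hτ.neg_apply x ω⟩
  refine le_antisymm (key x S) ?_
  have h1 : τ (-x) ⁻¹' (τ x ⁻¹' S) = S := by
    ext ω
    rw [mem_preimage, mem_preimage, hτ.apply_neg]
  have h2 := key (-x) (τ x ⁻¹' S)
  rwa [h1] at h2

lemma ae_comp (hτ : IsErgodicFlow P τ) (x : ℝ) {p : Ω → Prop} (hp : ∀ᵐ ω ∂P, p ω) :
    ∀ᵐ ω ∂P, p (τ x ω) := by
  rw [ae_iff] at *
  rw [← hp]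
  exact hτ.measure_preimage x {ω | ¬p ω}

/-- An almost everywhere measurable, exactly invariant function is almost surely constant. -/
lemma exists_ae_eq_const (hτ : IsErgodicFlow P τ) {φ : Ω → ℝ} (hφ : AEMeasurable φ P)
    (hinv : ∀ x ω, φ (τ x ω) = φ ω) : ∃ c, ∀ᵐ ω ∂P, φ ω = c := by
  obtain ⟨c, hc⟩ := hτ.ergodic (hφ.mk φ) hφ.measurable_mk fun x => by
    filter_upwards [hφ.ae_eq_mk, hτ.ae_comp x hφ.ae_eq_mk] with ω h1 h2
    rw [← h1, ← h2, hinv]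
  exact ⟨c, by filter_upwards [hφ.ae_eq_mk, hc] with ω h1 h2; rw [h1, h2]⟩

end IsErgodicFlow

/-- A stationary nonnegative process which almost surely has a zero has arbitrarily large zeros. -/
lemma ae_exists_zero_ge {Ω : Type*} [MeasurableSpace Ω] {P : Measure Ω} [IsProbabilityMeasure P]
    {b : ℝ → Ω → ℝ} (hb : ∀ x, AEMeasurable (b x) P) (hcont : ∀ ω, Continuous fun x => b x ω)
    (hnn : ∀ x ω, 0 ≤ b x ω) (hzero : ∀ᵐ ω ∂P, ∃ z, b z ω = 0)
    (hinv : ∀ r, P {ω | ∀ z ≥ r, b z ω ≠ 0} = P {ω | ∀ z ≥ 0, b z ω ≠ 0}) :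
    ∀ᵐ ω ∂P, ∀ x, ∃ z ≥ x, b z ω = 0 := by
  let S : ℝ → Set Ω := fun r => {ω | ∀ z ≥ r, b z ω ≠ 0}
  have hS : ∀ r, NullMeasurableSet (S r) P := fun r => by
    have h1 : S r = ⋂ m : ℕ, {ω | ∀ x ∈ Icc r (r + m), -b x ω < 0} := by
      ext ω
      simp only [S, mem_ofPred_eq, mem_iInter, neg_lt_zero]
      refine ⟨fun h m x hx => lt_of_le_of_ne (hnn x ω) (h x hx.1).symm, fun h z hz => ?_⟩
      obtain ⟨m, hm⟩ := exists_nat_ge (z - r)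
      exact (h m z ⟨hz, by linarith⟩).ne'
    rw [h1]
    exact .iInter fun m => nullMeasurableSet_forall_lt (fun x => (hb x).neg)
      (Eventually.of_forall fun ω => (hcont ω).neg) (by linarith [Nat.cast_nonneg (α := ℝ) m]) 0
  have hanti : Antitone fun n : ℕ => S (-n) := fun m n hmn ω hω z hz =>
    hω z (le_trans (neg_le_neg (Nat.cast_le.2 hmn)) hz)
  -- The events that there is no zero beyond `-n` decrease to the null event that there is no zero
  -- at all, but by stationarity they all have the same probability, which is therefore `0`.
  have hlim := tendsto_measure_iInter_atTop (μ := P) (fun n : ℕ => hS (-n)) hanti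
    ⟨0, measure_ne_top _ _⟩
  have h0 : P (⋂ n : ℕ, S (-n)) = 0 := by
    refine measure_mono_null (fun ω hω => ?_) (ae_iff.1 hzero)
    rintro ⟨z, hz⟩
    obtain ⟨n, hn⟩ := exists_nat_ge (-z)
    exact mem_iInter.1 hω n z (by linarith) hz
  have h1 : P (S 0) = 0 := by
    rw [h0] at hlim
    refine tendsto_nhds_unique ?_ hlim
    refine tendsto_const_nhds.congr fun n => ?_
    exact (hinv (-n)).symm
  have h2 : ∀ᵐ ω ∂P, ∀ n : ℕ, ω ∉ S n := ae_all_iff.2 fun n =>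
    measure_eq_zero_iff_ae_notMem.1 ((hinv n).trans h1)
  filter_upwards [h2] with ω hω x
  obtain ⟨n, hn⟩ := exists_nat_ge x
  have := hω n
  simp only [S, mem_ofPred_eq, not_forall, not_not] at this
  obtain ⟨z, hz, h0⟩ := this
  exact ⟨z, hn.trans hz, h0⟩

end Flow

end

/-! ### Assembly of the theorem -/

theorem proposition5p2
    {Ω : Type*} [TopologicalSpace Ω] [PolishSpace Ω] [MeasurableSpace Ω] [BorelSpace Ω]
    (P : Measure Ω) [IsProbabilityMeasure P]
    (τ : ℝ → Ω → Ω) (hτ : IsErgodicFlow P τ)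
    (a : ℝ → Ω → ℝ) (H : ℝ → ℝ → Ω → ℝ)
    (ha_meas : Measurable (fun q : ℝ × NullMeasurableSpace Ω P => a q.1 q.2))
    (hH_meas : Measurable (fun q : ℝ × ℝ × NullMeasurableSpace Ω P => H q.1 q.2.1 q.2.2))
    (ha_stat : ∀ x y ω, a (x + y) ω = a x (τ y ω))
    (hH_stat : ∀ x y p ω, H (x + y) p ω = H x p (τ y ω))
    (ha_range : ∀ x ω, a x ω ∈ Icc (0 : ℝ) 1)
    (hA1 : ∀ᵐ ω ∂P, (∃ x, a x ω ≠ 0) ∧ IsLeast (range fun x => a x ω) 0)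
    (κ : ℝ) (hκ : 0 < κ)
    (hA2 : ∀ ω x y, |√(a x ω) - √(a y ω)| ≤ κ * |x - y|)
    (α₀ α₁ γ η : ℝ) (hα₀ : 0 < α₀) (hα₁ : 0 < α₁) (hγ : 2 < γ) (hη : 0 < η)
    (hH : ∀ ω, IsSqcHamiltonian α₀ α₁ γ η (fun x p => H x p ω)) :
    ∃ l₀ : ℝ,
      -- the critical value is almost surely the constant `l₀`, and critical solutions exist
      (∀ᵐ ω ∂P, IsCriticalValue (fun x => a x ω) (fun x p => H x p ω) l₀ ∧
        ∃ v : ℝ → ℝ, IsLipschitzSolution (fun x => a x ω) (fun x p => H x p ω) l₀ v) ∧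
      -- for every choice of critical solutions
      ∀ v : Ω → ℝ → ℝ,
        (∀ᵐ ω ∂P, IsLipschitzSolution (fun x => a x ω) (fun x p => H x p ω) l₀ (v ω)) →
        -- the correctors are well defined and of class `C¹`, and their slopes are integrable
        (∀ᵐ ω ∂P, ∀ l : ℝ, l₀ < l →
          (∃! u : ℝ → ℝ, IsUpperCorrector (fun x => a x ω) (fun x p => H x p ω) (v ω) l u) ∧
          ContDiff ℝ 1 (upperCorrector (fun x => a x ω) (fun x p => H x p ω) (v ω) l) ∧
          (∃! u : ℝ → ℝ, IsLowerCorrector (fun x => a x ω) (fun x p => H x p ω) (v ω) l u) ∧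
          ContDiff ℝ 1 (lowerCorrector (fun x => a x ω) (fun x p => H x p ω) (v ω) l)) ∧
        (∀ l : ℝ, l₀ < l → Integrable (upperSlope a H v l) P ∧ Integrable (lowerSlope a H v l) P) ∧
        -- (i)
        (IsGLB (thetaPlus P a H v l₀ '' Ioi l₀) (thetaPlus P a H v l₀ l₀) ∧
          ContinuousOn (thetaPlus P a H v l₀) (Ici l₀) ∧
          Tendsto (thetaPlus P a H v l₀) atTop atTop ∧
          StrictMonoOn (thetaPlus P a H v l₀) (Ici l₀) ∧
          MapsTo (thetaPlus P a H v l₀) (Ioi l₀) (Ioi (thetaPlus P a H v l₀ l₀))) ∧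
        -- (ii)
        (IsLUB (thetaMinus P a H v l₀ '' Ioi l₀) (thetaMinus P a H v l₀ l₀) ∧
          ContinuousOn (thetaMinus P a H v l₀) (Ici l₀) ∧
          Tendsto (thetaMinus P a H v l₀) atTop atBot ∧
          StrictAntiOn (thetaMinus P a H v l₀) (Ici l₀) ∧
          MapsTo (thetaMinus P a H v l₀) (Ioi l₀) (Iio (thetaMinus P a H v l₀ l₀))) := by
  have ha : ∀ x, AEMeasurable (a x) P := fun x =>
    NullMeasurable.aemeasurable fun s hs => (ha_meas.comp measurable_prodMk_left) hs
  have hHm : ∀ x p, AEMeasurable (H x p) P := fun x p =>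
    NullMeasurable.aemeasurable fun s hs =>
      (hH_meas.comp (measurable_prodMk_left.comp measurable_prodMk_left)) hs
  have hcont : ∀ ω, Continuous fun x => a x ω := fun ω => by
    have h1 : Continuous fun x => √(a x ω) :=
      (LipschitzWith.of_dist_le_mul (K := ⟨κ, hκ.le⟩) fun x y => hA2 ω x y).continuous
    exact (h1.pow 2).congr fun x => Real.sq_sqrt (ha_range x ω).1
  have hzero : ∀ᵐ ω ∂P, ∃ z, a z ω = 0 := hA1.mono fun ω h => h.2.1
  have hright : ∀ᵐ ω ∂P, ∀ x, ∃ z ≥ x, a z ω = 0 := by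
    refine ae_exists_zero_ge ha hcont (fun x ω => (ha_range x ω).1) hzero fun r => ?_
    rw [← hτ.measure_preimage r {ω | ∀ z ≥ 0, a z ω ≠ 0}]
    congr 1
    ext ω
    simp only [mem_ofPred_eq, mem_preimage, ← ha_stat]
    exact ⟨fun h z hz => h _ (by linarith), fun h z hz => by
      simpa using h (z - r) (by linarith)⟩
  have hleft : ∀ᵐ ω ∂P, ∀ x, ∃ z ≥ x, a (-z) ω = 0 := by
    refine ae_exists_zero_ge (b := fun x => a (-x)) (fun x => ha (-x))
      (fun ω => (hcont ω).comp continuous_neg) (fun x ω => (ha_range _ ω).1)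
      (hzero.mono fun ω ⟨z, hz⟩ => ⟨-z, by simpa using hz⟩) fun r => ?_
    rw [← hτ.measure_preimage (-r) {ω | ∀ z ≥ 0, a (-z) ω ≠ 0}]
    congr 1
    ext ω
    simp only [mem_ofPred_eq, mem_preimage, ← ha_stat]
    exact ⟨fun h z hz => by simpa [neg_add_rev, add_comm] using h (z + r) (by linarith),
      fun h z hz => by simpa [neg_sub, sub_eq_add_neg, add_comm] using h (z - r) (by linarith)⟩
  have hE : ∀ᵐ ω ∂P, IsEnvironment α₀ α₁ γ κ (fun x => a x ω) fun x p => H x p ω := by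
    filter_upwards [hright, hleft] with ω h1 h2
    refine ⟨hα₀, hα₁, hγ, hκ, fun x => ha_range x ω, hA2 ω, (hH ω).toIsHamiltonian,
      (hH ω).strict_quasiconvex, fun x => ?_, h1⟩
    obtain ⟨z, hz, h0⟩ := h2 (-x)
    exact ⟨-z, by linarith, h0⟩
  -- Translation carries supersolutions for `ω` to supersolutions for `τ y ω`, and back by the
  -- inverse translation. The set of admissible levels, hence its infimum, is invariant for every
  -- `ω`, and ergodicity applies.
  obtain ⟨l₀, hl₀⟩ := hτ.exists_ae_eq_const (aemeasurable_criticalValue ha hHm hE) fun y ω => by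
    have key : ∀ (y : ℝ) (ω : Ω) (l : ℝ), (∃ u : ℝ → ℝ,
        IsViscositySupersolution (fun x => a x ω) (fun x p => H x p ω) l u) → ∃ u : ℝ → ℝ,
        IsViscositySupersolution (fun x => a x (τ y ω)) (fun x p => H x p (τ y ω)) l u := by
      rintro y ω l ⟨u, hu⟩
      refine ⟨fun x => u (x + y), ?_⟩
      simp only [← ha_stat, ← hH_stat]
      exact hu.translate y
    congr 1
    ext l
    refine ⟨fun h => ?_, key y ω l⟩
    have := key (-y) (τ y ω) l h
    rwa [hτ.neg_apply] at this
  have hc : ∀ᵐ ω ∂P, IsCriticalValue (fun x => a x ω) (fun x p => H x p ω) l₀ := by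
    filter_upwards [hE, hl₀] with ω E h0
    rw [← h0]; exact E.exists_isCriticalValue
  refine ⟨l₀, ?_, fun v hv => ⟨?_, fun l hl => ⟨integrable_upperSlope ha hHm hE hc hv hl,
    integrable_lowerSlope ha hHm hE hc hv hl⟩, thetaPlus_properties ha hHm hE hc hv,
    thetaMinus_properties ha hHm hE hc hv⟩⟩
  · filter_upwards [hE, hc] with ω E hcω
    exact ⟨hcω, E.exists_critical_solution hcω⟩
  · filter_upwards [ae_upperCorrector hE hc hv, ae_lowerCorrector hE hc hv] with ω h1 h2 l hl
    exact ⟨(h1 l hl).1, (h1 l hl).2.1, (h2 l hl).1, (h2 l hl).2.1⟩
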